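/- **Setting.** Let $K\ge 1$ and, for $j=1,\dots,K$, let $G_j^*(p)=B_j^*(p)/A_j^*(p)$, with $p=\mathrm d/\mathrm dt$, be a stable causal transfer function with coprime polynomials $A_j^*(p)=a^*_{j,n_j}p^{n_j}+\dots+a^*_{j,1}p+1$, $a^*_{j,n_j}\ne 0$, and $B_j^*(p)=b^*_{j,m_j}p^{m_j}+\dots+b^*_{j,0}$, $m_j\le n_j$. For $\theta_j=[a_{j,1},\dots,a_{j,n_j},b_{j,0},\dots,b_{j,m_j}]^\top$ write $A_j,B_j$ for the corresponding model polynomials; a model is called stable if $a_{j,n_j}\neq0$ and all zeros of $A_j$ have negative real part. The inputs are sampled at $t_k=kh$ ($h>0$) and interpolated with a known intersample behaviour (for instance zero- or first-order hold); $G(p)u(t_k)$ is the steady-state output at time $t_k$ of the filter $G(p)$ driven by the interpolated signal. The measured output is $y(t_k)=\sum_{j=1}^K G_j^*(p)u_j(t_k)+v(t_k)$, where $v$ has mean zero and the $u_j$ and $v$ have finite variance. **Algorithm.** Block coordinate descent produces, from the first $N$ samples, estimates $\theta_j^l$ ($l$ the descent iteration). Fix $l$ and $i$. With $\tilde y_i(t_k)=y(t_k)-\sum_{j<i}G_j(p,\theta_j^{l+1})u_j(t_k)-\sum_{j>i}G_j(p,\theta_j^{l})u_j(t_k)$,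 put, for $\theta\in\mathbb R^{n_i+m_i+1}$ with model polynomials $A,B$, $$e(t_k,\theta)=\tilde y_i(t_k)-\tfrac{B(p)}{A(p)}u_i(t_k),\qquad \tilde y_{\rm f}(t_k,\theta)=\tfrac1{A(p)}\tilde y_i(t_k),$$ $$\hat\varphi_{\rm f}(t_k,\theta)=\Big[\tfrac{-pB(p)}{A^2(p)}u_i(t_k),\dots,\tfrac{-p^{n_i}B(p)}{A^2(p)}u_i(t_k),\tfrac{1}{A(p)}u_i(t_k),\dots,\tfrac{p^{m_i}}{A(p)}u_i(t_k)\Big]^\top,$$ $$\varphi_{\rm f}(t_k,\theta)=\Big[\tfrac{-p}{A(p)}\tilde y_i(t_k),\dots,\tfrac{-p^{n_i}}{A(p)}\tilde y_i(t_k),\tfrac{1}{A(p)}u_i(t_k),\dots,\tfrac{p^{m_i}}{A(p)}u_i(t_k)\Big]^\top,$$ where $\tilde y_i$ is interpolated with some fixed intersample behaviour. The Gauss-Newton (GN) iterations are $$\theta_{s+1}=\Big[\tfrac1N\sum_{k=1}^N\hat\varphi_{\rm f}\hat\varphi_{\rm f}^\top\Big]^{-1}\Big[\tfrac1N\sum_{k=1}^N\hat\varphi_{\rm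 f}\Big(e+\tfrac{B(p)}{A^2(p)}u_i(t_k)\Big)\Big],$$ and the SRIVC iterations are $$\theta_{s+1}=\Big[\tfrac1N\sum_{k=1}^N\hat\varphi_{\rm f}\varphi_{\rm f}^\top\Big]^{-1}\Big[\tfrac1N\sum_{k=1}^N\hat\varphi_{\rm f}\tilde y_{\rm f}\Big],$$ all quantities being evaluated at $(t_k,\theta_s)$; the matrices being inverted are non-singular for all large $s$. **Theorem.** Assume that each $u_j(t_k)$ is persistently exciting of order at least $2n_j$ (the $2n_j\times2n_j$ matrix of its second moments is positive definite); that the inputs and the disturbance are jointly stationary and ergodic, and that each $u_j(t_k)$ is independent of $v(t_s)$ for all $k,s$; and that the iterates $\theta_{i,s}^{l+1}$ are stable models with coprime numerator and denominator. Then the following holds almost surely. Suppose that, for all $N$ sufficiently large, the GN (or the SRIVC) iterations for the $i$th submodel converge, with limit $\theta_i^{l+1}$, as $s\to\infty$. Let $(\bar\theta_1,\dots,\bar\theta_K)$ be any limit point of $(\theta_1^{l+1},\dots,\theta_i^{l+1},\theta_{i+1}^l,\dots,\theta_K^l)$ as $N\to\infty$, with polynomials $\bar A_j,\bar B_j$,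 such that all the limit models are stable and $\bar A_i,\bar B_i$ are coprime. Then, for every $k$, the expectations below exist and $$\sum_{j=1}^K \mathbb E\Big\{\frac1{\bar A_i^2(p)}\mathbf u_i(t_k)\,\frac1{A_j^*(p)\bar A_j(p)}\mathbf u_j^\top(t_k)\Big\}\eta_j=\mathbf 0 ,$$ where $\mathbf u_j(t_k)=[p^{n_j+m_j},p^{n_j+m_j-1},\dots,1]^\top u_j(t_k)$, the vector $\eta_j\in\mathbb R^{n_j+m_j+1}$ contains the coefficients of $A_j^*\bar B_j-\bar A_jB_j^*$ in descending order of degree, and the expectation is taken with the $\bar\theta_j$ held fixed. -/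

import Mathlib

open Filter Topology MeasureTheory ProbabilityTheory Polynomial

namespace SysId

noncomputable section

/-! ### Filtering a continuous-time signal through a proper rational transfer function -/

/-- The coefficients `c 0, c 1, c 2, …` of the expansion `N(s) / D(s) = ∑ k, c k * s⁻ᵏ` at `s = ∞`
of a proper rational function: with `s = 1 / x` and `d = deg D` it is the power series of
`x ^ d * N(1 / x)` divided by that of `x ^ d * D(1 / x)`. -/
def expansionAtInfty (N D : ℝ[X]) : PowerSeries ℝ :=
  (N.reflect D.natDegree : PowerSeries ℝ) * (D.reverse : PowerSeries ℝ)⁻¹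

/-- The direct feed-through `lim_{s → ∞} N(s) / D(s)`. -/
def feedthrough (N D : ℝ[X]) : ℝ := PowerSeries.coeff 0 (expansionAtInfty N D)

/-- The impulse response of the strictly proper part of `N(s) / D(s)`, at time `t ≥ 0`: the
inverse Laplace transform of `∑ k, c (k + 1) / s ^ (k + 1)` is `∑ k, c (k + 1) * t ^ k / k!`. -/
def impulseResponse (N D : ℝ[X]) (t : ℝ) : ℝ :=
  ∑' k : ℕ, PowerSeries.coeff (k + 1) (expansionAtInfty N D) * t ^ k / (k.factorial : ℝ)

/-- The (causal, steady-state) output at time `t` of the filter `N(p) / D(p)` driven by the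
signal `f`. -/
def filterOut (N D : ℝ[X]) (f : ℝ → ℝ) (t : ℝ) : ℝ :=
  feedthrough N D * f t + ∫ τ in Set.Ioi (0 : ℝ), impulseResponse N D τ * f (t - τ)

/-! ### Sampled signals and their intersample behaviour -/

/-- An intersample behaviour for the sampling period `h`, given by its interpolation kernel. The
zero-order hold is the indicator function of `[0, h)`, the first-order hold is
`fun t => max 0 (1 - |t| / h)`. -/
structure IsIntersample (h : ℝ) (κ : ℝ → ℝ) : Prop where
  measurable : Measurable κ
  bounded : ∃ C : ℝ, ∀ t, |κ t| ≤ C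
  compactSupport : HasCompactSupport κ
  interpolates : ∀ k : ℤ, κ (k * h) = if k = 0 then 1 else 0

/-- The continuous-time signal with samples `w k` at the times `k * h` and the intersample
behaviour `κ` (a finite sum for every `t`). -/
def interpolate (h : ℝ) (κ : ℝ → ℝ) (w : ℤ → ℝ) (t : ℝ) : ℝ :=
  ∑' k : ℤ, κ (t - k * h) * w k

/-- `(N(p) / D(p)) w(t_k)` where `t_k = k * h`, for a signal that is given by its samples `w` and
its intersample behaviour `κ`. -/
def filterSample (h : ℝ) (κ : ℝ → ℝ) (N D : ℝ[X]) (w : ℤ → ℝ) (k : ℤ) : ℝ :=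
  filterOut N D (interpolate h κ w) (k * h)

/-! ### Parametrization of the subsystems -/

/-- Parameter vectors `[a_1, …, a_n, b_0, …, b_m]`: the entry `Sum.inl r` is `a_{r+1}`, the entry
`Sum.inr r` is `b_r`. -/
abbrev Param (n m : ℕ) : Type := Fin n ⊕ Fin (m + 1) → ℝ

/-- `A(p) = a_n p ^ n + ⋯ + a_1 p + 1`. -/
def den {n m : ℕ} (θ : Param n m) : ℝ[X] :=
  1 + ∑ r : Fin n, C (θ (Sum.inl r)) * X ^ ((r : ℕ) + 1)

/-- `B(p) = b_m p ^ m + ⋯ + b_1 p + b_0`. -/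
def num {n m : ℕ} (θ : Param n m) : ℝ[X] :=
  ∑ r : Fin (m + 1), C (θ (Sum.inr r)) * X ^ (r : ℕ)

/-- The submodel has order `n` (that is, `a_n ≠ 0`) and all its poles lie in the open left
half-plane. -/
def IsStableModel {n m : ℕ} (θ : Param n m) : Prop :=
  (den θ).natDegree = n ∧ ∀ z : ℂ, aeval z (den θ) = 0 → z.re < 0

/-- Numerator and denominator are coprime. -/
def IsCoprimeModel {n m : ℕ} (θ : Param n m) : Prop := IsCoprime (num θ) (den θ)

/-- `K` stable subsystems `B_j^*(p) / A_j^*(p)` in parallel, each with its own input, sampled with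
period `h`; `κ j` is the intersample behaviour of the `j`th input and `κy` is the intersample
behaviour that the SRIVC iterations specify for the output. -/
structure System (K : ℕ) where
  n : Fin K → ℕ
  m : Fin K → ℕ
  m_le_n : ∀ j, m j ≤ n j
  θstar : ∀ j, Param (n j) (m j)
  stable : ∀ j, IsStableModel (θstar j)
  coprime : ∀ j, IsCoprimeModel (θstar j)
  h : ℝ
  h_pos : 0 < h
  κ : Fin K → ℝ → ℝ
  intersample : ∀ j, IsIntersample h (κ j)
  κy : ℝ → ℝ
  intersample_y : IsIntersample h κy

/-! ### The descent step for the `i`th submodel, on given data `u`, `y` -/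

section Algorithm

variable {K : ℕ} (S : System K) (u : Fin K → ℤ → ℝ) (y : ℤ → ℝ)

/-- `(N(p) / D(p)) u_j(t_k)`. -/
def System.filterInput (j : Fin K) (N D : ℝ[X]) (k : ℤ) : ℝ :=
  filterSample S.h (S.κ j) N D (u j) k

/-- The measured output `y(t_k) = ∑ j, G_j^*(p) u_j(t_k) + v(t_k)`. -/
def System.output (v : ℤ → ℝ) (k : ℤ) : ℝ :=
  ∑ j, S.filterInput u j (num (S.θstar j)) (den (S.θstar j)) k + v k

/-- The residual output `ỹ_i(t_k)` when the submodels `j ≠ i` have the parameters `β j`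
(the entry `β i` is not used). -/
def System.residualOutput (i : Fin K) (β : ∀ j, Param (S.n j) (S.m j)) (k : ℤ) : ℝ :=
  y k - ∑ j ∈ Finset.univ.erase i, S.filterInput u j (num (β j)) (den (β j)) k

/-- The gradient (instrument) vector `φ̂_f(t_k, θ)`. -/
def System.gradient (i : Fin K) (θ : Param (S.n i) (S.m i)) (k : ℤ) : Param (S.n i) (S.m i)
  | Sum.inl r => S.filterInput u i (-(X ^ ((r : ℕ) + 1) * num θ)) (den θ ^ 2) k
  | Sum.inr r => S.filterInput u i (X ^ (r : ℕ)) (den θ) k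

/-- The total residual `e(t_k, θ)`. -/
def System.residual (i : Fin K) (β : ∀ j, Param (S.n j) (S.m j)) (θ : Param (S.n i) (S.m i))
    (k : ℤ) : ℝ :=
  S.residualOutput u y i β k - S.filterInput u i (num θ) (den θ) k

/-- The filtered regressor `φ_f(t_k, θ)`. -/
def System.regressor (i : Fin K) (β : ∀ j, Param (S.n j) (S.m j)) (θ : Param (S.n i) (S.m i))
    (k : ℤ) : Param (S.n i) (S.m i)
  | Sum.inl r =>
      filterSample S.h S.κy (-X ^ ((r : ℕ) + 1)) (den θ) (S.residualOutput u y i β) k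
  | Sum.inr r => S.filterInput u i (X ^ (r : ℕ)) (den θ) k

/-- The filtered residual output `ỹ_f(t_k, θ)`. -/
def System.filteredOutput (i : Fin K) (β : ∀ j, Param (S.n j) (S.m j))
    (θ : Param (S.n i) (S.m i)) (k : ℤ) : ℝ :=
  filterSample S.h S.κy 1 (den θ) (S.residualOutput u y i β) k

/-- The two ways of computing the descent step: Gauss-Newton iterations and SRIVC iterations. -/
inductive Method where
  | gaussNewton
  | srivc

/-- The (modified) normal matrix that the iteration inverts, for the sample size `N`. -/
def System.normalMatrix (i : Fin K) (β : ∀ j, Param (S.n j) (S.m j)) (N : ℕ)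
    (θ : Param (S.n i) (S.m i)) :
    Method → Matrix (Fin (S.n i) ⊕ Fin (S.m i + 1)) (Fin (S.n i) ⊕ Fin (S.m i + 1)) ℝ
  | Method.gaussNewton => (1 / (N : ℝ)) • ∑ k ∈ Finset.Icc 1 N,
      Matrix.vecMulVec (S.gradient u i θ k) (S.gradient u i θ k)
  | Method.srivc => (1 / (N : ℝ)) • ∑ k ∈ Finset.Icc 1 N,
      Matrix.vecMulVec (S.gradient u i θ k) (S.regressor u y i β θ k)

/-- The vector that the iteration multiplies by the inverse of the normal matrix. -/
def System.normalVector (i : Fin K) (β : ∀ j, Param (S.n j) (S.m j)) (N : ℕ)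
    (θ : Param (S.n i) (S.m i)) : Method → Param (S.n i) (S.m i)
  | Method.gaussNewton => (1 / (N : ℝ)) • ∑ k ∈ Finset.Icc 1 N,
      (S.residual u y i β θ k + S.filterInput u i (num θ) (den θ ^ 2) k) • S.gradient u i θ k
  | Method.srivc => (1 / (N : ℝ)) • ∑ k ∈ Finset.Icc 1 N,
      S.filteredOutput u y i β θ k • S.gradient u i θ k

/-- `θs 0, θs 1, …` are the iterates of the method for the `i`th submodel (from an arbitrary
initial estimate), and the matrices being inverted are non-singular for all large `s`. -/
def System.IsIteration (mth : Method) (i : Fin K) (β : ∀ j, Param (S.n j) (S.m j)) (N : ℕ)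
    (θs : ℕ → Param (S.n i) (S.m i)) : Prop :=
  (∀ s, θs (s + 1) =
    (S.normalMatrix u y i β N (θs s) mth)⁻¹.mulVec (S.normalVector u y i β N (θs s) mth)) ∧
  ∀ᶠ s in atTop, IsUnit (S.normalMatrix u y i β N (θs s) mth).det

/-- The parameters of all submodels at the descent iteration `l`, right after the update of the
`i`th one: `θ_j^{l+1}` for `j ≤ i` and `θ_j^l` for `j > i`. -/
def System.blocks (θ : ℕ → ∀ j, Param (S.n j) (S.m j)) (l : ℕ) (i : Fin K) :
    ∀ j, Param (S.n j) (S.m j) :=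
  fun j => if j ≤ i then θ (l + 1) j else θ l j

end Algorithm

/-! ### The stochastic setting and the quantities of the limit equation -/

section Stochastic

variable {Ω : Type*} [MeasurableSpace Ω]

/-- The inputs and the disturbance have finite variance and are jointly stationary and ergodic
(that is, the shift is measure preserving and ergodic for the law of the joint process); each
input sample is independent of each disturbance sample, and the disturbance has mean zero. -/
structure IsStationaryData {K : ℕ} (P : Measure Ω) (u : Fin K → ℤ → Ω → ℝ) (v : ℤ → Ω → ℝ) :
    Prop where
  measurable_u : ∀ j k, Measurable (u j k)
  measurable_v : ∀ k, Measurable (v k)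
  memLp_u : ∀ j k, MemLp (u j k) 2 P
  memLp_v : ∀ k, MemLp (v k) 2 P
  mean_v : ∀ k, ∫ ω, v k ω ∂P = 0
  ergodic : Ergodic (fun (w : ℤ → (Fin K → ℝ) × ℝ) (k : ℤ) => w (k + 1))
    (P.map fun ω k => (fun j => u j k ω, v k ω))
  indep : ∀ j k s, IndepFun (u j k) (v s) P

/-- Persistence of excitation of order `d` (or more) of a stationary sequence: the `d × d` matrix
of its second moments is positive definite. -/
def IsPersistentlyExciting (P : Measure Ω) (w : ℤ → Ω → ℝ) (d : ℕ) : Prop :=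
  (Matrix.of fun a b : Fin d => ∫ ω, w (a : ℕ) ω * w (b : ℕ) ω ∂P).PosDef

variable {K : ℕ} (S : System K)

/-- The vector `(1 / D(p)) 𝐮_j(t_k)`, where
`𝐮_j(t_k) = [p ^ (n_j + m_j), p ^ (n_j + m_j - 1), …, 1]ᵀ u_j(t_k)`. -/
def System.filteredStack (u : Fin K → ℤ → ℝ) (j : Fin K) (D : ℝ[X]) (k : ℤ) :
    Fin (S.n j + S.m j + 1) → ℝ :=
  fun r => S.filterInput u j (X ^ (S.n j + S.m j - (r : ℕ))) D k

/-- The product whose expectation is the entry `(r, c)` of the `j`th matrix of the limit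
equation, as a random variable. -/
def System.momentEntry (u : Fin K → ℤ → Ω → ℝ) (i j : Fin K) (θ : ∀ j, Param (S.n j) (S.m j))
    (k : ℤ) (r : Fin (S.n i + S.m i + 1)) (c : Fin (S.n j + S.m j + 1)) (ω : Ω) : ℝ :=
  S.filteredStack (fun j k => u j k ω) i (den (θ i) ^ 2) k r *
    S.filteredStack (fun j k => u j k ω) j (den (S.θstar j) * den (θ j)) k c

/-- The matrix `𝔼 {(1 / Ā_i²(p)) 𝐮_i(t_k) · (1 / (A_j^*(p) Ā_j(p))) 𝐮_jᵀ(t_k)}`. -/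
def System.momentMatrix (P : Measure Ω) (u : Fin K → ℤ → Ω → ℝ) (i j : Fin K)
    (θ : ∀ j, Param (S.n j) (S.m j)) (k : ℤ) :
    Matrix (Fin (S.n i + S.m i + 1)) (Fin (S.n j + S.m j + 1)) ℝ :=
  Matrix.of fun r c => ∫ ω, S.momentEntry u i j θ k r c ω ∂P

/-- The vector `η_j` of the coefficients of `A_j^* B̄_j - Ā_j B_j^*` in descending order of
degree. -/
def System.biasVector (j : Fin K) (θ : Param (S.n j) (S.m j)) : Fin (S.n j + S.m j + 1) → ℝ :=
  fun r => (den (S.θstar j) * num θ - den θ * num (S.θstar j)).coeff (S.n j + S.m j - (r : ℕ))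

end Stochastic

end

end SysId

open SysId

/-! A limit of either iteration makes the residual orthogonal to the gradient, whatever the sample
size. Both methods solve a linear regression whose error at the current parameter is the total
residual: for Gauss-Newton because the gradient vector times `θ` is `(B / A²) u`, for SRIVC because
`1 / A - (1 - A) / A = 1`. Passing to the limit in `s` gives `∑ k, gradient * residual = 0` at the
limiting estimate (`System.IsIteration.sum_gradient_mul_residual`).

To let `N → ∞`, each sampled filter is written as a convolution of the samples with a two-sided
kernel. Near a stable parameter the poles stay uniformly inside the left half-plane, so the kernels
obey a common exponential bound and converge pointwise (`tendsto_filterKernel`). By the ergodic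
theorem almost every path is typical (`IsStationaryData.ae_isTypical`): averages of products of two
delayed samples converge to second moments, and averages of delayed squares grow subexponentially in
the delay. For a typical path, dominated convergence over the lags gives the limit of averages of
filtered signals even when the filters depend on `N` (`IsTypical.tendsto_average_conv`). The
exceptional null set depends only on the data, so it is fixed before any estimates are chosen.

Consequently, along any filter on which the estimates tend to stable limits, the averages at the
estimates and those at the frozen limit `θbar` have the same limit, which is zero. Coprimeness of
the limiting `i`th model makes the gradient numerators over `A²` span all polynomials of degree at
most `n + m` (`exists_sum_C_mul_gradientNum_eq`), so the gradient may be replaced by `X ^ e / A²`.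
The disturbance drops out by independence and zero mean. The rest of the residual, over common
denominators, is minus the sum of the filtered stacks times the vectors `η_j`. The resulting lag
sums are the expectations of the limit equation (`System.integrable_momentEntry`). -/

namespace SysId

/-! ### The pointwise ergodic theorem -/

section Birkhoff

variable {α : Type*} {T : α → α} {f : α → ℝ}

/-- The maximum of `0` and the first `n` nonempty Birkhoff sums. -/
def maxBirkhoffSum (T : α → α) (f : α → ℝ) : ℕ → α → ℝ
  | 0, _ => 0
  | n + 1, x => max 0 (f x + maxBirkhoffSum T f n (T x))

theorem maxBirkhoffSum_nonneg (n : ℕ) (x : α) : 0 ≤ maxBirkhoffSum T f n x := by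
  cases n with
  | zero => exact le_rfl
  | succ n => exact le_max_left _ _

theorem maxBirkhoffSum_le_succ (n : ℕ) (x : α) :
    maxBirkhoffSum T f n x ≤ maxBirkhoffSum T f (n + 1) x := by
  induction n generalizing x with
  | zero => exact maxBirkhoffSum_nonneg 1 x
  | succ n ih => exact max_le_max le_rfl (add_le_add le_rfl (ih (T x)))

theorem birkhoffSum_le_maxBirkhoffSum (n : ℕ) (x : α) :
    birkhoffSum T f n x ≤ maxBirkhoffSum T f n x := by
  induction n generalizing x with
  | zero => simp [maxBirkhoffSum]
  | succ n ih =>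
    rw [birkhoffSum_succ']
    exact (add_le_add le_rfl (ih (T x))).trans (le_max_right _ _)

variable [MeasurableSpace α] {μ : Measure α}

theorem integrable_maxBirkhoffSum (hT : MeasurePreserving T μ μ) (hf : Integrable f μ) (n : ℕ) :
    Integrable (maxBirkhoffSum T f n) μ := by
  induction n with
  | zero => exact integrable_zero _ _ _
  | succ n ih => exact (integrable_zero α ℝ μ).sup (hf.add (hT.integrable_comp_of_integrable ih))

theorem measurable_maxBirkhoffSum (hT : Measurable T) (hf : Measurable f) (n : ℕ) :
    Measurable (maxBirkhoffSum T f n) := by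
  induction n with
  | zero => exact measurable_const
  | succ n ih => exact measurable_const.max (hf.add (ih.comp hT))

/-- The set where the maxima `M n` stay bounded is invariant, hence null or of full measure. If it
were null, then `M n ∘ T → ∞` almost everywhere, so `M (n + 1) - M n ∘ T = max (-M n ∘ T) f` would
tend to `f`, dominated by `|f|`. But the integral of the left-hand side is `∫ (M (n + 1) - M n) ≥
0`, which contradicts `∫ f < 0`. -/
theorem ae_bddAbove_maxBirkhoffSum (hT : Ergodic T μ) (hfm : Measurable f) (hf : Integrable f μ)
    (hneg : ∫ x, f x ∂μ < 0) :
    ∀ᵐ x ∂μ, BddAbove (Set.range fun n => maxBirkhoffSum T f n x) := by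
  set A : Set α := {x | BddAbove (Set.range fun n => maxBirkhoffSum T f n x)} with hA
  have hAm : MeasurableSet A :=
    measurableSet_bddAbove_range fun n => measurable_maxBirkhoffSum hT.measurable hfm n
  have hinv : T ⁻¹' A = A := by
    ext x
    constructor
    · rintro ⟨C, hC⟩
      refine ⟨max 0 (f x + C), ?_⟩
      rintro _ ⟨n, rfl⟩
      refine (maxBirkhoffSum_le_succ n x).trans ?_
      exact max_le_max le_rfl (add_le_add le_rfl (hC ⟨n, rfl⟩))
    · rintro ⟨C, hC⟩
      refine ⟨C - f x, ?_⟩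
      rintro _ ⟨n, rfl⟩
      have h1 : maxBirkhoffSum T f (n + 1) x ≤ C := hC ⟨n + 1, rfl⟩
      have h2 : f x + maxBirkhoffSum T f n (T x) ≤ maxBirkhoffSum T f (n + 1) x := le_max_right _ _
      show maxBirkhoffSum T f n (T x) ≤ C - f x
      linarith
  rcases hT.toPreErgodic.ae_mem_or_ae_notMem hAm hinv with h | h
  · exact h
  exfalso
  have hlim : Tendsto (fun n => ∫ x, max (-maxBirkhoffSum T f n (T x)) (f x) ∂μ) atTop
      (𝓝 (∫ x, f x ∂μ)) := by
    refine tendsto_integral_of_dominated_convergence (fun x => |f x|) (fun n => ?_) hf.abs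
      (fun n => ?_) ?_
    · exact ((measurable_maxBirkhoffSum hT.measurable hfm n).comp hT.measurable).neg.max hfm
        |>.aestronglyMeasurable
    · refine ae_of_all _ fun x => ?_
      have h0 := maxBirkhoffSum_nonneg (T := T) (f := f) n (T x)
      rw [Real.norm_eq_abs, abs_le]
      constructor
      · exact (neg_abs_le _).trans (le_max_right _ _)
      · exact max_le (by have := abs_nonneg (f x); linarith) (le_abs_self _)
    · filter_upwards [h] with x hx
      have hx' : ¬ BddAbove (Set.range fun n => maxBirkhoffSum T f n (T x)) := fun hc =>
        hx (by have : x ∈ T ⁻¹' A := hc; rwa [hinv] at this)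
      have hmono : Monotone fun n => maxBirkhoffSum T f n (T x) :=
        monotone_nat_of_le_succ fun n => maxBirkhoffSum_le_succ n (T x)
      have htop := tendsto_atTop_of_monotone hmono |>.resolve_right ?_
      · refine tendsto_const_nhds.congr' ?_
        filter_upwards [htop.eventually_ge_atTop (-f x)] with n hn
        rw [max_eq_right (by linarith)]
      · rintro ⟨l, hl⟩
        exact hx' hl.bddAbove_range
  refine absurd (ge_of_tendsto' hlim fun n => ?_) (not_le.2 hneg)
  have hint := integrable_maxBirkhoffSum hT.toMeasurePreserving hf n
  have hcomp : ∫ x, maxBirkhoffSum T f n (T x) ∂μ = ∫ x, maxBirkhoffSum T f n x ∂μ := by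
    conv_rhs => rw [← hT.map_eq]
    exact (integral_map hT.measurable.aemeasurable
      (by rw [hT.map_eq]; exact hint.aestronglyMeasurable)).symm
  have heq : ∀ x, max (-maxBirkhoffSum T f n (T x)) (f x)
      = maxBirkhoffSum T f (n + 1) x - maxBirkhoffSum T f n (T x) := fun x => by
    simp only [maxBirkhoffSum]
    rw [← max_sub_sub_right]; simp
  simp_rw [heq]
  have hint' : Integrable (fun x => maxBirkhoffSum T f n (T x)) μ :=
    hT.toMeasurePreserving.integrable_comp_of_integrable hint
  rw [integral_sub (integrable_maxBirkhoffSum hT.toMeasurePreserving hf (n + 1)) hint', hcomp,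
    sub_nonneg]
  exact integral_mono hint (integrable_maxBirkhoffSum hT.toMeasurePreserving hf (n + 1))
    fun x => maxBirkhoffSum_le_succ n x

/-- For `b` strictly between the mean and `a`, the Birkhoff sums of `f - b` are bounded above by
some `C`, so the averages of `f` are at most `b + C / n`. -/
theorem ae_eventually_birkhoffSum_le [IsProbabilityMeasure μ] (hT : Ergodic T μ)
    (hfm : Measurable f) (hf : Integrable f μ) {a : ℝ} (ha : ∫ x, f x ∂μ < a) :
    ∀ᵐ x ∂μ, ∀ᶠ n : ℕ in atTop, birkhoffSum T f n x / n < a := by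
  obtain ⟨b, hb, hba⟩ := exists_between ha
  have hneg : ∫ x, (f x - b) ∂μ < 0 := by
    rw [integral_sub hf (integrable_const b)]; simpa using hb
  filter_upwards [ae_bddAbove_maxBirkhoffSum hT (hfm.sub_const b) (hf.sub (integrable_const b))
    hneg] with x hx
  obtain ⟨C, hC⟩ := hx
  have hlim : Tendsto (fun n : ℕ => C / (n : ℝ)) atTop (𝓝 0) :=
    tendsto_const_div_atTop_nhds_zero_nat C
  filter_upwards [hlim.eventually_lt_const (sub_pos.2 hba), eventually_gt_atTop 0] with n hn hn0
  have h1 := (birkhoffSum_le_maxBirkhoffSum (T := T) (f := fun x => f x - b) n x).trans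
    (hC ⟨n, rfl⟩)
  have h2 : birkhoffSum T (fun x => f x - b) n x = birkhoffSum T f n x - n * b := by
    simp [birkhoffSum]
  have hn' : (0 : ℝ) < n := by exact_mod_cast hn0
  rw [div_lt_iff₀ hn'] at hn ⊢
  rw [h2] at h1
  nlinarith

/-- The pointwise ergodic theorem of Birkhoff, for an ergodic transformation. -/
theorem ae_tendsto_birkhoffSum_div [IsProbabilityMeasure μ] (hT : Ergodic T μ)
    (hfm : Measurable f) (hf : Integrable f μ) :
    ∀ᵐ x ∂μ, Tendsto (fun n : ℕ => birkhoffSum T f n x / n) atTop (𝓝 (∫ x, f x ∂μ)) := by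
  obtain ⟨r, hr, hr0, hrl⟩ := exists_seq_strictAnti_tendsto (0 : ℝ)
  have hup : ∀ᵐ x ∂μ, ∀ q : ℕ, ∀ᶠ n : ℕ in atTop,
      birkhoffSum T f n x / n < ∫ x, f x ∂μ + r q :=
    ae_all_iff.2 fun q => ae_eventually_birkhoffSum_le hT hfm hf (by linarith [hr0 q])
  have hlo : ∀ᵐ x ∂μ, ∀ q : ℕ, ∀ᶠ n : ℕ in atTop,
      birkhoffSum T (fun x => -f x) n x / n < -∫ x, f x ∂μ + r q :=
    ae_all_iff.2 fun q => ae_eventually_birkhoffSum_le hT hfm.neg hf.neg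
      (by simp only [Pi.neg_apply, integral_neg]; linarith [hr0 q])
  filter_upwards [hup, hlo] with x h1 h2
  rw [Metric.tendsto_nhds]
  intro ε hε
  obtain ⟨q, hq⟩ := (hrl.eventually_lt_const hε).exists
  filter_upwards [h1 q, h2 q] with n hn1 hn2
  have h3 : birkhoffSum T (fun x => -f x) n x = -birkhoffSum T f n x := by simp [birkhoffSum]
  rw [h3, neg_div] at hn2
  rw [Real.dist_eq, abs_lt]
  constructor <;> linarith

/-- Summation over `1, …, n` instead of `0, …, n - 1` is the Birkhoff average at the point `T x`. -/
theorem ae_tendsto_sum_Icc_iterate [IsProbabilityMeasure μ] (hT : Ergodic T μ)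
    (hfm : Measurable f) (hf : Integrable f μ) :
    ∀ᵐ x ∂μ, Tendsto (fun n : ℕ => (1 / (n : ℝ)) * ∑ k ∈ Finset.Icc 1 n, f (T^[k] x)) atTop
      (𝓝 (∫ x, f x ∂μ)) := by
  have h := hT.quasiMeasurePreserving.ae (ae_tendsto_birkhoffSum_div hT hfm hf)
  filter_upwards [h] with x hx
  refine hx.congr fun n => ?_
  have hI : Finset.Icc 1 n = Finset.Ico (0 + 1) (n + 1) := by ext k; simp
  rw [birkhoffSum, div_eq_inv_mul, one_div, hI, ← Finset.sum_Ico_add', Finset.range_eq_Ico]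
  rfl

end Birkhoff

/-! ### Differentiation of exponential generating functions -/

section ExponentialGeneratingFunctions

theorem summable_mul_pow_div_factorial {a : ℕ → ℂ} {C B : ℝ} (ha : ∀ k, ‖a k‖ ≤ C * B ^ k)
    (t : ℝ) : Summable fun k : ℕ => a k * (t : ℂ) ^ k / (k.factorial : ℂ) := by
  refine Summable.of_norm_bounded (g := fun k : ℕ => C * ((B * |t|) ^ k / (k.factorial : ℝ)))
    ((Real.summable_pow_div_factorial _).mul_left C) fun k => ?_
  rw [norm_div, norm_mul, norm_pow, Complex.norm_real, Complex.norm_natCast, Real.norm_eq_abs,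
    mul_pow, ← mul_div_assoc, ← mul_assoc]
  gcongr
  exact ha k

/-- Termwise differentiation shifts the coefficients. Geometric growth of `a` dominates the
derivatives by an exponential series, uniformly on the ball of radius `|t| + 1`. -/
theorem hasDerivAt_tsum_mul_pow_div_factorial {a : ℕ → ℂ} {C B : ℝ}
    (ha : ∀ k, ‖a k‖ ≤ C * B ^ k) (t : ℝ) :
    HasDerivAt (fun s : ℝ => ∑' k : ℕ, a k * (s : ℂ) ^ k / (k.factorial : ℂ))
      (∑' k : ℕ, a (k + 1) * (t : ℂ) ^ k / (k.factorial : ℂ)) t := by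
  have hshift : ∀ (k : ℕ) (y : ℂ),
      a (k + 1) * (((k + 1 : ℕ) : ℂ) * y ^ (k + 1 - 1)) / ((k + 1).factorial : ℂ)
        = a (k + 1) * y ^ k / (k.factorial : ℂ) := fun k y => by
    have h1 : ((k + 1 : ℕ) : ℂ) ≠ 0 := Nat.cast_ne_zero.2 k.succ_ne_zero
    have h2 : (k.factorial : ℂ) ≠ 0 := Nat.cast_ne_zero.2 k.factorial_ne_zero
    rw [Nat.factorial_succ, Nat.cast_mul, Nat.add_sub_cancel]
    field_simp
  have ha' : ∀ k, ‖a (k + 1)‖ ≤ C * B * B ^ k := fun k => by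
    have := ha (k + 1); rwa [pow_succ', ← mul_assoc] at this
  have hsum := summable_mul_pow_div_factorial ha' t
  let u : ℕ → ℝ := fun n => match n with
    | 0 => 0
    | k + 1 => C * B * ((B * (|t| + 1)) ^ k / (k.factorial : ℝ))
  have hu : Summable u := by
    rw [← summable_nat_add_iff 1]
    exact (Real.summable_pow_div_factorial (B * (|t| + 1))).mul_left (C * B)
  have hC : 0 ≤ C := by have := (norm_nonneg _).trans (ha 0); simpa using this
  have key := hasDerivAt_tsum_of_isPreconnected (𝕜 := ℝ)
    (g := fun (k : ℕ) (s : ℝ) => a k * (s : ℂ) ^ k / (k.factorial : ℂ))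
    (g' := fun (k : ℕ) (s : ℝ) => a k * ((k : ℂ) * (s : ℂ) ^ (k - 1)) / (k.factorial : ℂ))
    (u := u) (t := Metric.ball (0 : ℝ) (|t| + 1)) (y₀ := t) (y := t) hu Metric.isOpen_ball
    (convex_ball _ _).isPreconnected ?_ ?_ (by simp) (summable_mul_pow_div_factorial ha t) (by simp)
  · refine key.congr_deriv ?_
    have hs : Summable fun k : ℕ => a k * ((k : ℂ) * (t : ℂ) ^ (k - 1)) / (k.factorial : ℂ) := by
      rw [← summable_nat_add_iff 1]
      exact hsum.congr fun k => (hshift k t).symm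
    rw [hs.tsum_eq_zero_add]
    simp only [hshift]
    simp
  · intro n y _
    have h1 : HasDerivAt (fun s : ℝ => (s : ℂ) ^ n) ((n : ℂ) * (y : ℂ) ^ (n - 1)) y := by
      simpa using (hasDerivAt_pow n (y : ℂ)).comp_ofReal
    exact (h1.const_mul (a n)).div_const _
  · intro n y hy
    cases n with
    | zero => simp [u]
    | succ k =>
      rw [hshift, norm_div, norm_mul, norm_pow, Complex.norm_real, Complex.norm_natCast]
      have hy' : ‖y‖ ≤ |t| + 1 := by simpa using (mem_ball_zero_iff.1 hy).le
      show _ ≤ C * B * ((B * (|t| + 1)) ^ k / (k.factorial : ℝ))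
      rw [mul_pow, ← mul_div_assoc, ← mul_assoc]
      gcongr
      · exact (norm_nonneg _).trans (ha' k)
      · exact ha' k

end ExponentialGeneratingFunctions

/-! ### Exponential decay of impulse responses, one pole at a time -/

section Decay

/-- The inverse Laplace transform of `∑ k, c (k + 1) / s ^ (k + 1)`, as a function of the power
series `∑ k, c k * x ^ k`. -/
noncomputable def borelTransform (F : PowerSeries ℂ) (t : ℝ) : ℂ :=
  ∑' k : ℕ, PowerSeries.coeff (k + 1) F * (t : ℂ) ^ k / (k.factorial : ℂ)

/-- The coefficients of `F` grow at most geometrically, and the corresponding impulse response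
decays exponentially. -/
structure HasExpBound (C B ε : ℝ) (F : PowerSeries ℂ) : Prop where
  coeff_le : ∀ k, ‖PowerSeries.coeff k F‖ ≤ C * B ^ k
  decay : ∀ t : ℝ, 0 ≤ t → ‖borelTransform F t‖ ≤ C * Real.exp (-ε * t)

variable {C B ε : ℝ} {F : PowerSeries ℂ}

theorem HasExpBound.nonneg (hF : HasExpBound C B ε F) : 0 ≤ C := by
  simpa using (norm_nonneg _).trans (hF.coeff_le 0)

theorem coeff_succ_le_of_coeff_le (h : ∀ k, ‖PowerSeries.coeff k F‖ ≤ C * B ^ k) (k : ℕ) :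
    ‖PowerSeries.coeff (k + 1) F‖ ≤ C * B * B ^ k := by
  have := h (k + 1); rwa [pow_succ', ← mul_assoc] at this

theorem hasDerivAt_borelTransform (h : ∀ k, ‖PowerSeries.coeff k F‖ ≤ C * B ^ k) (t : ℝ) :
    HasDerivAt (borelTransform F)
      (∑' k : ℕ, PowerSeries.coeff (k + 2) F * (t : ℂ) ^ k / (k.factorial : ℂ)) t :=
  hasDerivAt_tsum_mul_pow_div_factorial (coeff_succ_le_of_coeff_le h) t

theorem HasExpBound.summable (hF : HasExpBound C B ε F) (t : ℝ) :
    Summable fun k : ℕ => PowerSeries.coeff (k + 1) F * (t : ℂ) ^ k / (k.factorial : ℂ) :=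
  summable_mul_pow_div_factorial (coeff_succ_le_of_coeff_le hF.coeff_le) t

theorem HasExpBound.add {C' : ℝ} {G : PowerSeries ℂ} (hF : HasExpBound C B ε F)
    (hG : HasExpBound C' B ε G) : HasExpBound (C + C') B ε (F + G) where
  coeff_le k := by
    rw [map_add, add_mul]
    exact (norm_add_le _ _).trans (add_le_add (hF.coeff_le k) (hG.coeff_le k))
  decay t ht := by
    have : borelTransform (F + G) t = borelTransform F t + borelTransform G t := by
      rw [borelTransform, borelTransform, borelTransform,
        ← (hF.summable t).tsum_add (hG.summable t)]
      refine tsum_congr fun k => ?_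
      rw [map_add]; ring
    rw [this, add_mul]
    exact (norm_add_le _ _).trans (add_le_add (hF.decay t ht) (hG.decay t ht))

theorem HasExpBound.C_mul (hF : HasExpBound C B ε F) (z : ℂ) :
    HasExpBound (‖z‖ * C) B ε (PowerSeries.C z * F) where
  coeff_le k := by
    rw [PowerSeries.coeff_C_mul, norm_mul, mul_assoc]
    exact mul_le_mul_of_nonneg_left (hF.coeff_le k) (norm_nonneg z)
  decay t ht := by
    have : borelTransform (PowerSeries.C z * F) t = z * borelTransform F t := by
      rw [borelTransform, borelTransform, ← tsum_mul_left]
      refine tsum_congr fun k => ?_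
      rw [PowerSeries.coeff_C_mul]; ring
    rw [this, norm_mul, mul_assoc]
    exact mul_le_mul_of_nonneg_left (hF.decay t ht) (norm_nonneg z)

theorem HasExpBound.mono {C' : ℝ} (hF : HasExpBound C B ε F) (hB : 0 ≤ B) (h : C ≤ C') :
    HasExpBound C' B ε F where
  coeff_le k := (hF.coeff_le k).trans (by gcongr)
  decay t ht := (hF.decay t ht).trans (by gcongr)

theorem HasExpBound.zero : HasExpBound 0 B ε 0 where
  coeff_le k := by simp
  decay t _ := by simp [borelTransform]

theorem HasExpBound.one (hB : 1 ≤ B) : HasExpBound 1 B ε 1 where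
  coeff_le k := by
    rw [PowerSeries.coeff_one, one_mul]
    have := one_le_pow₀ (n := k) hB
    split_ifs <;> simp <;> linarith
  decay t _ := by
    simp [borelTransform, PowerSeries.coeff_one, Real.exp_nonneg]

theorem HasExpBound.sum {ι : Type*} (s : Finset ι) {c : ι → ℝ} {f : ι → PowerSeries ℂ}
    (h : ∀ i ∈ s, HasExpBound (c i) B ε (f i)) :
    HasExpBound (∑ i ∈ s, c i) B ε (∑ i ∈ s, f i) := by
  classical
  induction s using Finset.induction_on with
  | empty => simpa using HasExpBound.zero
  | insert a s ha ih =>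
    rw [Finset.sum_insert ha, Finset.sum_insert ha]
    exact (h a (Finset.mem_insert_self a s)).add
      (ih fun i hi => h i (Finset.mem_insert_of_mem hi))

/-- Multiplication by `x / (1 - z * x)` (that is, by `1 / (s - z)`) preserves exponential
bounds. -/
theorem HasExpBound.mul_X_div {ε₁ : ℝ} {z : ℂ} {H : PowerSeries ℂ} (hF : HasExpBound C B ε F)
    (hz : ‖z‖ + 1 ≤ B) (hre : z.re ≤ -ε₁) (hε : ε < ε₁)
    (hH : H * (1 - PowerSeries.C z * PowerSeries.X) = PowerSeries.X * F) :
    HasExpBound (C * (1 + 1 / (ε₁ - ε))) B ε H := by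
  have hC := hF.nonneg
  have hz0 := norm_nonneg z
  have hd : 0 < ε₁ - ε := sub_pos.2 hε
  have hH' : H = H * PowerSeries.C z * PowerSeries.X + PowerSeries.X * F := by
    rw [← hH]; ring
  have h0 : PowerSeries.coeff 0 H = 0 := by
    rw [hH']; simp
  have hs : ∀ k, PowerSeries.coeff (k + 1) H
      = z * PowerSeries.coeff k H + PowerSeries.coeff k F := fun k => by
    conv_lhs => rw [hH']
    rw [map_add, PowerSeries.coeff_succ_mul_X, PowerSeries.coeff_succ_X_mul,
      PowerSeries.coeff_mul_C, mul_comm]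
  -- The recursion multiplies the bound by at most `‖z‖ + 1 ≤ B`.
  have hle : ∀ k, ‖PowerSeries.coeff k H‖ ≤ C * B ^ k := by
    intro k
    induction k with
    | zero => rw [h0]; simpa using hC
    | succ k ih =>
      rw [hs]
      have hBk : 0 ≤ C * B ^ k := (norm_nonneg _).trans ih
      calc ‖z * PowerSeries.coeff k H + PowerSeries.coeff k F‖
          ≤ ‖z‖ * ‖PowerSeries.coeff k H‖ + ‖PowerSeries.coeff k F‖ := by
            rw [← norm_mul]; exact norm_add_le _ _
        _ ≤ ‖z‖ * (C * B ^ k) + C * B ^ k := by gcongr; exact hF.coeff_le k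
        _ = (‖z‖ + 1) * (C * B ^ k) := by ring
        _ ≤ B * (C * B ^ k) := by gcongr
        _ = C * B ^ (k + 1) := by ring
  -- In the time domain, division by `s - z` is the differential equation `H' = z H + F`.
  have hder : ∀ t : ℝ, HasDerivAt (borelTransform H)
      (z * borelTransform H t + borelTransform F t) t := fun t => by
    refine (hasDerivAt_borelTransform hle t).congr_deriv ?_
    rw [borelTransform, borelTransform, ← tsum_mul_left,
      ← ((summable_mul_pow_div_factorial (coeff_succ_le_of_coeff_le hle) t).mul_left z).tsum_add
        (hF.summable t)]
    refine tsum_congr fun k => ?_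
    rw [hs (k + 1)]; ring
  set m : ℝ := -z.re with hm
  have hmε : ε₁ ≤ m := by linarith
  have hmd : 0 < m - ε := by linarith
  have hexpn : ∀ t : ℝ, ‖Complex.exp (-z * t)‖ = Real.exp (m * t) := fun t => by
    rw [Complex.norm_exp]; simp [hm]
  -- Integrating factor: with `m = -z.re` the new derivative has norm at most `C * exp ((m - ε) *
  -- s)`, whose antiderivative `hbd` serves as the comparison function.
  have hq : ∀ t : ℝ, HasDerivAt (fun s : ℝ => Complex.exp (-z * s) * borelTransform H s)
      (Complex.exp (-z * t) * borelTransform F t) t := fun t => by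
    have h1 : HasDerivAt (fun s : ℝ => Complex.exp (-z * s)) (Complex.exp (-z * t) * -z) t := by
      have := ((hasDerivAt_id (t : ℂ)).const_mul (-z)).cexp.comp_ofReal
      simpa using this
    refine (h1.mul (hder t)).congr_deriv ?_
    ring
  have hbd : ∀ t : ℝ, HasDerivAt
      (fun s : ℝ => C * (1 + Real.exp ((m - ε) * s) / (m - ε))) (C * Real.exp ((m - ε) * t)) t :=
    fun t => by
      have h1 : HasDerivAt (fun s : ℝ => Real.exp ((m - ε) * s))
          (Real.exp ((m - ε) * t) * (m - ε)) t := by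
        simpa using ((hasDerivAt_id t).const_mul (m - ε)).exp
      refine (((h1.div_const (m - ε)).const_add 1).const_mul C).congr_deriv ?_
      rw [mul_div_cancel_right₀ _ hmd.ne']
  refine ⟨fun k => (hle k).trans ?_, fun t ht => ?_⟩
  · have hBk : 0 ≤ C * B ^ k := (norm_nonneg _).trans (hle k)
    have : 0 ≤ 1 / (ε₁ - ε) := by positivity
    nlinarith
  · have hnorm := image_norm_le_of_norm_deriv_right_le_deriv_boundary (a := 0) (b := t)
      (f := fun s : ℝ => Complex.exp (-z * s) * borelTransform H s)
      (f' := fun s : ℝ => Complex.exp (-z * s) * borelTransform F s)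
      (fun s _ => (hq s).continuousAt.continuousWithinAt)
      (fun s _ => (hq s).hasDerivWithinAt)
      (B := fun s : ℝ => C * (1 + Real.exp ((m - ε) * s) / (m - ε)))
      (B' := fun s : ℝ => C * Real.exp ((m - ε) * s)) ?_ hbd ?_ (Set.right_mem_Icc.2 ht)
    · simp only [norm_mul, hexpn] at hnorm
      have hpos := Real.exp_pos (-m * t)
      have h1 : ‖borelTransform H t‖
          = Real.exp (-m * t) * (Real.exp (m * t) * ‖borelTransform H t‖) := by
        rw [← mul_assoc, ← Real.exp_add]; simp
      rw [h1]
      refine (mul_le_mul_of_nonneg_left hnorm hpos.le).trans ?_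
      have h2 : Real.exp (-m * t) * Real.exp ((m - ε) * t) = Real.exp (-ε * t) := by
        rw [← Real.exp_add]; ring_nf
      have h3 : Real.exp (-m * t) ≤ Real.exp (-ε * t) := Real.exp_le_exp.2 (by nlinarith)
      have h4 : 1 / (m - ε) ≤ 1 / (ε₁ - ε) := by gcongr
      calc Real.exp (-m * t) * (C * (1 + Real.exp ((m - ε) * t) / (m - ε)))
          = C * (Real.exp (-m * t) + Real.exp (-m * t) * Real.exp ((m - ε) * t) * (1 / (m - ε))) :=
            by ring
        _ = C * (Real.exp (-m * t) + Real.exp (-ε * t) * (1 / (m - ε))) := by rw [h2]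
        _ ≤ C * (Real.exp (-ε * t) + Real.exp (-ε * t) * (1 / (ε₁ - ε))) := by gcongr
        _ = C * (1 + 1 / (ε₁ - ε)) * Real.exp (-ε * t) := by ring
    -- The initial value is bounded by `C`; this accounts for the summand `1` in `1 + 1 / (ε₁ - ε)`.
    · have h1 : borelTransform H 0 = PowerSeries.coeff 0 F := by
        rw [borelTransform, tsum_eq_single 0 fun k hk => by simp [hk]]
        simp [hs 0, h0]
      have h2 := hF.coeff_le 0
      simp only [pow_zero, mul_one] at h2
      have h3 : 0 ≤ C * (1 / (m - ε)) := by positivity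
      simp only [h1, Complex.ofReal_zero, mul_zero, Complex.exp_zero, one_mul, Real.exp_zero]
      linarith
    · intro s hs'
      rw [norm_mul, hexpn]
      calc Real.exp (m * s) * ‖borelTransform F s‖
          ≤ Real.exp (m * s) * (C * Real.exp (-ε * s)) := by gcongr; exact hF.decay s hs'.1
        _ = C * (Real.exp (m * s) * Real.exp (-ε * s)) := by ring
        _ = C * Real.exp ((m - ε) * s) := by rw [← Real.exp_add]; ring_nf

theorem constantCoeff_one_sub_C_mul_X_ne_zero (z : ℂ) :
    PowerSeries.constantCoeff (1 - PowerSeries.C z * PowerSeries.X) ≠ 0 := by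
  simp

/-- The exponential bound for `s ^ e / ∏ z, (s - z)`, in terms of bounds on the `z`. -/
theorem exists_hasExpBound_of_roots {ε₁ : ℝ} (hB : 1 ≤ B) (hε : ε < ε₁) (s : Multiset ℂ)
    (hs : ∀ z ∈ s, ‖z‖ + 1 ≤ B ∧ z.re ≤ -ε₁) (e : ℕ) (he : e ≤ Multiset.card s) :
    ∃ F : PowerSeries ℂ,
      F * (s.map fun z => 1 - PowerSeries.C z * PowerSeries.X).prod
          = PowerSeries.X ^ (Multiset.card s - e) ∧
        HasExpBound ((1 + B * (1 + 1 / (ε₁ - ε))) ^ Multiset.card s) B ε F := by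
  have hd : 0 < 1 / (ε₁ - ε) := one_div_pos.2 (sub_pos.2 hε)
  induction s using Multiset.induction_on generalizing e with
  | empty => exact ⟨1, by simp, by simpa using HasExpBound.one hB⟩
  | cons z s ih =>
    have hz := hs z (Multiset.mem_cons_self z s)
    have ih' := ih fun w hw => hs w (Multiset.mem_cons_of_mem hw)
    have hu := constantCoeff_one_sub_C_mul_X_ne_zero z
    rw [Multiset.card_cons] at he ⊢
    set κ : ℝ := 1 + B * (1 + 1 / (ε₁ - ε)) with hκ
    have hκ0 : 0 ≤ κ := by positivity
    have hκ1 : 1 + 1 / (ε₁ - ε) ≤ κ := by nlinarith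
    have step : ∀ F : PowerSeries ℂ, HasExpBound (κ ^ Multiset.card s) B ε F →
        HasExpBound (κ ^ Multiset.card s * (1 + 1 / (ε₁ - ε))) B ε
          (PowerSeries.X * F * (1 - PowerSeries.C z * PowerSeries.X)⁻¹) := fun F hF =>
      hF.mul_X_div hz.1 hz.2 hε (by rw [mul_assoc, PowerSeries.inv_mul_cancel _ hu, mul_one])
    -- If `e` exceeds the number of remaining poles, the new factor is `s / (s - z) = 1 + z / (s -
    -- z)`; otherwise it is `1 / (s - z)`. The constant `κ` bounds the cost of either.
    rcases Nat.lt_or_ge (Multiset.card s) e with hlt | hge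
    · have hee : e = Multiset.card s + 1 := by omega
      obtain ⟨F, hF, hFb⟩ := ih' (Multiset.card s) le_rfl
      refine ⟨F + PowerSeries.C z *
        (PowerSeries.X * F * (1 - PowerSeries.C z * PowerSeries.X)⁻¹), ?_, ?_⟩
      · have h1 : (F + PowerSeries.C z *
            (PowerSeries.X * F * (1 - PowerSeries.C z * PowerSeries.X)⁻¹)) *
            (1 - PowerSeries.C z * PowerSeries.X) = F := by
          have := PowerSeries.inv_mul_cancel _ hu
          linear_combination (PowerSeries.C z * PowerSeries.X * F) * this
        rw [Multiset.map_cons, Multiset.prod_cons, ← mul_assoc, h1, hF, hee]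
        simp
      · refine (hFb.add ((step F hFb).C_mul z)).mono (by linarith) ?_
        have h2 : ‖z‖ ≤ B := by linarith [hz.1]
        have h3 : 0 ≤ κ ^ Multiset.card s * (1 + 1 / (ε₁ - ε)) := by positivity
        calc κ ^ Multiset.card s + ‖z‖ * (κ ^ Multiset.card s * (1 + 1 / (ε₁ - ε)))
            ≤ κ ^ Multiset.card s + B * (κ ^ Multiset.card s * (1 + 1 / (ε₁ - ε))) := by gcongr
          _ = κ ^ (Multiset.card s + 1) := by rw [hκ]; ring
    · obtain ⟨F, hF, hFb⟩ := ih' e hge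
      refine ⟨PowerSeries.X * F * (1 - PowerSeries.C z * PowerSeries.X)⁻¹, ?_, ?_⟩
      · rw [Multiset.map_cons, Multiset.prod_cons, ← mul_assoc, mul_assoc (PowerSeries.X * F),
          PowerSeries.inv_mul_cancel _ hu, mul_one, mul_assoc, hF, ← pow_succ',
          Nat.sub_add_comm hge]
      · refine (step F hFb).mono (by linarith) ?_
        rw [pow_succ]
        gcongr

end Decay

/-! ### Expansions at infinity -/

section Expansion

variable {N D P : ℝ[X]}

theorem constantCoeff_reverse_ne_zero (hD : D ≠ 0) :
    PowerSeries.constantCoeff (D.reverse : PowerSeries ℝ) ≠ 0 := by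
  simpa using hD

theorem expansionAtInfty_mul_reverse (N : ℝ[X]) (hD : D ≠ 0) :
    expansionAtInfty N D * (D.reverse : PowerSeries ℝ)
      = (N.reflect D.natDegree : PowerSeries ℝ) := by
  rw [expansionAtInfty, mul_assoc, PowerSeries.inv_mul_cancel _ (constantCoeff_reverse_ne_zero hD),
    mul_one]

theorem expansionAtInfty_eq_of_mul_reverse_eq {F : PowerSeries ℝ} (hD : D ≠ 0)
    (h : F * (D.reverse : PowerSeries ℝ) = (N.reflect D.natDegree : PowerSeries ℝ)) :
    expansionAtInfty N D = F := by
  rw [expansionAtInfty, ← h, mul_assoc,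
    PowerSeries.mul_inv_cancel _ (constantCoeff_reverse_ne_zero hD), mul_one]

theorem expansionAtInfty_add (N M D : ℝ[X]) :
    expansionAtInfty (N + M) D = expansionAtInfty N D + expansionAtInfty M D := by
  simp [expansionAtInfty, reflect_add, add_mul]

theorem expansionAtInfty_C_mul (c : ℝ) (N D : ℝ[X]) :
    expansionAtInfty (C c * N) D = PowerSeries.C c * expansionAtInfty N D := by
  simp [expansionAtInfty, reflect_C_mul, mul_assoc]

/-- Common factors cancel. Properness is needed because `reflect` is multiplicative only within the
degree bound. -/
theorem expansionAtInfty_mul_right (hP : P ≠ 0) (hD : D ≠ 0) (hN : N.natDegree ≤ D.natDegree) :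
    expansionAtInfty (N * P) (D * P) = expansionAtInfty N D := by
  refine expansionAtInfty_eq_of_mul_reverse_eq (mul_ne_zero hD hP) ?_
  rw [reverse_mul_of_domain, natDegree_mul hD hP, reflect_mul _ _ hN le_rfl, Polynomial.coe_mul,
    Polynomial.coe_mul, ← mul_assoc, expansionAtInfty_mul_reverse N hD]
  rfl

theorem expansionAtInfty_self (hD : D ≠ 0) : expansionAtInfty D D = 1 :=
  expansionAtInfty_eq_of_mul_reverse_eq hD (by rw [one_mul]; rfl)

theorem reflect_eq_sum {R : Type*} [CommRing R] {N : R[X]} {d : ℕ} (hN : N.natDegree ≤ d) :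
    N.reflect d = ∑ e ∈ Finset.range (d + 1), C (N.coeff e) * X ^ (d - e) := by
  let φ : R[X] →+ R[X] := ⟨⟨reflect d, reflect_zero⟩, fun f g => reflect_add f g d⟩
  have h : φ N = ∑ e ∈ Finset.range (d + 1), φ (C (N.coeff e) * X ^ e) := by
    rw [← map_sum, ← N.as_sum_range_C_mul_X_pow' (Nat.lt_succ_of_le hN)]
  refine h.trans (Finset.sum_congr rfl fun e he => ?_)
  show reflect d (C (N.coeff e) * X ^ e) = _
  rw [reflect_C_mul_X_pow, revAt_le (Nat.lt_succ_iff.1 (Finset.mem_range.1 he))]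

theorem reverse_X_sub_C (z : ℂ) : (X - C z).reverse = 1 - C z * X := by
  ext n
  rw [reverse, natDegree_X_sub_C, coeff_reflect]
  rcases n with _ | _ | n
  · simp [revAt_le, coeff_X, coeff_C, coeff_one]
  · simp [revAt_le, coeff_X, coeff_one]
  · rw [revAt_eq_self_of_lt (by omega)]
    simp [coeff_X, coeff_one]

theorem coe_reverse_prod_X_sub_C (s : Multiset ℂ) :
    ((s.map fun z => X - C z).prod.reverse : PowerSeries ℂ)
      = (s.map fun z => 1 - PowerSeries.C z * PowerSeries.X).prod := by
  induction s using Multiset.induction_on with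
  | empty => simp [reverse]
  | cons z s ih =>
    rw [Multiset.map_cons, Multiset.prod_cons, reverse_mul_of_domain, Polynomial.coe_mul, ih,
      reverse_X_sub_C, Multiset.map_cons, Multiset.prod_cons]
    simp

/-- The exponential bound for `N(s) / D(s)`, in terms of bounds on the zeros of `D` and on the
coefficients of `N` and `D`. -/
theorem hasExpBound_expansionAtInfty {B ε ε₁ M : ℝ} (hB : 1 ≤ B) (hε : ε < ε₁) (hD : D ≠ 0)
    (hN : N.natDegree ≤ D.natDegree) (hM : ∀ e, |N.coeff e| ≤ M)
    (hroots : ∀ z : ℂ, aeval z D = 0 → ‖z‖ + 1 ≤ B ∧ z.re ≤ -ε₁) :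
    HasExpBound ((D.natDegree + 1) * (M * |D.leadingCoeff|⁻¹ *
        (1 + B * (1 + 1 / (ε₁ - ε))) ^ D.natDegree)) B ε
      (PowerSeries.map (algebraMap ℝ ℂ) (expansionAtInfty N D)) := by
  set Dc : ℂ[X] := D.map (algebraMap ℝ ℂ) with hDc
  have hDc0 : Dc ≠ 0 := by rwa [hDc, Ne, Polynomial.map_eq_zero]
  have hsplit : Dc = C Dc.leadingCoeff * (Dc.roots.map fun z => X - C z).prod :=
    (IsAlgClosed.splits Dc).eq_prod_roots
  have hcard : Multiset.card Dc.roots = D.natDegree := by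
    rw [← (IsAlgClosed.splits Dc).natDegree_eq_card_roots, hDc, natDegree_map]
  have hlead : Dc.leadingCoeff = (D.leadingCoeff : ℂ) := by
    rw [hDc, leadingCoeff_map]; rfl
  have hlead0 : (D.leadingCoeff : ℂ) ≠ 0 := by simpa using hD
  have hmem : ∀ z ∈ Dc.roots, ‖z‖ + 1 ≤ B ∧ z.re ≤ -ε₁ := fun z hz => by
    refine hroots z ?_
    rw [mem_roots hDc0, IsRoot, hDc, eval_map_algebraMap] at hz
    exact hz
  choose! F hF hFb using exists_hasExpBound_of_roots hB hε Dc.roots hmem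
  rw [hcard] at hF hFb
  -- `N / D` is a combination of the functions `s ^ e / ∏ z, (s - z)`, with weights `N.coeff e /
  -- D.leadingCoeff`; the bound for each of them is already known.
  set Y : PowerSeries ℂ := ∑ e ∈ Finset.range (D.natDegree + 1),
    PowerSeries.C ((N.coeff e : ℂ) * (D.leadingCoeff : ℂ)⁻¹) * F e with hY
  have hrev : (Dc.reverse : PowerSeries ℂ) = PowerSeries.C (D.leadingCoeff : ℂ) *
      (Dc.roots.map fun z => 1 - PowerSeries.C z * PowerSeries.X).prod := by
    conv_lhs => rw [hsplit]
    rw [reverse_mul_of_domain, Polynomial.coe_mul, coe_reverse_prod_X_sub_C, hlead, reverse_C,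
      Polynomial.coe_C]
  have hmaprev : PowerSeries.map (algebraMap ℝ ℂ) (D.reverse : PowerSeries ℝ) = Dc.reverse := by
    ext n
    rw [PowerSeries.coeff_map, Polynomial.coeff_coe, Polynomial.coeff_coe, reverse, reverse,
      coeff_reflect, coeff_reflect, hDc, natDegree_map, coeff_map]
  have hmapE : PowerSeries.map (algebraMap ℝ ℂ) (expansionAtInfty N D) * (Dc.reverse : PowerSeries ℂ)
      = Y * (Dc.reverse : PowerSeries ℂ) := by
    rw [← hmaprev, ← map_mul, expansionAtInfty_mul_reverse N hD, reflect_eq_sum hN, hmaprev, hrev,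
      hY, Finset.sum_mul]
    rw [← Polynomial.coeToPowerSeries.ringHom_apply, map_sum, map_sum]
    refine Finset.sum_congr rfl fun e he => ?_
    have hee := hF e (Nat.lt_succ_iff.1 (Finset.mem_range.1 he))
    have hc : PowerSeries.C ((N.coeff e : ℂ) * (D.leadingCoeff : ℂ)⁻¹)
        * PowerSeries.C (D.leadingCoeff : ℂ) = PowerSeries.C (N.coeff e : ℂ) := by
      rw [← map_mul, mul_assoc, inv_mul_cancel₀ hlead0, mul_one]
    calc _ = PowerSeries.C (N.coeff e : ℂ) * PowerSeries.X ^ (D.natDegree - e) := by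
          simp
      _ = _ := by rw [← hc, ← hee]; ring
  have hE : PowerSeries.map (algebraMap ℝ ℂ) (expansionAtInfty N D) = Y := by
    refine mul_right_cancel₀ ?_ hmapE
    rw [Ne, Polynomial.coe_eq_zero_iff, reverse_eq_zero]
    exact hDc0
  rw [hE]
  have hM0 : 0 ≤ M := (abs_nonneg _).trans (hM 0)
  have hκ0 : 0 ≤ (1 + B * (1 + 1 / (ε₁ - ε))) ^ D.natDegree := by
    have hd : 0 < 1 / (ε₁ - ε) := one_div_pos.2 (sub_pos.2 hε)
    positivity
  have hsum := HasExpBound.sum (Finset.range (D.natDegree + 1)) fun e he =>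
    (hFb e (Nat.lt_succ_iff.1 (Finset.mem_range.1 he))).C_mul
      ((N.coeff e : ℂ) * (D.leadingCoeff : ℂ)⁻¹)
  refine hsum.mono (by linarith) ?_
  refine (Finset.sum_le_card_nsmul _ _ (M * |D.leadingCoeff|⁻¹ *
    (1 + B * (1 + 1 / (ε₁ - ε))) ^ D.natDegree) fun e _ => ?_).trans (by simp)
  rw [norm_mul, norm_inv, Complex.norm_real, Complex.norm_real, Real.norm_eq_abs, Real.norm_eq_abs]
  gcongr
  exact hM e

/-- The impulse response as a Borel transform. -/
theorem ofReal_impulseResponse (N D : ℝ[X]) (t : ℝ) :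
    (impulseResponse N D t : ℂ)
      = borelTransform (PowerSeries.map (algebraMap ℝ ℂ) (expansionAtInfty N D)) t := by
  rw [impulseResponse, borelTransform, Complex.ofReal_tsum]
  refine tsum_congr fun k => ?_
  simp

variable {C B ε : ℝ}

theorem HasExpBound.abs_coeff_le
    (h : HasExpBound C B ε (PowerSeries.map (algebraMap ℝ ℂ) (expansionAtInfty N D))) (k : ℕ) :
    |PowerSeries.coeff k (expansionAtInfty N D)| ≤ C * B ^ k := by
  simpa using h.coeff_le k

theorem HasExpBound.abs_impulseResponse_le
    (h : HasExpBound C B ε (PowerSeries.map (algebraMap ℝ ℂ) (expansionAtInfty N D))) {t : ℝ}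
    (ht : 0 ≤ t) : |impulseResponse N D t| ≤ C * Real.exp (-ε * t) := by
  have := h.decay t ht
  rwa [← ofReal_impulseResponse, Complex.norm_real, Real.norm_eq_abs] at this

theorem HasExpBound.continuous_impulseResponse
    (h : HasExpBound C B ε (PowerSeries.map (algebraMap ℝ ℂ) (expansionAtInfty N D))) :
    Continuous (impulseResponse N D) := by
  have h1 : Continuous fun t => (impulseResponse N D t : ℂ) := by
    simp_rw [ofReal_impulseResponse]
    exact continuous_iff_continuousAt.2 fun t =>
      (hasDerivAt_borelTransform h.coeff_le t).continuousAt
  exact Complex.continuous_re.comp h1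

theorem HasExpBound.summable_real
    (h : HasExpBound C B ε (PowerSeries.map (algebraMap ℝ ℂ) (expansionAtInfty N D))) (t : ℝ) :
    Summable fun k : ℕ =>
      PowerSeries.coeff (k + 1) (expansionAtInfty N D) * t ^ k / (k.factorial : ℝ) := by
  have := h.summable t
  rw [← Complex.summable_ofReal]
  refine this.congr fun k => ?_
  simp

end Expansion

/-! ### Locally uniform bounds for families of stable rational functions -/

section Families

/-- `N(s) / D(s)` is proper with all its poles in the open left half-plane. -/
structure IsStableRational (N D : ℝ[X]) : Prop where
  ne_zero : D ≠ 0
  proper : N.natDegree ≤ D.natDegree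
  poles : ∀ z : ℂ, aeval z D = 0 → z.re < 0

variable {T : Type*} [TopologicalSpace T] {N D : T → ℝ[X]} {d : ℕ} {θ₀ : T}

/-- A Cauchy-type bound by the coefficients confines the zeros of nearby polynomials to a fixed
disc. The part of a larger disc in the closed right half-plane is compact and free of zeros of `D
θ₀`, so nearby polynomials also avoid a strip to the left of the imaginary axis. -/
theorem eventually_roots_le (hDc : ∀ e, Continuous fun θ => (D θ).coeff e)
    (hDd : ∀ θ, (D θ).natDegree ≤ d) (hlead : (D θ₀).coeff d ≠ 0)
    (hst : ∀ z : ℂ, aeval z (D θ₀) = 0 → z.re < 0) :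
    ∃ ε > 0, ∃ B ≥ 1, ∀ᶠ θ in 𝓝 θ₀, ∀ z : ℂ, aeval z (D θ) = 0 → ‖z‖ + 1 ≤ B ∧ z.re ≤ -ε := by
  have haeval : ∀ θ (z : ℂ),
      aeval z (D θ) = ∑ e ∈ Finset.range (d + 1), ((D θ).coeff e : ℂ) * z ^ e := fun θ z => by
    rw [aeval_eq_sum_range' (Nat.lt_succ_of_le (hDd θ))]
    simp
  let S : T → ℝ := fun θ => (∑ e ∈ Finset.range d, |(D θ).coeff e|) / |(D θ).coeff d|
  have hS : ContinuousAt S θ₀ := by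
    refine ContinuousAt.div ?_ (hDc d).abs.continuousAt (abs_ne_zero.2 hlead)
    exact (continuous_finsetSum _ fun e _ => (hDc e).abs).continuousAt
  have hS0 : ∀ θ, 0 ≤ S θ := fun θ => by positivity
  set R : ℝ := S θ₀ + 1 with hR
  have hR1 : 1 ≤ R := by linarith [hS0 θ₀]
  have hbound : ∀ᶠ θ in 𝓝 θ₀, ∀ z : ℂ, aeval z (D θ) = 0 → ‖z‖ ≤ R := by
    filter_upwards [hS.eventually_lt_const (show S θ₀ < R by linarith),
      (hDc d).continuousAt.eventually_ne hlead] with θ hθ hθ0 z hz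
    by_contra! hzR
    have hz1 : 1 ≤ ‖z‖ := hR1.trans hzR.le
    rw [haeval, Finset.sum_range_succ, add_comm] at hz
    have hz2 := eq_neg_of_add_eq_zero_left hz
    have hle : |(D θ).coeff d| * ‖z‖ ^ d ≤ ∑ e ∈ Finset.range d, |(D θ).coeff e| * ‖z‖ ^ e := by
      have : |(D θ).coeff d| * ‖z‖ ^ d = ‖((D θ).coeff d : ℂ) * z ^ d‖ := by simp
      rw [this, hz2, norm_neg]
      refine (norm_sum_le _ _).trans (le_of_eq (Finset.sum_congr rfl fun e _ => ?_))
      simp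
    have hd0 : 0 < |(D θ).coeff d| := abs_pos.2 hθ0
    rcases d with _ | n
    · simp at hle; exact hθ0 hle
    · have hle2 : |(D θ).coeff (n + 1)| * ‖z‖ ^ (n + 1)
          ≤ (∑ e ∈ Finset.range (n + 1), |(D θ).coeff e|) * ‖z‖ ^ n := by
        refine hle.trans ?_
        rw [Finset.sum_mul]
        refine Finset.sum_le_sum fun e he => ?_
        have := Finset.mem_range.1 he
        gcongr
        omega
      rw [pow_succ, mul_comm (‖z‖ ^ n), ← mul_assoc] at hle2
      have hle3 := le_of_mul_le_mul_right hle2 (by positivity)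
      have : ‖z‖ ≤ S θ := by
        rw [le_div_iff₀ hd0, mul_comm]; exact hle3
      linarith
  have hK : IsCompact {z : ℂ | 0 ≤ z.re ∧ ‖z‖ ≤ R + 1} := by
    have : {z : ℂ | 0 ≤ z.re ∧ ‖z‖ ≤ R + 1} = {z : ℂ | 0 ≤ z.re} ∩ Metric.closedBall 0 (R + 1) := by
      ext z; simp
    rw [this]
    exact (isCompact_closedBall _ _).inter_left (isClosed_le continuous_const Complex.continuous_re)
  -- Tube lemma with a second parameter, a small real shift of the argument. A zero with `-ε < z.re`
  -- would be moved by `ε ≤ 1` into this compact set, whose radius `R + 1` leaves room for the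
  -- shift.
  have htube := hK.eventually_forall_of_forall_eventually (x₀ := (θ₀, (0 : ℝ)))
    (P := fun x z => aeval (z - (x.2 : ℂ)) (D x.1) ≠ 0) fun z hz => by
      have hcont : Continuous fun y : (T × ℝ) × ℂ => aeval (y.2 - (y.1.2 : ℂ)) (D y.1.1) := by
        simp_rw [haeval]
        refine continuous_finsetSum _ fun e _ => ?_
        refine Continuous.mul ?_ ?_
        · exact Complex.continuous_ofReal.comp ((hDc e).comp (continuous_fst.comp continuous_fst))
        · exact (continuous_snd.sub (Complex.continuous_ofReal.comp
            (continuous_snd.comp continuous_fst))).pow e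
      refine hcont.continuousAt.eventually_ne ?_
      intro h0
      simp only [Complex.ofReal_zero, sub_zero] at h0
      exact absurd (hst z h0) (not_lt.2 hz.1)
  rw [nhds_prod_eq, eventually_prod_iff] at htube
  obtain ⟨pa, hpa, pb, hpb, hpab⟩ := htube
  obtain ⟨δ, hδ, hδb⟩ := Metric.eventually_nhds_iff.1 hpb
  set ε : ℝ := min (δ / 2) 1 with hε
  have hε0 : 0 < ε := by positivity
  have hpε : pb ε := hδb (by
    rw [Real.dist_eq, sub_zero, abs_of_pos hε0]
    exact (min_le_left _ _).trans_lt (by linarith))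
  refine ⟨ε, hε0, R + 1, by linarith, ?_⟩
  filter_upwards [hpa, hbound] with θ h1 h2 z hz
  refine ⟨by linarith [h2 z hz], ?_⟩
  by_contra! hlt
  refine hpab h1 hpε (z + (ε : ℂ)) ⟨by simp; linarith, ?_⟩ (by simpa using hz)
  refine (norm_add_le _ _).trans (add_le_add (h2 z hz) ?_)
  rw [Complex.norm_real, Real.norm_eq_abs, abs_of_pos hε0]
  exact min_le_right _ _

/-- Locally uniform exponential bounds on the impulse response of a stable rational function. -/
theorem eventually_hasExpBound (hNc : ∀ e, Continuous fun θ => (N θ).coeff e)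
    (hDc : ∀ e, Continuous fun θ => (D θ).coeff e) (hNd : ∀ θ, (N θ).natDegree ≤ d)
    (hDd : ∀ θ, (D θ).natDegree ≤ d) (hlead : (D θ₀).coeff d ≠ 0)
    (hst : ∀ z : ℂ, aeval z (D θ₀) = 0 → z.re < 0) :
    ∃ ε > 0, ∃ C B : ℝ, ∀ᶠ θ in 𝓝 θ₀, (D θ).natDegree = d ∧ IsStableRational (N θ) (D θ) ∧
      HasExpBound C B ε (PowerSeries.map (algebraMap ℝ ℂ) (expansionAtInfty (N θ) (D θ))) := by
  obtain ⟨ε, hε, B, hB, hroots⟩ := eventually_roots_le hDc hDd hlead hst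
  set M : ℝ := ∑ e ∈ Finset.range (d + 1), (|(N θ₀).coeff e| + 1) with hM
  set a : ℝ := |(D θ₀).coeff d| / 2 with ha
  have ha0 : 0 < a := by have := abs_pos.2 hlead; positivity
  -- The decay rate must be strictly smaller than the stability margin `ε`. Here `M` bounds the
  -- numerator coefficients and `a` bounds the leading coefficient of `D` away from zero.
  refine ⟨ε / 2, half_pos hε, (d + 1) * (M * a⁻¹ * (1 + B * (1 + 1 / (ε - ε / 2))) ^ d), B, ?_⟩
  have h1 : ∀ᶠ θ in 𝓝 θ₀, ∀ e ∈ Finset.range (d + 1),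
      |(N θ).coeff e| < |(N θ₀).coeff e| + 1 := by
    rw [eventually_all_finset]
    intro e _
    exact (hNc e).abs.continuousAt.eventually_lt_const (lt_add_one _)
  have h2 : ∀ᶠ θ in 𝓝 θ₀, a < |(D θ).coeff d| :=
    (hDc d).abs.continuousAt.eventually_const_lt (by linarith [abs_pos.2 hlead])
  filter_upwards [hroots, h1, h2] with θ hr hn hl
  have hl0 : (D θ).coeff d ≠ 0 := abs_pos.1 (ha0.trans hl)
  have hdeg : (D θ).natDegree = d := le_antisymm (hDd θ) (le_natDegree_of_ne_zero hl0)
  have hD0 : D θ ≠ 0 := fun h => hl0 (by rw [h, coeff_zero])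
  have hM0 : 0 ≤ M := Finset.sum_nonneg fun e _ => by positivity
  refine ⟨hdeg, ⟨hD0, (hNd θ).trans hdeg.ge, fun z hz => by linarith [(hr z hz).2]⟩, ?_⟩
  have hMle : ∀ e, |(N θ).coeff e| ≤ M := fun e => by
    rcases Nat.lt_or_ge d e with hlt | hge
    · rw [coeff_eq_zero_of_natDegree_lt ((hNd θ).trans_lt hlt), abs_zero]
      exact hM0
    · have hmem : e ∈ Finset.range (d + 1) := Finset.mem_range.2 (Nat.lt_succ_of_le hge)
      exact (hn e hmem).le.trans (Finset.single_le_sum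
        (f := fun e => |(N θ₀).coeff e| + 1) (fun e _ => by positivity) hmem)
  have hb := hasExpBound_expansionAtInfty hB (half_lt_self hε) hD0 ((hNd θ).trans hdeg.ge) hMle hr
  rw [hdeg, leadingCoeff, hdeg] at hb
  have hpos : 0 < 1 / (ε - ε / 2) := one_div_pos.2 (by linarith)
  refine hb.mono (by linarith) ?_
  gcongr

theorem tendsto_coeff_expansionAtInfty (hNc : ∀ e, Continuous fun θ => (N θ).coeff e)
    (hDc : ∀ e, Continuous fun θ => (D θ).coeff e)
    (hdeg : ∀ᶠ θ in 𝓝 θ₀, (D θ).natDegree = d) (hlead : (D θ₀).coeff d ≠ 0) (k : ℕ) :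
    Tendsto (fun θ => PowerSeries.coeff k (expansionAtInfty (N θ) (D θ))) (𝓝 θ₀)
      (𝓝 (PowerSeries.coeff k (expansionAtInfty (N θ₀) (D θ₀)))) := by
  -- Comparing coefficients in `expansion * reverse D = reflect N` expresses each coefficient by the
  -- earlier ones, dividing only by the leading coefficient of `D`. Continuity follows by strong
  -- induction.
  have hform : ∀ θ, (D θ).natDegree = d → (D θ).coeff d ≠ 0 → ∀ k,
      PowerSeries.coeff k (expansionAtInfty (N θ) (D θ)) =
        ((N θ).coeff (revAt d k) - ∑ j : Fin k,
          PowerSeries.coeff j (expansionAtInfty (N θ) (D θ)) * (D θ).coeff (revAt d (k - j)))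
          / (D θ).coeff d := fun θ hθ hl k => by
    have hD0 : D θ ≠ 0 := fun h => hl (by rw [h, coeff_zero])
    have h := congrArg (PowerSeries.coeff k) (expansionAtInfty_mul_reverse (N θ) hD0)
    rw [PowerSeries.coeff_mul, Finset.Nat.sum_antidiagonal_eq_sum_range_succ
      (fun i j => PowerSeries.coeff i (expansionAtInfty (N θ) (D θ)) *
        PowerSeries.coeff j ((D θ).reverse : PowerSeries ℝ)), Finset.sum_range_succ] at h
    simp only [Polynomial.coeff_coe, reverse, coeff_reflect, hθ, Nat.sub_self,
      revAt_zero] at h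
    rw [eq_div_iff hl, Fin.sum_univ_eq_sum_range
      (fun j => PowerSeries.coeff j (expansionAtInfty (N θ) (D θ)) *
        (D θ).coeff (revAt d (k - j))) k]
    linarith
  have hne : ∀ᶠ θ in 𝓝 θ₀, (D θ).coeff d ≠ 0 := (hDc d).continuousAt.eventually_ne hlead
  induction k using Nat.strong_induction_on with
  | _ k ih =>
    rw [hform θ₀ hdeg.self_of_nhds hlead k]
    have hev : ∀ᶠ θ in 𝓝 θ₀, ((N θ).coeff (revAt d k) - ∑ j : Fin k,
          PowerSeries.coeff j (expansionAtInfty (N θ) (D θ)) * (D θ).coeff (revAt d (k - j)))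
          / (D θ).coeff d = PowerSeries.coeff k (expansionAtInfty (N θ) (D θ)) := by
      filter_upwards [hdeg, hne] with θ h1 h2
      exact (hform θ h1 h2 k).symm
    refine Tendsto.congr' hev ?_
    refine Tendsto.div (Tendsto.sub ((hNc _).tendsto _) ?_) ((hDc d).tendsto _) hlead
    exact tendsto_finsetSum _ fun j _ => (ih j j.2).mul ((hDc _).tendsto _)

end Families

/-! ### Convolution of exponentially decaying kernels with subexponential signals -/

section TwoSidedSequences

/-- A two-sided sequence that decays exponentially. -/
def GeomBounded (c : ℤ → ℝ) : Prop :=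
  ∃ K ρ : ℝ, 0 < ρ ∧ ρ < 1 ∧ ∀ m : ℤ, |c m| ≤ K * ρ ^ m.natAbs

/-- Pointwise convergence of two-sided sequences under a common exponential bound. -/
structure GeomTendsto {T : Type*} (c : T → ℤ → ℝ) (l : Filter T) (c₀ : ℤ → ℝ) : Prop where
  bound : ∃ K ρ : ℝ, 0 < ρ ∧ ρ < 1 ∧ ∀ᶠ θ in l, ∀ m : ℤ, |c θ m| ≤ K * ρ ^ m.natAbs
  tendsto : ∀ m, Tendsto (fun θ => c θ m) l (𝓝 (c₀ m))

/-- A two-sided sequence of subexponential growth. -/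
def Subexponential (w : ℤ → ℝ) : Prop :=
  ∀ r : ℝ, 1 < r → ∃ C : ℝ, ∀ k : ℤ, |w k| ≤ C * r ^ k.natAbs

/-- The convolution of two-sided sequences. -/
noncomputable def conv (c w : ℤ → ℝ) (k : ℤ) : ℝ := ∑' m : ℤ, c m * w (k - m)

variable {T : Type*} {l : Filter T} {c : T → ℤ → ℝ} {c₀ d : ℤ → ℝ} {w w' : ℤ → ℝ}

theorem GeomBounded.geomTendsto (h : GeomBounded d) (l : Filter T) :
    GeomTendsto (fun _ => d) l d where
  bound := by
    obtain ⟨K, ρ, h0, h1, hb⟩ := h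
    exact ⟨K, ρ, h0, h1, Eventually.of_forall fun _ => hb⟩
  tendsto _ := tendsto_const_nhds

theorem GeomTendsto.comp {T' : Type*} {l' : Filter T'} {f : T' → T} (h : GeomTendsto c l c₀)
    (hf : Tendsto f l' l) : GeomTendsto (fun t => c (f t)) l' c₀ where
  bound := by
    obtain ⟨K, ρ, h0, h1, hb⟩ := h.bound
    exact ⟨K, ρ, h0, h1, hf.eventually hb⟩
  tendsto m := (h.tendsto m).comp hf

theorem summable_pow_natAbs {ρ : ℝ} (h0 : 0 < ρ) (h1 : ρ < 1) :
    Summable fun m : ℤ => ρ ^ m.natAbs := by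
  have h := summable_geometric_of_lt_one h0.le h1
  exact Summable.of_nat_of_neg (by simpa using h) (by simpa using h)

/-- A growth rate `r` that the decay rate `ρ` still beats: `r` is taken between `1` and `min s ρ⁻¹`.
-/
theorem exists_one_lt_mul_lt_one {ρ s : ℝ} (h0 : 0 < ρ) (h1 : ρ < 1) (hs : 1 < s) :
    ∃ r : ℝ, 1 < r ∧ r < s ∧ ρ * r < 1 := by
  obtain ⟨r, hr, hr'⟩ := exists_between (lt_min hs ((one_lt_inv₀ h0).2 h1))
  refine ⟨r, hr, hr'.trans_le (min_le_left _ _), ?_⟩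
  have := hr'.trans_le (min_le_right _ _)
  rwa [lt_inv_comm₀ (by linarith) h0, inv_eq_one_div, lt_div_iff₀ (by linarith)] at this

theorem pow_natAbs_sub_le {r : ℝ} (hr : 1 ≤ r) (k m : ℤ) :
    r ^ (k - m).natAbs ≤ r ^ k.natAbs * r ^ m.natAbs := by
  rw [← pow_add]
  exact pow_le_pow_right₀ hr (Int.natAbs_sub_le k m)

theorem Subexponential.summable {ρ : ℝ} (hw : Subexponential w) (h0 : 0 < ρ) (h1 : ρ < 1)
    (k : ℤ) : Summable fun m : ℤ => ρ ^ m.natAbs * |w (k - m)| := by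
  obtain ⟨r, hr, -, hr'⟩ := exists_one_lt_mul_lt_one h0 h1 one_lt_two
  obtain ⟨C, hC⟩ := hw r hr
  have hC0 : 0 ≤ C := by simpa using (abs_nonneg _).trans (hC 0)
  refine Summable.of_nonneg_of_le (fun m => by positivity) (fun m => ?_)
    ((summable_pow_natAbs (mul_pos h0 (by linarith)) hr').mul_left (C * r ^ k.natAbs))
  calc ρ ^ m.natAbs * |w (k - m)| ≤ ρ ^ m.natAbs * (C * (r ^ k.natAbs * r ^ m.natAbs)) := by
        gcongr
        exact (hC _).trans (by gcongr; exact pow_natAbs_sub_le hr.le k m)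
    _ = C * r ^ k.natAbs * (ρ * r) ^ m.natAbs := by rw [mul_pow]; ring

theorem GeomBounded.summable (hd : GeomBounded d) (hw : Subexponential w) (k : ℤ) :
    Summable fun m : ℤ => d m * w (k - m) := by
  obtain ⟨K, ρ, h0, h1, hb⟩ := hd
  refine Summable.of_norm_bounded ((hw.summable h0 h1 k).mul_left K) fun m => ?_
  rw [norm_mul, Real.norm_eq_abs, Real.norm_eq_abs, ← mul_assoc]
  gcongr
  exact hb m

theorem Subexponential.conv (hd : GeomBounded d) (hw : Subexponential w) :
    Subexponential (conv d w) := by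
  intro s hs
  obtain ⟨K, ρ, h0, h1, hb⟩ := hd
  obtain ⟨r, hr, hrs, hr'⟩ := exists_one_lt_mul_lt_one h0 h1 hs
  obtain ⟨C, hC⟩ := hw r hr
  have hC0 : 0 ≤ C := by simpa using (abs_nonneg _).trans (hC 0)
  have hK0 : 0 ≤ K := by simpa using (abs_nonneg _).trans (hb 0)
  have hsum := summable_pow_natAbs (mul_pos h0 (by linarith)) hr'
  refine ⟨K * C * ∑' m : ℤ, (ρ * r) ^ m.natAbs, fun k => ?_⟩
  have h2 : ∀ m : ℤ, ‖d m * w (k - m)‖ ≤ K * C * r ^ k.natAbs * (ρ * r) ^ m.natAbs := fun m => by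
    rw [norm_mul, Real.norm_eq_abs, Real.norm_eq_abs]
    calc |d m| * |w (k - m)| ≤ K * ρ ^ m.natAbs * (C * (r ^ k.natAbs * r ^ m.natAbs)) := by
          gcongr
          · exact hb m
          · exact (hC _).trans (by gcongr; exact pow_natAbs_sub_le hr.le k m)
      _ = K * C * r ^ k.natAbs * (ρ * r) ^ m.natAbs := by rw [mul_pow]; ring
  refine (tsum_of_norm_bounded (hsum.mul_left _).hasSum h2).trans ?_
  rw [tsum_mul_left]
  have h3 : 0 ≤ ∑' m : ℤ, (ρ * r) ^ m.natAbs :=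
    tsum_nonneg fun m => pow_nonneg (mul_nonneg h0.le (by linarith)) _
  calc K * C * r ^ k.natAbs * ∑' m : ℤ, (ρ * r) ^ m.natAbs
      = K * C * (∑' m : ℤ, (ρ * r) ^ m.natAbs) * r ^ k.natAbs := by ring
    _ ≤ K * C * (∑' m : ℤ, (ρ * r) ^ m.natAbs) * s ^ k.natAbs := by gcongr

theorem Subexponential.add (hw : Subexponential w) (hw' : Subexponential w') :
    Subexponential fun k => w k + w' k := by
  intro r hr
  obtain ⟨C, hC⟩ := hw r hr
  obtain ⟨C', hC'⟩ := hw' r hr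
  refine ⟨C + C', fun k => (abs_add_le _ _).trans ?_⟩
  rw [add_mul]
  exact add_le_add (hC k) (hC' k)

theorem Subexponential.neg (hw : Subexponential w) : Subexponential fun k => -w k := by
  intro r hr
  obtain ⟨C, hC⟩ := hw r hr
  exact ⟨C, fun k => by rw [abs_neg]; exact hC k⟩

theorem Subexponential.sum {ι : Type*} (s : Finset ι) {f : ι → ℤ → ℝ}
    (h : ∀ i ∈ s, Subexponential (f i)) : Subexponential fun k => ∑ i ∈ s, f i k := by
  classical
  induction s using Finset.induction_on with
  | empty => exact fun r hr => ⟨0, fun k => by simp⟩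
  | insert a s ha ih =>
    simp_rw [Finset.sum_insert ha]
    exact (h a (Finset.mem_insert_self a s)).add
      (ih fun i hi => h i (Finset.mem_insert_of_mem hi))

/-- Dominated convergence: the common exponential bound outweighs the subexponential growth of `w`.
-/
theorem GeomTendsto.conv (h : GeomTendsto c l c₀) (hw : Subexponential w) (k : ℤ) :
    Tendsto (fun θ => conv (c θ) w k) l (𝓝 (conv c₀ w k)) := by
  obtain ⟨K, ρ, h0, h1, hb⟩ := h.bound
  refine tendsto_tsum_of_dominated_convergence ((hw.summable h0 h1 k).mul_left K)
    (fun m => (h.tendsto m).mul_const _) ?_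
  filter_upwards [hb] with θ hθ m
  rw [norm_mul, Real.norm_eq_abs, Real.norm_eq_abs, ← mul_assoc]
  gcongr
  exact hθ m

end TwoSidedSequences

/-! ### Sampled filters as convolutions, and their algebra -/

section Kernel

/-- The weights with which the samples enter the sampled output of the filter `N(p) / D(p)`. -/
noncomputable def filterKernel (h : ℝ) (κ : ℝ → ℝ) (N D : ℝ[X]) (m : ℤ) : ℝ :=
  (if m = 0 then feedthrough N D else 0) +
    ∫ τ in Set.Ioi (0 : ℝ), impulseResponse N D τ * κ (m * h - τ)

variable {h ε : ℝ} {κ : ℝ → ℝ}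

/-- The compact support of `κ` forces `h * |m| ≤ τ + R` on the support of the integrand. Half of the
rate `ε` then gives decay in `m` and the other half integrability in `τ`. The constant depends only
on `h`, `κ` and `ε`, which makes the bound uniform over families of filters. -/
theorem exists_integral_kernel_bound (hh : 0 < h) (hκ : IsIntersample h κ) (hε : 0 < ε) :
    ∃ K : ℝ, 0 ≤ K ∧ ∀ (N D : ℝ[X]) (C B : ℝ),
      HasExpBound C B ε (PowerSeries.map (algebraMap ℝ ℂ) (expansionAtInfty N D)) → ∀ m : ℤ,
        IntegrableOn (fun τ => impulseResponse N D τ * κ (m * h - τ)) (Set.Ioi 0) ∧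
        ∫ τ in Set.Ioi (0 : ℝ), ‖impulseResponse N D τ * κ (m * h - τ)‖
          ≤ C * K * Real.exp (-(ε / 2) * h) ^ m.natAbs := by
  obtain ⟨M, hM⟩ := hκ.bounded
  have hM0 : 0 ≤ M := (abs_nonneg _).trans (hM 0)
  obtain ⟨R, hR⟩ := hκ.compactSupport.isBounded.subset_closedBall (0 : ℝ)
  have hsupp : ∀ t : ℝ, κ t ≠ 0 → |t| ≤ R := fun t ht => by
    have := hR (subset_tsupport κ ht)
    simpa using this
  have hint : IntegrableOn (fun τ : ℝ => Real.exp (-(ε / 2) * τ)) (Set.Ioi 0) :=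
    exp_neg_integrableOn_Ioi 0 (half_pos hε)
  refine ⟨M * Real.exp (ε / 2 * R) * ∫ τ in Set.Ioi (0 : ℝ), Real.exp (-(ε / 2) * τ), ?_,
    fun N D C B hb m => ?_⟩
  · have : 0 ≤ ∫ τ in Set.Ioi (0 : ℝ), Real.exp (-(ε / 2) * τ) :=
      integral_nonneg fun τ => (Real.exp_pos _).le
    positivity
  have hC0 := hb.nonneg
  have hpow : Real.exp (-(ε / 2) * h) ^ m.natAbs = Real.exp (-(ε / 2) * (h * |(m : ℝ)|)) := by
    rw [← Real.exp_nat_mul, Nat.cast_natAbs, Int.cast_abs]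
    ring_nf
  have hle : ∀ τ ∈ Set.Ioi (0 : ℝ), ‖impulseResponse N D τ * κ (m * h - τ)‖
      ≤ C * (M * Real.exp (ε / 2 * R)) * Real.exp (-(ε / 2) * h) ^ m.natAbs
        * Real.exp (-(ε / 2) * τ) := fun τ hτ => by
    have hτ0 : (0 : ℝ) < τ := hτ
    by_cases hz : κ (m * h - τ) = 0
    · rw [hz, mul_zero, norm_zero]; positivity
    have hs := hsupp _ hz
    have hge : h * |(m : ℝ)| ≤ τ + R := by
      have h1 : |(m : ℝ) * h| ≤ |m * h - τ| + |τ| := by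
        have := abs_add_le ((m : ℝ) * h - τ) τ
        simpa using this
      rw [abs_mul, abs_of_pos hh, abs_of_pos hτ0, mul_comm] at h1
      linarith
    rw [norm_mul, Real.norm_eq_abs, Real.norm_eq_abs, hpow]
    calc |impulseResponse N D τ| * |κ (m * h - τ)|
        ≤ C * Real.exp (-ε * τ) * M := by
          gcongr
          · exact hb.abs_impulseResponse_le hτ0.le
          · exact hM _
      _ ≤ C * (Real.exp (ε / 2 * R) * Real.exp (-(ε / 2) * (h * |(m : ℝ)|))
            * Real.exp (-(ε / 2) * τ)) * M := by
          gcongr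
          rw [← Real.exp_add, ← Real.exp_add]
          refine Real.exp_le_exp.2 ?_
          nlinarith
      _ = _ := by ring
  have hmeas : AEStronglyMeasurable (fun τ => impulseResponse N D τ * κ (m * h - τ))
      (volume.restrict (Set.Ioi 0)) :=
    (hb.continuous_impulseResponse.measurable.mul
      (hκ.measurable.comp (measurable_const.sub measurable_id))).aestronglyMeasurable
  have hI : IntegrableOn (fun τ => impulseResponse N D τ * κ (m * h - τ)) (Set.Ioi 0) :=
    Integrable.mono' (hint.const_mul _) hmeas (ae_restrict_of_forall_mem measurableSet_Ioi hle)
  refine ⟨hI, ?_⟩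
  refine (setIntegral_mono_on hI.norm (hint.const_mul _) measurableSet_Ioi hle).trans ?_
  rw [integral_const_mul]
  exact le_of_eq (by ring)

theorem exists_filterKernel_bound (hh : 0 < h) (hκ : IsIntersample h κ) (hε : 0 < ε) :
    ∃ K : ℝ, 0 ≤ K ∧ ∀ (N D : ℝ[X]) (C B : ℝ),
      HasExpBound C B ε (PowerSeries.map (algebraMap ℝ ℂ) (expansionAtInfty N D)) → ∀ m : ℤ,
        |filterKernel h κ N D m| ≤ C * K * Real.exp (-(ε / 2) * h) ^ m.natAbs := by
  obtain ⟨K, hK0, hK⟩ := exists_integral_kernel_bound hh hκ hε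
  refine ⟨1 + K, by linarith, fun N D C B hb m => (abs_add_le _ _).trans ?_⟩
  rw [mul_add, add_mul]
  have hC0 := hb.nonneg
  refine add_le_add ?_ ((norm_integral_le_integral_norm _).trans (hK N D C B hb m).2)
  split_ifs with hm
  · simpa [hm, feedthrough] using hb.abs_coeff_le 0
  · rw [abs_zero]; positivity

theorem interpolate_sample (hκ : IsIntersample h κ) (w : ℤ → ℝ) (k : ℤ) :
    interpolate h κ w (k * h) = w k := by
  have hval : ∀ j : ℤ, κ ((k : ℝ) * h - j * h) = if k - j = 0 then 1 else 0 := fun j => by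
    rw [← hκ.interpolates (k - j)]
    push_cast; ring_nf
  rw [interpolate, tsum_eq_single k fun j hj => ?_]
  · rw [hval]; simp
  · rw [hval, if_neg (sub_ne_zero.2 hj.symm), zero_mul]

/-- Interchange of the integral over `τ` with the sum over samples, justified by summability of the
integrals of the norms. The feedthrough contributes only at lag `0`, because the interpolation
reproduces the samples. -/
theorem filterSample_eq_conv_of_hasExpBound {N D : ℝ[X]} {C B : ℝ} {w : ℤ → ℝ} (hh : 0 < h)
    (hκ : IsIntersample h κ) (hε : 0 < ε)
    (hb : HasExpBound C B ε (PowerSeries.map (algebraMap ℝ ℂ) (expansionAtInfty N D)))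
    (hw : Subexponential w) (k : ℤ) :
    filterSample h κ N D w k = conv (filterKernel h κ N D) w k := by
  obtain ⟨K, hK0, hK⟩ := exists_integral_kernel_bound hh hκ hε
  set ρ : ℝ := Real.exp (-(ε / 2) * h) with hρ
  have hρ0 : 0 < ρ := Real.exp_pos _
  have hρ1 : ρ < 1 := by
    rw [hρ, Real.exp_lt_one_iff]
    have := mul_pos (half_pos hε) hh
    linarith
  have hinterp : ∀ τ : ℝ,
      interpolate h κ w (k * h - τ) = ∑' m : ℤ, κ (m * h - τ) * w (k - m) := fun τ => by
    rw [interpolate, ← (Equiv.subLeft k).tsum_eq]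
    refine tsum_congr fun m => ?_
    simp only [Equiv.subLeft_apply]
    push_cast
    ring_nf
  have hint : ∀ m : ℤ, Integrable
      (fun τ => impulseResponse N D τ * κ (m * h - τ) * w (k - m))
      (volume.restrict (Set.Ioi (0 : ℝ))) := fun m => ((hK N D C B hb m).1).mul_const _
  have hnorm : ∀ m : ℤ,
      ∫ τ in Set.Ioi (0 : ℝ), ‖impulseResponse N D τ * κ (m * h - τ) * w (k - m)‖
        ≤ C * K * (ρ ^ m.natAbs * |w (k - m)|) := fun m => by
    simp_rw [norm_mul _ (w (k - m))]
    rw [integral_mul_const, ← mul_assoc]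
    exact mul_le_mul_of_nonneg_right (hK N D C B hb m).2 (norm_nonneg _)
  have hsum := hasSum_integral_of_summable_integral_norm hint
    (Summable.of_nonneg_of_le (fun m => integral_nonneg fun τ => norm_nonneg _) hnorm
      ((hw.summable hρ0 hρ1 k).mul_left (C * K)))
  rw [filterSample, filterOut, interpolate_sample hκ]
  have heq : ∀ τ : ℝ, impulseResponse N D τ * interpolate h κ w (k * h - τ)
      = ∑' m : ℤ, impulseResponse N D τ * κ (m * h - τ) * w (k - m) := fun τ => by
    rw [hinterp, ← tsum_mul_left]
    exact tsum_congr fun m => by ring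
  simp_rw [heq]
  rw [← hsum.tsum_eq, conv]
  have h1 : ∀ m : ℤ, filterKernel h κ N D m * w (k - m)
      = (if m = 0 then feedthrough N D * w k else 0)
        + ∫ τ in Set.Ioi (0 : ℝ), impulseResponse N D τ * κ (m * h - τ) * w (k - m) := fun m => by
    rw [filterKernel, add_mul, integral_mul_const]
    congr 1
    split_ifs with hm
    · rw [hm, sub_zero]
    · rw [zero_mul]
  simp_rw [h1]
  have h2 := hasSum_ite_eq (0 : ℤ) (feedthrough N D * w k)
  rw [h2.summable.tsum_add hsum.summable, h2.tsum_eq]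

variable {T : Type*} [TopologicalSpace T] {N D : T → ℝ[X]} {d : ℕ} {θ₀ : T}

/-- Dominated convergence twice: the expansion coefficients converge under a common geometric bound,
hence so do the impulse responses; these have a common exponential bound, hence the kernel integrals
converge. -/
theorem tendsto_filterKernel [FirstCountableTopology T] (hh : 0 < h) (hκ : IsIntersample h κ)
    (hNc : ∀ e, Continuous fun θ => (N θ).coeff e) (hDc : ∀ e, Continuous fun θ => (D θ).coeff e)
    (hNd : ∀ θ, (N θ).natDegree ≤ d) (hDd : ∀ θ, (D θ).natDegree ≤ d) (hlead : (D θ₀).coeff d ≠ 0)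
    (hst : ∀ z : ℂ, aeval z (D θ₀) = 0 → z.re < 0) :
    (∀ᶠ θ in 𝓝 θ₀, IsStableRational (N θ) (D θ)) ∧
      GeomTendsto (fun θ => filterKernel h κ (N θ) (D θ)) (𝓝 θ₀)
        (filterKernel h κ (N θ₀) (D θ₀)) := by
  obtain ⟨ε, hε, C, B, hb⟩ := eventually_hasExpBound hNc hDc hNd hDd hlead hst
  obtain ⟨K, hK0, hK⟩ := exists_filterKernel_bound hh hκ hε
  obtain ⟨M, hM⟩ := hκ.bounded
  have hM0 : 0 ≤ M := (abs_nonneg _).trans (hM 0)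
  have hC0 : 0 ≤ C := hb.self_of_nhds.2.2.nonneg
  have hcoeff := fun k => tendsto_coeff_expansionAtInfty hNc hDc (hb.mono fun θ h => h.1) hlead k
  have himp : ∀ t : ℝ, Tendsto (fun θ => impulseResponse (N θ) (D θ) t) (𝓝 θ₀)
      (𝓝 (impulseResponse (N θ₀) (D θ₀) t)) := fun t => by
    refine tendsto_tsum_of_dominated_convergence
      (bound := fun k : ℕ => C * B * ((B * |t|) ^ k / (k.factorial : ℝ)))
      ((Real.summable_pow_div_factorial _).mul_left _)
      (fun k => ((hcoeff (k + 1)).mul_const _).div_const _) ?_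
    filter_upwards [hb] with θ hθ k
    rw [norm_div, norm_mul, norm_pow, Real.norm_eq_abs, Real.norm_eq_abs, Real.norm_natCast,
      mul_pow, ← mul_div_assoc, ← mul_assoc, mul_assoc C B, ← pow_succ']
    gcongr
    exact hθ.2.2.abs_coeff_le (k + 1)
  refine ⟨hb.mono fun θ h => h.2.1, ⟨⟨C * K, Real.exp (-(ε / 2) * h), Real.exp_pos _, ?_, ?_⟩, ?_⟩⟩
  · rw [Real.exp_lt_one_iff]
    have := mul_pos (half_pos hε) hh
    linarith
  · exact hb.mono fun θ hθ => hK _ _ C B hθ.2.2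
  · intro m
    refine Tendsto.add ?_ ?_
    · split_ifs
      · exact hcoeff 0
      · exact tendsto_const_nhds
    · refine tendsto_integral_filter_of_dominated_convergence
        (fun τ => C * M * Real.exp (-ε * τ)) ?_ ?_ ?_ ?_
      · exact hb.mono fun θ hθ => (hθ.2.2.continuous_impulseResponse.measurable.mul
          (hκ.measurable.comp (measurable_const.sub measurable_id))).aestronglyMeasurable
      · refine hb.mono fun θ hθ => ae_restrict_of_forall_mem measurableSet_Ioi fun τ hτ => ?_
        rw [norm_mul, Real.norm_eq_abs, Real.norm_eq_abs]
        calc _ ≤ C * Real.exp (-ε * τ) * M := by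
              gcongr
              · exact hθ.2.2.abs_impulseResponse_le (le_of_lt hτ)
              · exact hM _
          _ = _ := by ring
      · exact (exp_neg_integrableOn_Ioi 0 hε).const_mul _
      · exact ae_of_all _ fun τ => (himp τ).mul_const _

theorem IsStableRational.exists_hasExpBound {N D : ℝ[X]} (hs : IsStableRational N D) :
    ∃ ε > 0, ∃ C B : ℝ,
      HasExpBound C B ε (PowerSeries.map (algebraMap ℝ ℂ) (expansionAtInfty N D)) := by
  -- A single filter is a constant family over a point.
  obtain ⟨ε, hε, C, B, hb⟩ := eventually_hasExpBound (T := Unit) (N := fun _ => N) (D := fun _ => D)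
    (θ₀ := ()) (d := D.natDegree) (fun _ => continuous_const) (fun _ => continuous_const)
    (fun _ => hs.proper) (fun _ => le_rfl) (by simpa using hs.ne_zero) hs.poles
  exact ⟨ε, hε, C, B, hb.self_of_nhds.2.2⟩

theorem IsStableRational.geomBounded {N D : ℝ[X]} (hs : IsStableRational N D) (hh : 0 < h)
    (hκ : IsIntersample h κ) : GeomBounded (filterKernel h κ N D) := by
  obtain ⟨ε, hε, C, B, hb⟩ := hs.exists_hasExpBound
  obtain ⟨K, -, hK⟩ := exists_filterKernel_bound hh hκ hε
  refine ⟨C * K, Real.exp (-(ε / 2) * h), Real.exp_pos _, ?_, hK N D C B hb⟩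
  rw [Real.exp_lt_one_iff]
  have := mul_pos (half_pos hε) hh
  linarith

theorem IsStableRational.filterSample_eq_conv {N D : ℝ[X]} {w : ℤ → ℝ}
    (hs : IsStableRational N D) (hh : 0 < h) (hκ : IsIntersample h κ) (hw : Subexponential w)
    (k : ℤ) : filterSample h κ N D w k = conv (filterKernel h κ N D) w k := by
  obtain ⟨ε, hε, C, B, hb⟩ := hs.exists_hasExpBound
  exact filterSample_eq_conv_of_hasExpBound hh hκ hε hb hw k

theorem filterKernel_add {N M D : ℝ[X]} (hN : IsStableRational N D) (hM : IsStableRational M D)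
    (hh : 0 < h) (hκ : IsIntersample h κ) (m : ℤ) :
    filterKernel h κ (N + M) D m = filterKernel h κ N D m + filterKernel h κ M D m := by
  obtain ⟨ε, hε, C, B, hb⟩ := hN.exists_hasExpBound
  obtain ⟨ε', hε', C', B', hb'⟩ := hM.exists_hasExpBound
  obtain ⟨_, -, hK⟩ := exists_integral_kernel_bound hh hκ hε
  obtain ⟨_, -, hK'⟩ := exists_integral_kernel_bound hh hκ hε'
  have himp : ∀ t, impulseResponse (N + M) D t = impulseResponse N D t + impulseResponse M D t :=
    fun t => by
      rw [impulseResponse, impulseResponse, impulseResponse,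
        ← (hb.summable_real t).tsum_add (hb'.summable_real t), expansionAtInfty_add]
      exact tsum_congr fun k => by rw [map_add]; ring
  have hft : feedthrough (N + M) D = feedthrough N D + feedthrough M D := by
    rw [feedthrough, expansionAtInfty_add, map_add]; rfl
  simp_rw [filterKernel, himp, add_mul, hft]
  rw [integral_add (hK N D C B hb m).1 (hK' M D C' B' hb' m).1]
  split_ifs <;> ring

theorem filterKernel_C_mul (N D : ℝ[X]) (a : ℝ) (m : ℤ) :
    filterKernel h κ (C a * N) D m = a * filterKernel h κ N D m := by
  have himp : ∀ t, impulseResponse (C a * N) D t = a * impulseResponse N D t :=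
    fun t => by
      rw [impulseResponse, impulseResponse, ← tsum_mul_left, expansionAtInfty_C_mul]
      exact tsum_congr fun k => by rw [PowerSeries.coeff_C_mul]; ring
  have hft : feedthrough (C a * N) D = a * feedthrough N D := by
    rw [feedthrough, expansionAtInfty_C_mul, PowerSeries.coeff_C_mul]; rfl
  simp_rw [filterKernel, himp, hft, mul_assoc, integral_const_mul]
  split_ifs <;> ring

theorem filterSample_mul_right {N D P : ℝ[X]} (hP : P ≠ 0) (hD : D ≠ 0)
    (hN : N.natDegree ≤ D.natDegree) (w : ℤ → ℝ) (k : ℤ) :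
    filterSample h κ (N * P) (D * P) w k = filterSample h κ N D w k := by
  have := expansionAtInfty_mul_right hP hD hN
  simp only [filterSample, filterOut, feedthrough, impulseResponse, this]

theorem filterSample_self {D : ℝ[X]} (hD : D ≠ 0) (hκ : IsIntersample h κ)
    (w : ℤ → ℝ) (k : ℤ) : filterSample h κ D D w k = w k := by
  simp [filterSample, filterOut, feedthrough, impulseResponse, expansionAtInfty_self hD,
    PowerSeries.coeff_one, interpolate_sample hκ]

theorem filterSample_add {N M D : ℝ[X]} {w : ℤ → ℝ} (hN : IsStableRational N D)
    (hM : IsStableRational M D) (hh : 0 < h) (hκ : IsIntersample h κ) (hw : Subexponential w)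
    (k : ℤ) : filterSample h κ (N + M) D w k = filterSample h κ N D w k + filterSample h κ M D w k := by
  have hNM : IsStableRational (N + M) D :=
    ⟨hN.ne_zero, (natDegree_add_le _ _).trans (max_le hN.proper hM.proper), hN.poles⟩
  rw [hNM.filterSample_eq_conv hh hκ hw, hN.filterSample_eq_conv hh hκ hw,
    hM.filterSample_eq_conv hh hκ hw, conv, conv, conv,
    ← ((hN.geomBounded hh hκ).summable hw k).tsum_add ((hM.geomBounded hh hκ).summable hw k)]
  exact tsum_congr fun m => by rw [filterKernel_add hN hM hh hκ]; ring

theorem filterSample_C_mul {N D : ℝ[X]} {w : ℤ → ℝ} (hN : IsStableRational N D) (a : ℝ)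
    (hh : 0 < h) (hκ : IsIntersample h κ) (hw : Subexponential w) (k : ℤ) :
    filterSample h κ (C a * N) D w k = a * filterSample h κ N D w k := by
  have hNM : IsStableRational (C a * N) D :=
    ⟨hN.ne_zero, (natDegree_C_mul_le _ _).trans hN.proper, hN.poles⟩
  rw [hNM.filterSample_eq_conv hh hκ hw, hN.filterSample_eq_conv hh hκ hw, conv, conv,
    ← tsum_mul_left]
  exact tsum_congr fun m => by rw [filterKernel_C_mul]; ring

theorem filterSample_sum {ι : Type*} (s : Finset ι) {N : ι → ℝ[X]} {D : ℝ[X]} {w : ℤ → ℝ}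
    (a : ι → ℝ) (hD : IsStableRational 0 D) (hN : ∀ i ∈ s, IsStableRational (N i) D) (hh : 0 < h)
    (hκ : IsIntersample h κ) (hw : Subexponential w) (k : ℤ) :
    filterSample h κ (∑ i ∈ s, C (a i) * N i) D w k
      = ∑ i ∈ s, a i * filterSample h κ (N i) D w k := by
  classical
  have key : IsStableRational (∑ i ∈ s, C (a i) * N i) D ∧
      filterSample h κ (∑ i ∈ s, C (a i) * N i) D w k
        = ∑ i ∈ s, a i * filterSample h κ (N i) D w k := by
    induction s using Finset.induction_on with
    | empty =>
      refine ⟨hD, ?_⟩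
      have := filterSample_C_mul hD 0 hh hκ hw k
      simpa using this
    | insert j s hj ih =>
      obtain ⟨h1, h2⟩ := ih fun i hi => hN i (Finset.mem_insert_of_mem hi)
      have hj' := hN j (Finset.mem_insert_self j s)
      have h3 : IsStableRational (C (a j) * N j) D :=
        ⟨hj'.ne_zero, (natDegree_C_mul_le _ _).trans hj'.proper, hj'.poles⟩
      rw [Finset.sum_insert hj, Finset.sum_insert hj]
      refine ⟨⟨hD.ne_zero, (natDegree_add_le _ _).trans (max_le h3.proper h1.proper), hD.poles⟩, ?_⟩
      rw [filterSample_add h3 h1 hh hκ hw, filterSample_C_mul hj' _ hh hκ hw, h2]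
  exact key.2

end Kernel

theorem abs_mul_le_half_sq_add_sq (a b : ℝ) : |a * b| ≤ (a ^ 2 + b ^ 2) / 2 :=
  abs_le.2 ⟨by linarith [sq_nonneg (a + b), add_sq a b], by linarith [sq_nonneg (a - b), sub_sq a b]⟩

/-! ### Time averages along typical paths -/

section TypicalPaths

variable {ι : Type*}

/-- A sample path whose time averages of products of two samples converge to `R`, with a bound on
the averages of delayed squares that is subexponential in the delay. -/
structure IsTypical (x : ι → ℤ → ℝ) (R : ι → ι → ℤ → ℤ → ℝ) : Prop where
  sq_average_le : ∀ (a : ι) (ρ : ℝ), 0 < ρ → ρ < 1 → ∃ M : ℝ, ∀ (m : ℤ) (N : ℕ),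
    ρ ^ m.natAbs * ((1 / (N : ℝ)) * ∑ k ∈ Finset.Icc 1 N, x a (k - m) ^ 2) ≤ M
  tendsto : ∀ (a b : ι) (m m' : ℤ),
    Tendsto (fun N : ℕ => (1 / (N : ℝ)) * ∑ k ∈ Finset.Icc 1 N, x a (k - m) * x b (k - m')) atTop
      (𝓝 (R a b m m'))

variable {x : ι → ℤ → ℝ} {R : ι → ι → ℤ → ℤ → ℝ}

theorem IsTypical.subexponential (h : IsTypical x R) (a : ι) : Subexponential (x a) := by
  intro r hr
  have hr0 : 0 < r := by linarith
  obtain ⟨M, hM⟩ := h.sq_average_le a (r ^ 2)⁻¹ (by positivity)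
    (inv_lt_one_of_one_lt₀ (one_lt_pow₀ hr two_ne_zero))
  have hM0 : 0 ≤ M := by
    have := hM 0 0
    simpa using this
  refine ⟨√M * r, fun k => ?_⟩
  -- With `N = 1` and delay `1 - k` the average consists of the single square `x a k ^ 2`.
  have h1 := hM (1 - k) 1
  simp only [Nat.cast_one, Finset.Icc_self, Finset.sum_singleton, div_one, one_mul] at h1
  rw [show ((1 : ℤ) - (1 - k)) = k by ring, inv_pow, inv_mul_le_iff₀ (by positivity)] at h1
  have h2 : r ^ (1 - k).natAbs ≤ r * r ^ k.natAbs := by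
    rw [← pow_succ']
    exact pow_le_pow_right₀ hr.le (by omega)
  refine abs_le_of_sq_le_sq (h1.trans ?_) (by positivity)
  rw [mul_assoc, mul_pow (√M), Real.sq_sqrt hM0, mul_comm M, ← pow_mul, mul_comm 2, pow_mul]
  gcongr

/-- Products of convolutions as double sums. -/
theorem conv_mul_conv {c d w w' : ℤ → ℝ} (hc : GeomBounded c) (hd : GeomBounded d)
    (hw : Subexponential w) (hw' : Subexponential w') (k : ℤ) :
    HasSum (fun p : ℤ × ℤ => c p.1 * d p.2 * (w (k - p.1) * w' (k - p.2)))
      (conv c w k * conv d w' k) := by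
  have h1 := (hc.summable hw k).norm
  have h2 := (hd.summable hw' k).norm
  have h3 := (summable_mul_of_summable_norm h1 h2).hasSum
  rw [← tsum_mul_tsum_of_summable_norm h1 h2] at h3
  have h4 : (fun p : ℤ × ℤ => c p.1 * d p.2 * (w (k - p.1) * w' (k - p.2)))
      = fun p : ℤ × ℤ => c p.1 * w (k - p.1) * (d p.2 * w' (k - p.2)) := by
    funext p; ring
  rw [h4]
  exact h3

/-- Time averages of products of filtered signals converge, even if the filters vary with the
number of samples. -/
theorem IsTypical.tendsto_average_conv (h : IsTypical x R) {l : Filter ℕ} (hl : l ≤ atTop)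
    {c d : ℕ → ℤ → ℝ} {c₀ d₀ : ℤ → ℝ} (hc : GeomTendsto c l c₀) (hd : GeomTendsto d l d₀)
    (a b : ι) :
    Tendsto (fun N : ℕ => (1 / (N : ℝ)) *
        ∑ k ∈ Finset.Icc 1 N, conv (c N) (x a) k * conv (d N) (x b) k) l
      (𝓝 (∑' p : ℤ × ℤ, c₀ p.1 * d₀ p.2 * R a b p.1 p.2)) := by
  obtain ⟨K₁, ρ₁, h10, h11, hb1⟩ := hc.bound
  obtain ⟨K₂, ρ₂, h20, h21, hb2⟩ := hd.bound
  set ρ : ℝ := max ρ₁ ρ₂ with hρ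
  have hρ0 : 0 < ρ := lt_max_of_lt_left h10
  have hρ1 : ρ < 1 := max_lt h11 h21
  -- The decay `ρ ^ |m| = σ ^ |m| * σ ^ |m|` is split: one factor absorbs the growth of the delayed
  -- averages, the other keeps the sum over lags finite.
  set σ : ℝ := √ρ with hσ
  have hσ0 : 0 < σ := Real.sqrt_pos.2 hρ0
  have hσ1 : σ < 1 := by rw [hσ, Real.sqrt_lt' one_pos]; simpa using hρ1
  have hσρ : ∀ m : ℤ, ρ ^ m.natAbs = σ ^ m.natAbs * σ ^ m.natAbs := fun m => by
    rw [← mul_pow, Real.mul_self_sqrt hρ0.le]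
  obtain ⟨M₁, hM1⟩ := h.sq_average_le a σ hσ0 hσ1
  obtain ⟨M₂, hM2⟩ := h.sq_average_le b σ hσ0 hσ1
  have hsum : Summable fun p : ℤ × ℤ => σ ^ p.1.natAbs * σ ^ p.2.natAbs :=
    (summable_pow_natAbs hσ0 hσ1).mul_of_nonneg (summable_pow_natAbs hσ0 hσ1)
      (fun m => by positivity) (fun m => by positivity)
  have hA : ∀ (N : ℕ) (m m' : ℤ), σ ^ m.natAbs * σ ^ m'.natAbs *
      |(1 / (N : ℝ)) * ∑ k ∈ Finset.Icc 1 N, x a (k - m) * x b (k - m')| ≤ (M₁ + M₂) / 2 :=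
    fun N m m' => by
      have hN0 : 0 ≤ 1 / (N : ℝ) := by positivity
      have h1 : |(1 / (N : ℝ)) * ∑ k ∈ Finset.Icc 1 N, x a (k - m) * x b (k - m')|
          ≤ ((1 / (N : ℝ)) * ∑ k ∈ Finset.Icc 1 N, x a (k - m) ^ 2) / 2
            + ((1 / (N : ℝ)) * ∑ k ∈ Finset.Icc 1 N, x b (k - m') ^ 2) / 2 := by
        rw [abs_mul, abs_of_nonneg hN0, ← add_div, ← mul_add, ← Finset.sum_add_distrib,
          mul_div_assoc, Finset.sum_div]
        refine mul_le_mul_of_nonneg_left ((Finset.abs_sum_le_sum_abs _ _).trans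
          (Finset.sum_le_sum fun k _ => ?_)) hN0
        exact abs_mul_le_half_sq_add_sq _ _
      have h2 := hM1 m N
      have h3 := hM2 m' N
      set P := (1 / (N : ℝ)) * ∑ k ∈ Finset.Icc 1 N, x a (k - m) ^ 2 with hP
      set Q := (1 / (N : ℝ)) * ∑ k ∈ Finset.Icc 1 N, x b (k - m') ^ 2 with hQ
      have hP0 : 0 ≤ P := mul_nonneg hN0 (Finset.sum_nonneg fun k _ => sq_nonneg _)
      have hQ0 : 0 ≤ Q := mul_nonneg hN0 (Finset.sum_nonneg fun k _ => sq_nonneg _)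
      have hp1 : σ ^ m.natAbs ≤ 1 := pow_le_one₀ hσ0.le hσ1.le
      have hp2 : σ ^ m'.natAbs ≤ 1 := pow_le_one₀ hσ0.le hσ1.le
      have hp10 : 0 ≤ σ ^ m.natAbs := by positivity
      have hp20 : 0 ≤ σ ^ m'.natAbs := by positivity
      calc _ ≤ σ ^ m.natAbs * σ ^ m'.natAbs * (P / 2 + Q / 2) := by gcongr
        _ = σ ^ m'.natAbs * (σ ^ m.natAbs * P) / 2 + σ ^ m.natAbs * (σ ^ m'.natAbs * Q) / 2 := by
          ring
        _ ≤ 1 * (σ ^ m.natAbs * P) / 2 + 1 * (σ ^ m'.natAbs * Q) / 2 := by gcongr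
        _ ≤ (M₁ + M₂) / 2 := by linarith
  -- Averages over `k` are taken inside the sum over pairs of lags; there everything converges
  -- termwise under the bound `hA`, uniform in `N`.
  have hmain : Tendsto (fun N : ℕ => ∑' p : ℤ × ℤ, c N p.1 * d N p.2 *
      ((1 / (N : ℝ)) * ∑ k ∈ Finset.Icc 1 N, x a (k - p.1) * x b (k - p.2))) l
      (𝓝 (∑' p : ℤ × ℤ, c₀ p.1 * d₀ p.2 * R a b p.1 p.2)) := by
    refine tendsto_tsum_of_dominated_convergence
      (hsum.mul_left (|K₁| * |K₂| * ((M₁ + M₂) / 2)))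
      (fun p => ((hc.tendsto p.1).mul (hd.tendsto p.2)).mul ((h.tendsto a b p.1 p.2).mono_left hl)) ?_
    filter_upwards [hb1, hb2] with N h1 h2 p
    rw [norm_mul, norm_mul, Real.norm_eq_abs, Real.norm_eq_abs, Real.norm_eq_abs]
    have e1 : |c N p.1| ≤ |K₁| * (σ ^ p.1.natAbs * σ ^ p.1.natAbs) := by
      rw [← hσρ]
      refine (h1 p.1).trans ?_
      gcongr
      · exact le_abs_self _
      · exact le_max_left _ _
    have e2 : |d N p.2| ≤ |K₂| * (σ ^ p.2.natAbs * σ ^ p.2.natAbs) := by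
      rw [← hσρ]
      refine (h2 p.2).trans ?_
      gcongr
      · exact le_abs_self _
      · exact le_max_right _ _
    calc _ ≤ |K₁| * (σ ^ p.1.natAbs * σ ^ p.1.natAbs) * (|K₂| * (σ ^ p.2.natAbs * σ ^ p.2.natAbs))
          * |(1 / (N : ℝ)) * ∑ k ∈ Finset.Icc 1 N, x a (k - p.1) * x b (k - p.2)| := by gcongr
      _ = |K₁| * |K₂| * (σ ^ p.1.natAbs * σ ^ p.2.natAbs) * (σ ^ p.1.natAbs * σ ^ p.2.natAbs *
          |(1 / (N : ℝ)) * ∑ k ∈ Finset.Icc 1 N, x a (k - p.1) * x b (k - p.2)|) := by ring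
      _ ≤ |K₁| * |K₂| * (σ ^ p.1.natAbs * σ ^ p.2.natAbs) * ((M₁ + M₂) / 2) := by
          gcongr
          exact hA N p.1 p.2
      _ = _ := by ring
  refine hmain.congr' ?_
  filter_upwards [hb1, hb2] with N h1 h2
  have hcN : GeomBounded (c N) := ⟨K₁, ρ₁, h10, h11, h1⟩
  have hdN : GeomBounded (d N) := ⟨K₂, ρ₂, h20, h21, h2⟩
  have hfin := hasSum_sum fun (k : ℕ) (_ : k ∈ Finset.Icc 1 N) =>
    conv_mul_conv hcN hdN (h.subexponential a) (h.subexponential b) (k : ℤ)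
  rw [← (hfin.mul_left (1 / (N : ℝ))).tsum_eq]
  refine tsum_congr fun p => ?_
  rw [← Finset.mul_sum]
  ring

end TypicalPaths

/-! ### Expectations of products of filtered signals -/

section Moments

variable {Ω : Type*} [MeasurableSpace Ω] {P : Measure Ω}

/-- Tonelli: the integral of the sum of the norms is the sum of their integrals. -/
theorem integrable_tsum_of_summable_integral_norm {ι : Type*} [Countable ι] {F : ι → Ω → ℝ}
    (hm : ∀ i, Measurable (F i)) (hint : ∀ i, Integrable (F i) P)
    (hsum : Summable fun i => ∫ ω, ‖F i ω‖ ∂P) : Integrable (fun ω => ∑' i, F i ω) P := by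
  refine ⟨(Measurable.tsum hm).aestronglyMeasurable, ?_⟩
  rw [hasFiniteIntegral_def]
  refine (lintegral_mono fun ω => enorm_tsum_le_tsum_enorm).trans_lt ?_
  rw [lintegral_tsum fun i => (hm i).enorm.aemeasurable]
  have h1 : ∀ i, ∫⁻ ω, ‖F i ω‖ₑ ∂P = ENNReal.ofReal (∫ ω, ‖F i ω‖ ∂P) := fun i =>
    (ofReal_integral_norm_eq_lintegral_enorm (hint i)).symm
  simp_rw [h1]
  rw [← ENNReal.ofReal_tsum_of_nonneg (fun i => integral_nonneg fun ω => norm_nonneg _) hsum]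
  exact ENNReal.ofReal_lt_top

/-- Second moments of filtered signals. -/
theorem integral_conv_mul_conv {w w' : ℤ → Ω → ℝ} {V : ℝ} {c d : ℤ → ℝ}
    (hw : ∀ k, Measurable (w k)) (hw' : ∀ k, Measurable (w' k)) (hw2 : ∀ k, MemLp (w k) 2 P)
    (hw2' : ∀ k, MemLp (w' k) 2 P) (hV : ∀ k m, ∫ ω, ‖w k ω * w' m ω‖ ∂P ≤ V)
    (hs : ∀ᵐ ω ∂P, Subexponential fun k => w k ω) (hs' : ∀ᵐ ω ∂P, Subexponential fun k => w' k ω)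
    (hc : GeomBounded c) (hd : GeomBounded d) (k : ℤ) :
    Integrable (fun ω => conv c (fun k => w k ω) k * conv d (fun k => w' k ω) k) P ∧
      ∫ ω, conv c (fun k => w k ω) k * conv d (fun k => w' k ω) k ∂P
        = ∑' p : ℤ × ℤ, c p.1 * d p.2 * ∫ ω, w (k - p.1) ω * w' (k - p.2) ω ∂P := by
  set F : ℤ × ℤ → Ω → ℝ := fun p ω => c p.1 * d p.2 * (w (k - p.1) ω * w' (k - p.2) ω) with hF
  have hm : ∀ p, Measurable (F p) := fun p => ((hw _).mul (hw' _)).const_mul _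
  have hint : ∀ p, Integrable (F p) P := fun p => ((hw2 _).integrable_mul (hw2' _)).const_mul _
  have hV0 : 0 ≤ V := (integral_nonneg fun ω => norm_nonneg _).trans (hV 0 0)
  have hsum : Summable fun p => ∫ ω, ‖F p ω‖ ∂P := by
    obtain ⟨K₁, ρ₁, h10, h11, hb1⟩ := hc
    obtain ⟨K₂, ρ₂, h20, h21, hb2⟩ := hd
    have hprod : Summable fun p : ℤ × ℤ => (K₁ * ρ₁ ^ p.1.natAbs) * (K₂ * ρ₂ ^ p.2.natAbs) :=
      ((summable_pow_natAbs h10 h11).mul_left K₁).mul_of_nonneg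
        ((summable_pow_natAbs h20 h21).mul_left K₂) (fun m => (abs_nonneg _).trans (hb1 m))
        (fun m => (abs_nonneg _).trans (hb2 m))
    refine Summable.of_nonneg_of_le (fun p => integral_nonneg fun ω => norm_nonneg _) (fun p => ?_)
      (hprod.mul_right V)
    simp_rw [hF, norm_mul (c p.1 * d p.2)]
    rw [integral_const_mul, norm_mul, Real.norm_eq_abs, Real.norm_eq_abs]
    have e1 := hb1 p.1
    have e2 := hb2 p.2
    have e0 : 0 ≤ K₁ * ρ₁ ^ p.1.natAbs := (abs_nonneg _).trans e1
    have e3 : 0 ≤ K₂ * ρ₂ ^ p.2.natAbs := (abs_nonneg _).trans e2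
    exact mul_le_mul (mul_le_mul e1 e2 (abs_nonneg _) e0) (hV _ _)
      (integral_nonneg fun ω => norm_nonneg _) (mul_nonneg e0 e3)
  have hae : ∀ᵐ ω ∂P, ∑' p, F p ω = conv c (fun k => w k ω) k * conv d (fun k => w' k ω) k := by
    filter_upwards [hs, hs'] with ω h1 h2
    exact (conv_mul_conv hc hd h1 h2 k).tsum_eq
  refine ⟨(integrable_tsum_of_summable_integral_norm hm hint hsum).congr hae, ?_⟩
  rw [← integral_congr_ae hae, ← integral_tsum_of_summable_integral_norm hint hsum]
  exact tsum_congr fun p => integral_const_mul _ _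

end Moments

/-! ### Consequences of stationarity and ergodicity -/

section Stationary

/-- The coordinates of the joint process of the inputs and the disturbance. -/
def jointCoord {K : ℕ} : Option (Fin K) → (Fin K → ℝ) × ℝ → ℝ
  | some j, z => z.1 j
  | none, z => z.2

/-- The inputs and the disturbance as one family of signals. -/
def jointSignal {Ω : Type*} {K : ℕ} (u : Fin K → ℤ → Ω → ℝ) (v : ℤ → Ω → ℝ) :
    Option (Fin K) → ℤ → Ω → ℝ
  | some j => u j
  | none => v

theorem measurable_jointCoord {K : ℕ} (a : Option (Fin K)) : Measurable (jointCoord a) := by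
  cases a with
  | none => exact measurable_snd
  | some j => exact (measurable_pi_apply j).comp measurable_fst

variable {Ω : Type*} {K : ℕ} {u : Fin K → ℤ → Ω → ℝ}
  {v : ℤ → Ω → ℝ}

theorem jointSignal_eq (u : Fin K → ℤ → Ω → ℝ) (v : ℤ → Ω → ℝ) (a : Option (Fin K)) (k : ℤ)
    (ω : Ω) :
    jointSignal u v a k ω = jointCoord a ((fun j => u j k ω), v k ω) := by
  cases a <;> rfl

theorem iterate_shift_apply {E : Type*} (n : ℕ) (w : ℤ → E) (k : ℤ) :
    (fun (w : ℤ → E) (k : ℤ) => w (k + 1))^[n] w k = w (k + n) := by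
  induction n generalizing w k with
  | zero => simp
  | succ n ih =>
    rw [Function.iterate_succ_apply, ih]
    push_cast
    ring_nf

namespace IsStationaryData

variable [MeasurableSpace Ω] {P : Measure Ω} (hd : IsStationaryData P u v)

include hd

theorem measurable_jointSignal (a : Option (Fin K)) (k : ℤ) : Measurable (jointSignal u v a k) := by
  cases a with
  | none => exact hd.measurable_v k
  | some j => exact hd.measurable_u j k

theorem memLp_jointSignal (a : Option (Fin K)) (k : ℤ) : MemLp (jointSignal u v a k) 2 P := by
  cases a with
  | none => exact hd.memLp_v k
  | some j => exact hd.memLp_u j k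

theorem measurable_path : Measurable fun ω (k : ℤ) => ((fun j => u j k ω), v k ω) :=
  measurable_pi_lambda _ fun k =>
    (measurable_pi_lambda _ fun j => hd.measurable_u j k).prodMk (hd.measurable_v k)

theorem integrable_mul_jointSignal (a b : Option (Fin K)) (k m : ℤ) :
    Integrable (fun ω => jointSignal u v a k ω * jointSignal u v b m ω) P :=
  (hd.memLp_jointSignal a k).integrable_mul (hd.memLp_jointSignal b m)

/-- The pointwise ergodic theorem along the data. -/
theorem ae_tendsto_average [IsProbabilityMeasure P] {f : (ℤ → (Fin K → ℝ) × ℝ) → ℝ}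
    (hfm : Measurable f)
    (hf : Integrable (fun ω => f fun k => ((fun j => u j k ω), v k ω)) P) :
    ∀ᵐ ω ∂P, Tendsto (fun N : ℕ => (1 / (N : ℝ)) * ∑ n ∈ Finset.Icc 1 N,
        f fun k => ((fun j => u j (k + (n : ℕ)) ω), v (k + (n : ℕ)) ω)) atTop
      (𝓝 (∫ ω, f (fun k => ((fun j => u j k ω), v k ω)) ∂P)) := by
  have hΦ := hd.measurable_path
  have hprob : IsProbabilityMeasure (P.map fun ω (k : ℤ) => ((fun j => u j k ω), v k ω)) :=
    Measure.isProbabilityMeasure_map hΦ.aemeasurable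
  have hint : Integrable f (P.map fun ω (k : ℤ) => ((fun j => u j k ω), v k ω)) :=
    (integrable_map_measure hfm.aestronglyMeasurable hΦ.aemeasurable).2 hf
  have h := ae_of_ae_map hΦ.aemeasurable (ae_tendsto_sum_Icc_iterate hd.ergodic hfm hint)
  filter_upwards [h] with ω hω
  rw [integral_map hΦ.aemeasurable hfm.aestronglyMeasurable] at hω
  refine hω.congr fun N => ?_
  congr 1
  refine Finset.sum_congr rfl fun n _ => ?_
  congr 1
  funext k
  rw [iterate_shift_apply]

theorem integral_mul_jointSignal_add_nat (a b : Option (Fin K)) (k m : ℤ) (n : ℕ) :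
    ∫ ω, jointSignal u v a (k + n) ω * jointSignal u v b (m + n) ω ∂P
      = ∫ ω, jointSignal u v a k ω * jointSignal u v b m ω ∂P := by
  have hΦ := hd.measurable_path
  set f : (ℤ → (Fin K → ℝ) × ℝ) → ℝ := fun w => jointCoord a (w k) * jointCoord b (w m) with hf
  have hfm : Measurable f := ((measurable_jointCoord a).comp (measurable_pi_apply k)).mul
    ((measurable_jointCoord b).comp (measurable_pi_apply m))
  have hTn := hd.ergodic.toMeasurePreserving.iterate n
  have h1 : ∫ w, f w ∂(P.map fun ω (k : ℤ) => ((fun j => u j k ω), v k ω))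
      = ∫ ω, jointSignal u v a k ω * jointSignal u v b m ω ∂P := by
    rw [integral_map hΦ.aemeasurable hfm.aestronglyMeasurable]
    simp only [hf, ← jointSignal_eq]
  have hfT : Measurable fun w => f ((fun (w : ℤ → (Fin K → ℝ) × ℝ) (k : ℤ) => w (k + 1))^[n] w) :=
    hfm.comp hTn.measurable
  have h2 : ∫ w, f ((fun (w : ℤ → (Fin K → ℝ) × ℝ) (k : ℤ) => w (k + 1))^[n] w) ∂(P.map fun ω (k : ℤ) => ((fun j => u j k ω), v k ω))
      = ∫ ω, jointSignal u v a (k + n) ω * jointSignal u v b (m + n) ω ∂P := by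
    rw [integral_map hΦ.aemeasurable hfT.aestronglyMeasurable]
    simp only [hf, iterate_shift_apply, ← jointSignal_eq]
  rw [← h1, ← h2]
  conv_rhs => rw [← hTn.map_eq]
  rw [integral_map hTn.measurable.aemeasurable hfm.aestronglyMeasurable]

/-- Iterates of the shift only move forward, so a negative `k` is handled by shifting the left-hand
side by `-k`. -/
theorem integral_mul_jointSignal_sub (a b : Option (Fin K)) (k m m' : ℤ) :
    ∫ ω, jointSignal u v a (k - m) ω * jointSignal u v b (k - m') ω ∂P
      = ∫ ω, jointSignal u v a (-m) ω * jointSignal u v b (-m') ω ∂P := by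
  obtain ⟨n, rfl | rfl⟩ := k.eq_nat_or_neg
  · rw [← hd.integral_mul_jointSignal_add_nat a b (-m) (-m') n]
    simp only [sub_eq_neg_add]
  · rw [← hd.integral_mul_jointSignal_add_nat a b (-n - m) (-n - m') n]
    ring_nf

/-- `|a b| ≤ (a² + b²) / 2` and stationarity give a bound independent of both times. -/
theorem integral_norm_mul_jointSignal_le (a b : Option (Fin K)) (k m : ℤ) :
    ∫ ω, ‖jointSignal u v a k ω * jointSignal u v b m ω‖ ∂P
      ≤ (∫ ω, jointSignal u v a 0 ω * jointSignal u v a 0 ω ∂P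
        + ∫ ω, jointSignal u v b 0 ω * jointSignal u v b 0 ω ∂P) / 2 := by
  have h : ∀ (a : Option (Fin K)) (k : ℤ), ∫ ω, jointSignal u v a k ω * jointSignal u v a k ω ∂P
      = ∫ ω, jointSignal u v a 0 ω * jointSignal u v a 0 ω ∂P := fun a k => by
    simpa using hd.integral_mul_jointSignal_sub a a k 0 0
  rw [← h a k, ← h b m, ← integral_add (hd.integrable_mul_jointSignal a a k k)
    (hd.integrable_mul_jointSignal b b m m), ← integral_div]
  refine integral_mono (hd.integrable_mul_jointSignal a b k m).norm
    (((hd.integrable_mul_jointSignal a a k k).add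
      (hd.integrable_mul_jointSignal b b m m)).div_const 2) fun ω => ?_
  simpa [sq] using abs_mul_le_half_sq_add_sq (jointSignal u v a k ω) (jointSignal u v b m ω)

/-- One application of the ergodic theorem controls all delays at once: it is applied to the
discounted sum `Z = ∑ m, ρ ^ |m| * x (-m) ^ 2`, which is integrable by stationarity and, shifted by
`k`, dominates every term `ρ ^ |m| * x (k - m) ^ 2`. Its averages converge and are therefore
bounded. -/
theorem ae_sq_average_le [IsProbabilityMeasure P] (a : Option (Fin K)) {ρ : ℝ} (h0 : 0 < ρ)
    (h1 : ρ < 1) :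
    ∀ᵐ ω ∂P, ∃ M : ℝ, ∀ (m : ℤ) (N : ℕ), ρ ^ m.natAbs *
      ((1 / (N : ℝ)) * ∑ k ∈ Finset.Icc 1 N, jointSignal u v a (k - m) ω ^ 2) ≤ M := by
  set Z : (ℤ → (Fin K → ℝ) × ℝ) → ENNReal := fun w =>
    ∑' m : ℤ, ENNReal.ofReal (ρ ^ m.natAbs * jointCoord a (w (-m)) ^ 2) with hZ
  have hZm : Measurable Z := Measurable.tsum fun m => ENNReal.measurable_ofReal.comp
    ((((measurable_jointCoord a).comp (measurable_pi_apply (-m))).pow_const 2).const_mul _)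
  have hcoord : ∀ (k : ℤ) ω, jointCoord a ((fun j => u j k ω), v k ω) = jointSignal u v a k ω :=
    fun k ω => (jointSignal_eq u v a k ω).symm
  have hfin : ∫⁻ ω, Z (fun k => ((fun j => u j k ω), v k ω)) ∂P ≠ ⊤ := by
    simp only [hZ, hcoord]
    have hmeas : ∀ m : ℤ, Measurable fun ω =>
        ENNReal.ofReal (ρ ^ m.natAbs * jointSignal u v a (-m) ω ^ 2) := fun m =>
      (((hd.measurable_jointSignal a (-m)).pow_const 2).const_mul _).ennreal_ofReal
    rw [lintegral_tsum fun m => (hmeas m).aemeasurable]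
    have hterm : ∀ m : ℤ, ∫⁻ ω, ENNReal.ofReal (ρ ^ m.natAbs * jointSignal u v a (-m) ω ^ 2) ∂P
        = ENNReal.ofReal (ρ ^ m.natAbs *
          ∫ ω, jointSignal u v a 0 ω * jointSignal u v a 0 ω ∂P) := fun m => by
      have hi : Integrable (fun ω => ρ ^ m.natAbs * jointSignal u v a (-m) ω ^ 2) P := by
        simp only [sq]
        exact (hd.integrable_mul_jointSignal a a (-m) (-m)).const_mul _
      rw [← ofReal_integral_eq_lintegral_ofReal hi (ae_of_all _ fun ω => by positivity),
        integral_const_mul]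
      have := hd.integral_mul_jointSignal_sub a a (-m) 0 0
      simp only [sub_zero, neg_zero] at this
      simp only [sq, this]
    simp_rw [hterm]
    have hnn : 0 ≤ ∫ ω, jointSignal u v a 0 ω * jointSignal u v a 0 ω ∂P :=
      integral_nonneg fun ω => mul_self_nonneg _
    rw [← ENNReal.ofReal_tsum_of_nonneg (fun m => by positivity)
      ((summable_pow_natAbs h0 h1).mul_right _)]
    exact ENNReal.ofReal_ne_top
  -- `Z` must be finite along the whole orbit, since `toReal` would send the value `⊤` to `0` and
  -- the domination would fail.
  have hfinT : ∀ n : ℕ, ∫⁻ ω, Z (fun k => ((fun j => u j (k + n) ω), v (k + n) ω)) ∂P ≠ ⊤ :=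
    fun n => by
      have hΦ := hd.measurable_path
      have hTn := hd.ergodic.toMeasurePreserving.iterate n
      have e1 := lintegral_map hZm hΦ (μ := P)
      have e2 := lintegral_map (hZm.comp hTn.measurable) hΦ (μ := P)
      rw [hTn.lintegral_comp hZm |>.symm] at e1
      simp only [Function.comp] at e2
      rw [e2] at e1
      rw [← e1] at hfin
      have hpath : ∀ ω, (fun (w : ℤ → (Fin K → ℝ) × ℝ) (k : ℤ) => w (k + 1))^[n]
          (fun k => ((fun j => u j k ω), v k ω)) = fun k => ((fun j => u j (k + n) ω), v (k + n) ω) :=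
        fun ω => funext fun k => iterate_shift_apply n _ k
      simp only [hpath] at hfin
      exact hfin
  have hint : Integrable (fun ω => (Z fun k => ((fun j => u j k ω), v k ω)).toReal) P :=
    integrable_toReal_of_lintegral_ne_top (hZm.comp hd.measurable_path).aemeasurable hfin
  have hshift : ∀ n : ℕ, Measurable fun ω (k : ℤ) =>
      ((fun j => u j (k + n) ω), v (k + n) ω) := fun n =>
    measurable_pi_lambda _ fun k =>
      (measurable_pi_lambda _ fun j => hd.measurable_u j _).prodMk (hd.measurable_v _)
  have hlt : ∀ᵐ ω ∂P, ∀ n : ℕ, Z (fun k => ((fun j => u j (k + n) ω), v (k + n) ω)) < ⊤ :=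
    ae_all_iff.2 fun n => ae_lt_top (hZm.comp (hshift n)) (hfinT n)
  filter_upwards [hlt, hd.ae_tendsto_average hZm.ennreal_toReal hint] with ω hω hlim
  obtain ⟨M, hM⟩ := hlim.bddAbove_range
  refine ⟨M, fun m N => le_trans ?_ (hM ⟨N, rfl⟩)⟩
  rw [mul_left_comm, Finset.mul_sum]
  refine mul_le_mul_of_nonneg_left (Finset.sum_le_sum fun n _ => ?_) (by positivity)
  rw [← ENNReal.ofReal_le_iff_le_toReal (hω n).ne]
  have hle := ENNReal.le_tsum (f := fun m : ℤ => ENNReal.ofReal (ρ ^ m.natAbs *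
    jointCoord a ((fun j => u j (-m + n) ω), v (-m + n) ω) ^ 2)) m
  simp only [hcoord] at hle
  simp only [hZ, hcoord]
  rwa [show (n : ℤ) - m = -m + n by ring]

/-- Almost every realization of stationary ergodic data is typical. -/
theorem ae_isTypical [IsProbabilityMeasure P] :
    ∀ᵐ ω ∂P, IsTypical (fun a k => jointSignal u v a k ω)
      (fun a b m m' => ∫ ω, jointSignal u v a (-m) ω * jointSignal u v b (-m') ω ∂P) := by
  -- Countably many rates increasing to `1` suffice, because the bound for a rate implies it for all
  -- smaller ones; this leaves a single null set.
  have h1 : ∀ᵐ ω ∂P, ∀ (a : Option (Fin K)) (q : ℕ), ∃ M : ℝ, ∀ (m : ℤ) (N : ℕ),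
      (1 - 1 / ((q : ℝ) + 2)) ^ m.natAbs *
        ((1 / (N : ℝ)) * ∑ k ∈ Finset.Icc 1 N, jointSignal u v a (k - m) ω ^ 2) ≤ M := by
    refine ae_all_iff.2 fun a => ae_all_iff.2 fun q => hd.ae_sq_average_le a ?_ ?_
    · rw [sub_pos, div_lt_one (by positivity)]
      have : (0 : ℝ) ≤ q := q.cast_nonneg
      linarith
    · have : (0 : ℝ) < 1 / ((q : ℝ) + 2) := by positivity
      linarith
  have h2 : ∀ᵐ ω ∂P, ∀ (a b : Option (Fin K)) (m m' : ℤ),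
      Tendsto (fun N : ℕ => (1 / (N : ℝ)) * ∑ k ∈ Finset.Icc 1 N,
        jointSignal u v a (k - m) ω * jointSignal u v b (k - m') ω) atTop
      (𝓝 (∫ ω, jointSignal u v a (-m) ω * jointSignal u v b (-m') ω ∂P)) := by
    refine ae_all_iff.2 fun a => ae_all_iff.2 fun b => ae_all_iff.2 fun m =>
      ae_all_iff.2 fun m' => ?_
    have hcoord : ∀ (a : Option (Fin K)) (k : ℤ) ω,
        jointCoord a ((fun j => u j k ω), v k ω) = jointSignal u v a k ω :=
      fun a k ω => (jointSignal_eq u v a k ω).symm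
    have h := hd.ae_tendsto_average
      (f := fun w => jointCoord a (w (-m)) * jointCoord b (w (-m')))
      (((measurable_jointCoord a).comp (measurable_pi_apply _)).mul
        ((measurable_jointCoord b).comp (measurable_pi_apply _)))
      (by simp only [hcoord]; exact hd.integrable_mul_jointSignal a b _ _)
    simpa only [hcoord, neg_add_eq_sub] using h
  filter_upwards [h1, h2] with ω hω1 hω2
  refine ⟨fun a ρ hρ0 hρ1 => ?_, hω2⟩
  obtain ⟨q, hq⟩ := exists_nat_one_div_lt (sub_pos.2 hρ1)
  obtain ⟨M, hM⟩ := hω1 a q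
  refine ⟨M, fun m N => le_trans ?_ (hM m N)⟩
  have hle : ρ ≤ 1 - 1 / ((q : ℝ) + 2) := by
    have : 1 / ((q : ℝ) + 2) ≤ 1 / ((q : ℝ) + 1) := by gcongr; norm_num
    linarith
  have hs : 0 ≤ (1 / (N : ℝ)) * ∑ k ∈ Finset.Icc 1 N, jointSignal u v a (k - m) ω ^ 2 :=
    mul_nonneg (by positivity) (Finset.sum_nonneg fun k _ => sq_nonneg _)
  gcongr

theorem integral_input_mul_disturbance (j : Fin K) (k m : ℤ) :
    ∫ ω, jointSignal u v (some j) k ω * jointSignal u v none m ω ∂P = 0 := by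
  have h := (hd.indep j k m).integral_fun_mul_eq_mul_integral
    (hd.measurable_u j k).aestronglyMeasurable (hd.measurable_v m).aestronglyMeasurable
  rw [hd.mean_v, mul_zero] at h
  exact h

end IsStationaryData

end Stationary

/-! ### Polynomials of the parametrized models -/

section Parameters

variable {n m : ℕ}

theorem natDegree_den_le (θ : Param n m) : (den θ).natDegree ≤ n := by
  refine (natDegree_add_le _ _).trans (max_le (by simp) ?_)
  refine natDegree_sum_le_of_forall_le _ _ fun r _ => (natDegree_C_mul_X_pow_le _ _).trans ?_
  exact r.2

theorem natDegree_num_le (θ : Param n m) : (num θ).natDegree ≤ m :=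
  natDegree_sum_le_of_forall_le _ _ fun r _ =>
    (natDegree_C_mul_X_pow_le _ _).trans (Nat.lt_succ_iff.1 r.2)

theorem coeff_zero_den (θ : Param n m) : (den θ).coeff 0 = 1 := by
  simp [den, finsetSum_coeff, coeff_X_pow]

theorem den_ne_zero (θ : Param n m) : den θ ≠ 0 := fun h => by
  simpa [h] using coeff_zero_den θ

theorem continuous_coeff_den (e : ℕ) : Continuous fun θ : Param n m => (den θ).coeff e := by
  simp only [den, coeff_add, finsetSum_coeff, coeff_C_mul]
  exact continuous_const.add (continuous_finsetSum _ fun r _ =>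
    (continuous_apply _).mul continuous_const)

theorem continuous_coeff_num (e : ℕ) : Continuous fun θ : Param n m => (num θ).coeff e := by
  simp only [num, finsetSum_coeff, coeff_C_mul]
  exact continuous_finsetSum _ fun r _ => (continuous_apply _).mul continuous_const

theorem continuous_coeff_mul {T : Type*} [TopologicalSpace T] {N M : T → ℝ[X]}
    (hN : ∀ e, Continuous fun θ => (N θ).coeff e) (hM : ∀ e, Continuous fun θ => (M θ).coeff e)
    (e : ℕ) : Continuous fun θ => (N θ * M θ).coeff e := by
  simp only [coeff_mul]
  exact continuous_finsetSum _ fun p _ => (hN _).mul (hM _)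

variable {θ θ' : Param n m}

theorem IsStableModel.coeff_ne_zero (h : IsStableModel θ) : (den θ).coeff n ≠ 0 := by
  have : (den θ).leadingCoeff ≠ 0 := leadingCoeff_ne_zero.2 (den_ne_zero θ)
  rwa [leadingCoeff, h.1] at this

theorem IsStableModel.eventually (h : IsStableModel θ) : ∀ᶠ θ' in 𝓝 θ, IsStableModel θ' := by
  obtain ⟨ε, hε, C, B, hb⟩ := eventually_hasExpBound (N := fun _ : Param n m => (0 : ℝ[X]))
    (D := fun θ : Param n m => den θ) (θ₀ := θ) (d := n) (fun _ => by simpa using continuous_const)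
    continuous_coeff_den (fun _ => by simp) natDegree_den_le h.coeff_ne_zero h.2
  exact hb.mono fun θ' h' => ⟨h'.1, h'.2.1.poles⟩

theorem IsStableModel.isStableRational (h : IsStableModel θ) {N : ℝ[X]} (hN : N.natDegree ≤ n) :
    IsStableRational N (den θ) :=
  ⟨den_ne_zero θ, hN.trans h.1.ge, h.2⟩

theorem IsStableModel.isStableRational_mul (h : IsStableModel θ) (h' : IsStableModel θ')
    {N : ℝ[X]} (hN : N.natDegree ≤ n + n) : IsStableRational N (den θ * den θ') where
  ne_zero := mul_ne_zero (den_ne_zero θ) (den_ne_zero θ')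
  proper := by rw [natDegree_mul (den_ne_zero θ) (den_ne_zero θ'), h.1, h'.1]; exact hN
  poles z hz := by
    rw [map_mul, mul_eq_zero] at hz
    exact hz.elim (h.2 z) (h'.2 z)

/-- The numerators of the gradient vector over the common denominator `A ^ 2`. -/
noncomputable def gradientNum (θ : Param n m) : Fin n ⊕ Fin (m + 1) → ℝ[X]
  | Sum.inl r => -(X ^ ((r : ℕ) + 1) * num θ)
  | Sum.inr r => X ^ (r : ℕ) * den θ

theorem natDegree_gradientNum_le (hmn : m ≤ n) (θ : Param n m) (r : Fin n ⊕ Fin (m + 1)) :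
    (gradientNum θ r).natDegree ≤ n + n := by
  rcases r with r | r
  · rw [gradientNum, natDegree_neg]
    refine natDegree_mul_le.trans (add_le_add ?_ ((natDegree_num_le θ).trans hmn))
    rw [natDegree_X_pow]
    exact r.2
  · refine natDegree_mul_le.trans (add_le_add ?_ (natDegree_den_le θ))
    rw [natDegree_X_pow]
    exact (Nat.lt_succ_iff.1 r.2).trans hmn

theorem continuous_coeff_gradientNum (r : Fin n ⊕ Fin (m + 1)) (e : ℕ) :
    Continuous fun θ : Param n m => (gradientNum θ r).coeff e := by
  rcases r with r | r
  · simp only [gradientNum, coeff_neg]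
    exact (continuous_coeff_mul (fun _ => continuous_const) continuous_coeff_num e).neg
  · exact continuous_coeff_mul (fun _ => continuous_const) continuous_coeff_den e

theorem sum_den (θ : Param n m) :
    ∑ r : Fin n, C (θ (Sum.inl r)) * X ^ ((r : ℕ) + 1) = den θ - 1 := by
  rw [den]; ring

/-- The sum is `-(A - 1) B + B A = B`. -/
theorem sum_C_mul_gradientNum (θ : Param n m) : ∑ r, C (θ r) * gradientNum θ r = num θ := by
  rw [Fintype.sum_sum_type]
  have h1 : ∑ r : Fin n, C (θ (Sum.inl r)) * gradientNum θ (Sum.inl r)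
      = -((den θ - 1) * num θ) := by
    rw [← sum_den, Finset.sum_mul, ← Finset.sum_neg_distrib]
    exact Finset.sum_congr rfl fun r _ => by rw [gradientNum]; ring
  have h2 : ∑ r : Fin (m + 1), C (θ (Sum.inr r)) * gradientNum θ (Sum.inr r)
      = num θ * den θ := by
    rw [num, Finset.sum_mul]
    exact Finset.sum_congr rfl fun r _ => by rw [gradientNum]; ring
  rw [h1, h2]; ring

/-- If the model is coprime, the numerators of the gradient vector span all polynomials of degree
at most `n + m`. -/
theorem exists_sum_C_mul_gradientNum_eq (hst : IsStableModel θ)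
    (hco : IsCoprimeModel θ) {F : ℝ[X]} (hF : F.natDegree ≤ n + m) :
    ∃ a : Param n m, ∑ r, C (a r) * gradientNum θ r = F := by
  -- `A` has constant term `1`, so `X`, and with it `X * B`, is coprime to `A`.
  have hcoX : IsCoprime X (den θ) := by
    refine ⟨-∑ r : Fin n, C (θ (Sum.inl r)) * X ^ (r : ℕ), 1, ?_⟩
    rw [den, neg_mul, Finset.sum_mul]
    have : ∀ r : Fin n, C (θ (Sum.inl r)) * X ^ (r : ℕ) * X
        = C (θ (Sum.inl r)) * X ^ ((r : ℕ) + 1) := fun r => by ring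
    simp_rw [this]
    ring
  obtain ⟨U, V, hUV⟩ := hcoX.mul_left hco
  -- The Bézout identity gives `F = G * (X * B) + Q * A`. Reducing `G` modulo `A` makes its degree
  -- less than `n`; then `G * (X * B)` has degree at most `n + m`, which forces `Q` to have degree
  -- at most `m`. The coefficients of `-G` and `Q` are the required combination.
  set G := F * U % den θ with hG
  set Q := F * V + F * U / den θ * (X * num θ) with hQ
  have hdecomp : Q * den θ = F - G * (X * num θ) := by
    have h1 := EuclideanDomain.div_add_mod (F * U) (den θ)
    linear_combination F * hUV + (X * num θ) * h1
  have hdeg : G.degree < n := by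
    have := EuclideanDomain.mod_lt (F * U) (den_ne_zero θ)
    have h2 : (den θ).degree = n := by
      rw [degree_eq_natDegree (den_ne_zero θ), hst.1]
    rw [← h2]
    exact this
  have hGsum : G = ∑ r : Fin n, C (G.coeff r) * X ^ (r : ℕ) := by
    rw [Fin.sum_univ_eq_sum_range (fun r => C (G.coeff r) * X ^ r) n]
    ext k
    simp only [finsetSum_coeff, coeff_C_mul, coeff_X_pow, mul_ite, mul_one, mul_zero,
      Finset.sum_ite_eq, Finset.mem_range]
    split_ifs with hk
    · rfl
    · exact coeff_eq_zero_of_degree_lt (hdeg.trans_le (by exact_mod_cast not_lt.1 hk))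
  have hQdeg : Q.natDegree ≤ m := by
    by_cases hQ0 : Q = 0
    · simp [hQ0]
    have h3 : (Q * den θ).natDegree ≤ n + m := by
      rw [hdecomp]
      refine (natDegree_sub_le _ _).trans (max_le hF ?_)
      by_cases hG0 : G = 0
      · simp [hG0]
      refine natDegree_mul_le.trans ?_
      have h4 : G.natDegree < n := (natDegree_lt_iff_degree_lt hG0).2 hdeg
      have h5 : (X * num θ : ℝ[X]).natDegree ≤ 1 + m :=
        natDegree_mul_le.trans (add_le_add natDegree_X_le (natDegree_num_le θ))
      omega
    rw [natDegree_mul hQ0 (den_ne_zero θ), hst.1] at h3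
    omega
  have hQsum : Q = ∑ r : Fin (m + 1), C (Q.coeff r) * X ^ (r : ℕ) := by
    conv_lhs => rw [Q.as_sum_range_C_mul_X_pow' (Nat.lt_succ_of_le hQdeg)]
    rw [Fin.sum_univ_eq_sum_range (fun r => C (Q.coeff r) * X ^ r) (m + 1)]
  refine ⟨Sum.elim (fun r => -G.coeff r) (fun r => Q.coeff r), ?_⟩
  rw [Fintype.sum_sum_type]
  have e1 : ∑ r : Fin n, C (-G.coeff (r : ℕ)) * gradientNum θ (Sum.inl r) = G * (X * num θ) := by
    conv_rhs => rw [hGsum, Finset.sum_mul]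
    exact Finset.sum_congr rfl fun r _ => by rw [gradientNum, C_neg]; ring
  have e2 : ∑ r : Fin (m + 1), C (Q.coeff (r : ℕ)) * gradientNum θ (Sum.inr r) = Q * den θ := by
    conv_rhs => rw [hQsum, Finset.sum_mul]
    exact Finset.sum_congr rfl fun r _ => by rw [gradientNum]; ring
  simp only [Sum.elim_inl, Sum.elim_inr]
  rw [e1, e2, hdecomp]
  ring

end Parameters

/-! ### Continuity of the filters in the parameters -/

section Continuity

variable {h : ℝ} {κ : ℝ → ℝ} {n m : ℕ} {θ₀ : Param n m} {N : Param n m → ℝ[X]}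

theorem IsStableModel.tendsto_filterKernel (hst : IsStableModel θ₀) (hh : 0 < h)
    (hκ : IsIntersample h κ) (hNc : ∀ e, Continuous fun θ => (N θ).coeff e)
    (hNd : ∀ θ, (N θ).natDegree ≤ n) :
    (∀ᶠ θ in 𝓝 θ₀, IsStableRational (N θ) (den θ)) ∧
      GeomTendsto (fun θ => filterKernel h κ (N θ) (den θ)) (𝓝 θ₀)
        (filterKernel h κ (N θ₀) (den θ₀)) :=
  SysId.tendsto_filterKernel hh hκ hNc continuous_coeff_den hNd natDegree_den_le
    hst.coeff_ne_zero hst.2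

theorem IsStableModel.tendsto_filterKernel_sq (hst : IsStableModel θ₀) (hh : 0 < h)
    (hκ : IsIntersample h κ) (hNc : ∀ e, Continuous fun θ => (N θ).coeff e)
    (hNd : ∀ θ, (N θ).natDegree ≤ n + n) :
    (∀ᶠ θ in 𝓝 θ₀, IsStableRational (N θ) (den θ ^ 2)) ∧
      GeomTendsto (fun θ => filterKernel h κ (N θ) (den θ ^ 2)) (𝓝 θ₀)
        (filterKernel h κ (N θ₀) (den θ₀ ^ 2)) := by
  have hs := hst.isStableRational_mul hst (N := 0) (by simp)
  simp only [sq]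
  refine SysId.tendsto_filterKernel (d := n + n) hh hκ hNc
    (continuous_coeff_mul continuous_coeff_den continuous_coeff_den) hNd
    (fun θ => natDegree_mul_le.trans (add_le_add (natDegree_den_le θ) (natDegree_den_le θ))) ?_
    hs.poles
  have hdeg : (den θ₀ * den θ₀).natDegree = n + n := by
    rw [natDegree_mul (den_ne_zero θ₀) (den_ne_zero θ₀), hst.1]
  rw [← hdeg]
  exact leadingCoeff_ne_zero.2 hs.ne_zero

theorem tendsto_filterSample {T : Type*} {l : Filter T} {N D : T → ℝ[X]} {N₀ D₀ : ℝ[X]}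
    {w : ℤ → ℝ} (hh : 0 < h) (hκ : IsIntersample h κ)
    (hst : ∀ᶠ θ in l, IsStableRational (N θ) (D θ)) (hst₀ : IsStableRational N₀ D₀)
    (hg : GeomTendsto (fun θ => filterKernel h κ (N θ) (D θ)) l (filterKernel h κ N₀ D₀))
    (hw : Subexponential w) (k : ℤ) :
    Tendsto (fun θ => filterSample h κ (N θ) (D θ) w k) l (𝓝 (filterSample h κ N₀ D₀ w k)) := by
  rw [hst₀.filterSample_eq_conv hh hκ hw]
  refine (hg.conv hw k).congr' ?_
  filter_upwards [hst] with θ hθ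
  rw [hθ.filterSample_eq_conv hh hκ hw]

end Continuity

/-! ### The equation satisfied by limits of the iterations -/

section NormalEquations

variable {K : ℕ} (S : System K) {u : Fin K → ℤ → ℝ} {y : ℤ → ℝ} {i : Fin K}
  {β : ∀ j, Param (S.n j) (S.m j)}

/-- The entries with denominator `A` are expanded by `A`, so that linear combinations of the
gradient become operations on numerators over `A²`. -/
theorem System.gradient_eq (u : Fin K → ℤ → ℝ) (i : Fin K) (θ : Param (S.n i) (S.m i)) (k : ℤ)
    (hst : IsStableModel θ) (r : Fin (S.n i) ⊕ Fin (S.m i + 1)) :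
    S.gradient u i θ k r = S.filterInput u i (gradientNum θ r) (den θ ^ 2) k := by
  rcases r with r | r
  · rfl
  · rw [System.gradient, gradientNum, sq, System.filterInput, System.filterInput,
      filterSample_mul_right (den_ne_zero θ) (den_ne_zero θ)]
    rw [natDegree_X_pow, hst.1]
    exact (Nat.lt_succ_iff.1 r.2).trans (S.m_le_n i)

theorem System.subexponential_filterInput (hu : ∀ j, Subexponential (u j)) {j : Fin K}
    {N D : ℝ[X]} (hs : IsStableRational N D) : Subexponential (S.filterInput u j N D) := by
  have h := (hu j).conv (hs.geomBounded S.h_pos (S.intersample j))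
  have h2 : S.filterInput u j N D = conv (filterKernel S.h (S.κ j) N D) (u j) :=
    funext fun k => hs.filterSample_eq_conv S.h_pos (S.intersample j) (hu j) k
  rwa [h2]

theorem System.isStableRational_model {θ : Param (S.n i) (S.m i)} (hθ : IsStableModel θ) :
    IsStableRational (num θ) (den θ) :=
  hθ.isStableRational ((natDegree_num_le _).trans (S.m_le_n i))

theorem System.subexponential_output {v : ℤ → ℝ} (hu : ∀ j, Subexponential (u j))
    (hv : Subexponential v) : Subexponential (S.output u v) :=
  (Subexponential.sum Finset.univ fun j _ =>
    S.subexponential_filterInput hu (S.isStableRational_model (S.stable j))).add hv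

theorem System.subexponential_residualOutput (hu : ∀ j, Subexponential (u j))
    (hy : Subexponential y) (hβ : ∀ j, IsStableModel (β j)) :
    Subexponential (S.residualOutput u y i β) := by
  have := hy.add (Subexponential.sum (Finset.univ.erase i) fun j _ =>
    S.subexponential_filterInput (j := j) hu (S.isStableRational_model (hβ j))).neg
  simp only [← sub_eq_add_neg] at this
  exact this

/-- The regressor whose outer product with the gradient is averaged in the normal matrix. -/
noncomputable def System.methodRegressor (u : Fin K → ℤ → ℝ) (y : ℤ → ℝ) (i : Fin K)
    (β : ∀ j, Param (S.n j) (S.m j)) (θ : Param (S.n i) (S.m i)) (k : ℤ) :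
    Method → Param (S.n i) (S.m i)
  | Method.gaussNewton => S.gradient u i θ k
  | Method.srivc => S.regressor u y i β θ k

/-- The signal whose product with the gradient is averaged in the normal vector. -/
noncomputable def System.methodTarget (u : Fin K → ℤ → ℝ) (y : ℤ → ℝ) (i : Fin K)
    (β : ∀ j, Param (S.n j) (S.m j)) (θ : Param (S.n i) (S.m i)) (k : ℤ) : Method → ℝ
  | Method.gaussNewton => S.residual u y i β θ k + S.filterInput u i (num θ) (den θ ^ 2) k
  | Method.srivc => S.filteredOutput u y i β θ k

theorem System.normalMatrix_eq (mth : Method) (N : ℕ) (θ : Param (S.n i) (S.m i)) :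
    S.normalMatrix u y i β N θ mth = (1 / (N : ℝ)) • ∑ k ∈ Finset.Icc 1 N,
      Matrix.vecMulVec (S.gradient u i θ k) (S.methodRegressor u y i β θ k mth) := by
  cases mth <;> rfl

theorem System.normalVector_eq (mth : Method) (N : ℕ) (θ : Param (S.n i) (S.m i)) :
    S.normalVector u y i β N θ mth = (1 / (N : ℝ)) • ∑ k ∈ Finset.Icc 1 N,
      S.methodTarget u y i β θ k mth • S.gradient u i θ k := by
  cases mth <;> rfl

theorem System.sum_gradient_mul (hu : ∀ j, Subexponential (u j)) {θ : Param (S.n i) (S.m i)}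
    (hst : IsStableModel θ) (k : ℤ) :
    ∑ r, S.gradient u i θ k r * θ r = S.filterInput u i (num θ) (den θ ^ 2) k := by
  simp_rw [S.gradient_eq u i θ k hst, mul_comm _ (θ _), System.filterInput]
  have hs : ∀ N : ℝ[X], N.natDegree ≤ S.n i + S.n i → IsStableRational N (den θ ^ 2) :=
    fun N hN => by rw [sq]; exact hst.isStableRational_mul hst hN
  rw [← filterSample_sum Finset.univ θ (hs 0 (by simp))
    (fun r _ => hs _ (natDegree_gradientNum_le (S.m_le_n i) θ r)) S.h_pos (S.intersample i) (hu i),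
    sum_C_mul_gradientNum]

/-- The defining property of the two methods: the error of the linear regression is the total
residual. -/
theorem System.methodTarget_sub (hu : ∀ j, Subexponential (u j)) (hy : Subexponential y)
    (hβ : ∀ j, IsStableModel (β j)) {θ : Param (S.n i) (S.m i)} (hst : IsStableModel θ)
    (mth : Method) (k : ℤ) :
    S.methodTarget u y i β θ k mth - ∑ r, S.methodRegressor u y i β θ k mth r * θ r
      = S.residual u y i β θ k := by
  cases mth with
  | gaussNewton =>
    simp only [System.methodTarget, System.methodRegressor]
    rw [S.sum_gradient_mul hu hst]
    ring
  | srivc =>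
    have hw := S.subexponential_residualOutput (i := i) hu hy hβ
    have hs0 : IsStableRational 0 (den θ) := hst.isStableRational (by simp)
    have hself : IsStableRational (den θ) (den θ) := hst.isStableRational (natDegree_den_le θ)
    have h1den : IsStableRational (1 - den θ) (den θ) :=
      hst.isStableRational ((natDegree_sub_le _ _).trans (max_le (by simp) (natDegree_den_le θ)))
    simp only [System.methodTarget, System.methodRegressor, Fintype.sum_sum_type,
      System.regressor, System.residual, System.filteredOutput, System.filterInput,
      mul_comm _ (θ _)]
    rw [← filterSample_sum Finset.univ (fun r => θ (Sum.inl r)) hs0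
      (fun r _ => hst.isStableRational (by rw [natDegree_neg, natDegree_X_pow]; exact r.2))
      S.h_pos S.intersample_y hw,
      ← filterSample_sum Finset.univ (fun r => θ (Sum.inr r)) hs0
      (fun r _ => hst.isStableRational (by
        rw [natDegree_X_pow]; exact (Nat.lt_succ_iff.1 r.2).trans (S.m_le_n i)))
      S.h_pos (S.intersample i) (hu i)]
    have e1 : ∑ r : Fin (S.n i), C (θ (Sum.inl r)) * (-X ^ ((r : ℕ) + 1)) = 1 - den θ := by
      simp only [mul_neg, Finset.sum_neg_distrib, sum_den]
      ring
    have e2 : ∑ r : Fin (S.m i + 1), C (θ (Sum.inr r)) * X ^ (r : ℕ) = num θ := rfl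
    -- `(1 - A) / A + A / A = 1 / A`: the filtered parts of the residual output cancel, and only its
    -- sample at `t_k` remains, whatever its intersample behaviour.
    have e3 := filterSample_add h1den hself S.h_pos S.intersample_y hw k
    rw [sub_add_cancel, filterSample_self (den_ne_zero θ) S.intersample_y] at e3
    rw [e1, e2, e3]
    ring

theorem System.tendsto_gradient (hu : ∀ j, Subexponential (u j)) {θ : Param (S.n i) (S.m i)}
    (hst : IsStableModel θ) (k : ℤ) (r : Fin (S.n i) ⊕ Fin (S.m i + 1)) :
    Tendsto (fun θ' => S.gradient u i θ' k r) (𝓝 θ) (𝓝 (S.gradient u i θ k r)) := by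
  obtain ⟨h1, h2⟩ := hst.tendsto_filterKernel_sq S.h_pos (S.intersample i)
    (continuous_coeff_gradientNum r) (fun θ => natDegree_gradientNum_le (S.m_le_n i) θ r)
  rw [S.gradient_eq u i θ k hst]
  refine (tendsto_filterSample S.h_pos (S.intersample i) h1 h1.self_of_nhds h2 (hu i) k).congr' ?_
  filter_upwards [hst.eventually] with θ' h'
  rw [S.gradient_eq u i θ' k h', System.filterInput]

theorem System.tendsto_filterInput (hu : ∀ j, Subexponential (u j)) {θ : Param (S.n i) (S.m i)}
    (hst : IsStableModel θ) (k : ℤ) {N : Param (S.n i) (S.m i) → ℝ[X]}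
    (hNc : ∀ e, Continuous fun θ => (N θ).coeff e) (hNd : ∀ θ, (N θ).natDegree ≤ S.n i) :
    Tendsto (fun θ' => S.filterInput u i (N θ') (den θ') k) (𝓝 θ)
      (𝓝 (S.filterInput u i (N θ) (den θ) k)) := by
  obtain ⟨h1, h2⟩ := hst.tendsto_filterKernel S.h_pos (S.intersample i) hNc hNd
  exact tendsto_filterSample S.h_pos (S.intersample i) h1 h1.self_of_nhds h2 (hu i) k

theorem System.tendsto_methodRegressor (hu : ∀ j, Subexponential (u j)) (hy : Subexponential y)
    (hβ : ∀ j, IsStableModel (β j)) {θ : Param (S.n i) (S.m i)} (hst : IsStableModel θ)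
    (mth : Method) (k : ℤ) (r : Fin (S.n i) ⊕ Fin (S.m i + 1)) :
    Tendsto (fun θ' => S.methodRegressor u y i β θ' k mth r) (𝓝 θ)
      (𝓝 (S.methodRegressor u y i β θ k mth r)) := by
  cases mth with
  | gaussNewton => exact S.tendsto_gradient hu hst k r
  | srivc =>
    rcases r with r | r
    · obtain ⟨h1, h2⟩ := hst.tendsto_filterKernel S.h_pos S.intersample_y
        (N := fun _ => -X ^ ((r : ℕ) + 1)) (fun _ => continuous_const)
        (fun _ => by rw [natDegree_neg, natDegree_X_pow]; exact r.2)
      exact tendsto_filterSample S.h_pos S.intersample_y h1 h1.self_of_nhds h2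
        (S.subexponential_residualOutput hu hy hβ) k
    · exact S.tendsto_filterInput hu hst k (N := fun _ => X ^ (r : ℕ)) (fun _ => continuous_const)
        (fun _ => by rw [natDegree_X_pow]; exact (Nat.lt_succ_iff.1 r.2).trans (S.m_le_n i))

theorem System.tendsto_methodTarget (hu : ∀ j, Subexponential (u j)) (hy : Subexponential y)
    (hβ : ∀ j, IsStableModel (β j)) {θ : Param (S.n i) (S.m i)} (hst : IsStableModel θ)
    (mth : Method) (k : ℤ) :
    Tendsto (fun θ' => S.methodTarget u y i β θ' k mth) (𝓝 θ)
      (𝓝 (S.methodTarget u y i β θ k mth)) := by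
  cases mth with
  | gaussNewton =>
    refine Tendsto.add (tendsto_const_nhds.sub (S.tendsto_filterInput hu hst k
      continuous_coeff_num fun θ => (natDegree_num_le θ).trans (S.m_le_n i))) ?_
    obtain ⟨h1, h2⟩ := hst.tendsto_filterKernel_sq S.h_pos (S.intersample i)
      continuous_coeff_num (fun θ => ((natDegree_num_le θ).trans (S.m_le_n i)).trans (by omega))
    exact tendsto_filterSample S.h_pos (S.intersample i) h1 h1.self_of_nhds h2 (hu i) k
  | srivc =>
    obtain ⟨h1, h2⟩ := hst.tendsto_filterKernel S.h_pos S.intersample_y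
      (N := fun _ => 1) (fun _ => continuous_const) (fun _ => by simp)
    exact tendsto_filterSample S.h_pos S.intersample_y h1 h1.self_of_nhds h2
      (S.subexponential_residualOutput hu hy hβ) k

/-- A stable limit of the iterations makes the total residual orthogonal to the gradient. -/
theorem System.IsIteration.sum_gradient_mul_residual {mth : Method} {N : ℕ}
    {θs : ℕ → Param (S.n i) (S.m i)} {θ : Param (S.n i) (S.m i)}
    (hit : S.IsIteration u y mth i β N θs) (hu : ∀ j, Subexponential (u j))
    (hy : Subexponential y) (hβ : ∀ j, IsStableModel (β j)) (hst : IsStableModel θ)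
    (hlim : Tendsto θs atTop (𝓝 θ)) (r : Fin (S.n i) ⊕ Fin (S.m i + 1)) :
    (1 / (N : ℝ)) * ∑ k ∈ Finset.Icc 1 N, S.gradient u i θ k r * S.residual u y i β θ k = 0 := by
  have hM : ∀ θ r c, S.normalMatrix u y i β N θ mth r c = (1 / (N : ℝ)) *
      ∑ k ∈ Finset.Icc 1 N, S.gradient u i θ k r * S.methodRegressor u y i β θ k mth c :=
    fun θ r c => by
      rw [S.normalMatrix_eq, Matrix.smul_apply, Matrix.sum_apply]; rfl
  have hV : ∀ θ r, S.normalVector u y i β N θ mth r = (1 / (N : ℝ)) *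
      ∑ k ∈ Finset.Icc 1 N, S.methodTarget u y i β θ k mth * S.gradient u i θ k r :=
    fun θ r => by
      rw [S.normalVector_eq, Pi.smul_apply, Finset.sum_apply]; rfl
  have hMlim : ∀ c, Tendsto (fun s => S.normalMatrix u y i β N (θs s) mth r c) atTop
      (𝓝 (S.normalMatrix u y i β N θ mth r c)) := fun c => by
    simp only [hM]
    refine Tendsto.const_mul _ (tendsto_finsetSum _ fun k _ => ?_)
    exact ((S.tendsto_gradient hu hst k r).comp hlim).mul
      ((S.tendsto_methodRegressor hu hy hβ hst mth k c).comp hlim)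
  have hVlim : Tendsto (fun s => S.normalVector u y i β N (θs s) mth r) atTop
      (𝓝 (S.normalVector u y i β N θ mth r)) := by
    simp only [hV]
    refine Tendsto.const_mul _ (tendsto_finsetSum _ fun k _ => ?_)
    exact ((S.tendsto_methodTarget hu hy hβ hst mth k).comp hlim).mul
      ((S.tendsto_gradient hu hst k r).comp hlim)
  have hnext : ∀ c, Tendsto (fun s => θs (s + 1) c) atTop (𝓝 (θ c)) := fun c =>
    (tendsto_pi_nhds.1 hlim c).comp (tendsto_add_atTop_nat 1)
  -- The recursion is multiplied by the normal matrix before the limit is taken, so the matrix at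
  -- the limit need not be invertible.
  have heq : ∀ᶠ s in atTop, ∑ c, S.normalMatrix u y i β N (θs s) mth r c * θs (s + 1) c
      = S.normalVector u y i β N (θs s) mth r := by
    filter_upwards [hit.2] with s hs
    have h1 : (S.normalMatrix u y i β N (θs s) mth).mulVec (θs (s + 1))
        = S.normalVector u y i β N (θs s) mth := by
      rw [hit.1 s, Matrix.mulVec_mulVec, Matrix.mul_nonsing_inv _ hs, Matrix.one_mulVec]
    exact congrFun h1 r
  have hlimeq := tendsto_nhds_unique
    (Tendsto.congr' heq (tendsto_finsetSum _ fun c _ => (hMlim c).mul (hnext c))) hVlim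
  rw [hV] at hlimeq
  simp only [hM] at hlimeq
  have h2 : ∑ c, (1 / (N : ℝ)) * (∑ k ∈ Finset.Icc 1 N, S.gradient u i θ k r *
      S.methodRegressor u y i β θ k mth c) * θ c = (1 / (N : ℝ)) * ∑ k ∈ Finset.Icc 1 N,
        S.gradient u i θ k r * ∑ c, S.methodRegressor u y i β θ k mth c * θ c := by
    simp_rw [Finset.mul_sum, Finset.sum_mul]
    rw [Finset.sum_comm]
    exact Finset.sum_congr rfl fun k _ => Finset.sum_congr rfl fun c _ => by ring
  rw [h2] at hlimeq
  rw [← sub_eq_zero.2 hlimeq.symm, ← mul_sub, ← Finset.sum_sub_distrib]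
  congr 1
  refine Finset.sum_congr rfl fun k _ => ?_
  rw [← S.methodTarget_sub hu hy hβ hst mth k]
  ring

end NormalEquations

/-! ### The limit equation -/

section LimitEquation

/-- The limit of the time averages of products of the filtered signals `conv c (x a)` and
`conv d (x b)`. -/
noncomputable def momentPairing {ι : Type*} (R : ι → ι → ℤ → ℤ → ℝ) (a b : ι) (c d : ℤ → ℝ) : ℝ :=
  ∑' p : ℤ × ℤ, c p.1 * d p.2 * R a b p.1 p.2

/-- The unit of convolution. -/
def convUnit (m : ℤ) : ℝ := if m = 0 then 1 else 0

theorem conv_convUnit (w : ℤ → ℝ) (k : ℤ) : conv convUnit w k = w k := by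
  rw [conv, tsum_eq_single 0 fun m hm => by simp [convUnit, hm]]
  simp [convUnit]

theorem geomBounded_convUnit : GeomBounded convUnit := by
  refine ⟨1, 1 / 2, by norm_num, by norm_num, fun m => ?_⟩
  rw [convUnit]
  split_ifs with hm
  · simp [hm]
  · rw [abs_zero]; positivity

theorem sum_C_coeff_mul_X_pow_rev {F : ℝ[X]} {d : ℕ} (hF : F.natDegree ≤ d) :
    ∑ c : Fin (d + 1), C (F.coeff (d - (c : ℕ))) * X ^ (d - (c : ℕ)) = F := by
  rw [Fin.sum_univ_eq_sum_range (fun c => C (F.coeff (d - c)) * X ^ (d - c)) (d + 1)]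
  have h := Finset.sum_range_reflect (fun e => C (F.coeff e) * X ^ e) (d + 1)
  simp only [Nat.add_sub_cancel] at h
  rw [h, ← F.as_sum_range_C_mul_X_pow' (Nat.lt_succ_of_le hF)]

variable {K : ℕ} (S : System K) {x : Option (Fin K) → ℤ → ℝ}
  {R : Option (Fin K) → Option (Fin K) → ℤ → ℤ → ℝ} {i : Fin K}
  {θbar : ∀ j, Param (S.n j) (S.m j)}

/-- With the `i`th model taken from `β`, the total residual is symmetric in the submodels: the
disturbance plus the errors of all of them. -/
theorem System.residual_output_eq (u : Fin K → ℤ → ℝ) (v : ℤ → ℝ)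
    (β : ∀ j, Param (S.n j) (S.m j)) (k : ℤ) :
    S.residual u (S.output u v) i β (β i) k = v k +
      ∑ j, (S.filterInput u j (num (S.θstar j)) (den (S.θstar j)) k
        - S.filterInput u j (num (β j)) (den (β j)) k) := by
  rw [System.residual, System.residualOutput, System.output, Finset.sum_sub_distrib,
    ← Finset.add_sum_erase Finset.univ (fun j => S.filterInput u j (num (β j)) (den (β j)) k)
      (Finset.mem_univ i)]
  ring

/-- The limit depends on `β` only through `θbar`, so the averages at the estimates and at the frozen
limit agree asymptotically. Models near a stable one are stable, which gives the convolution form of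
every filter. The disturbance enters through the unit kernel. -/
theorem System.tendsto_average_gradient_mul_residual (ht : IsTypical x R) {l : Filter ℕ}
    (hl : l ≤ atTop) {β : ℕ → ∀ j, Param (S.n j) (S.m j)} (hβ : Tendsto β l (𝓝 θbar))
    (hst : ∀ j, IsStableModel (θbar j)) (r : Fin (S.n i) ⊕ Fin (S.m i + 1)) :
    Tendsto (fun N : ℕ => (1 / (N : ℝ)) * ∑ k ∈ Finset.Icc 1 N,
        S.gradient (fun j => x (some j)) i (β N i) k r *
          S.residual (fun j => x (some j)) (S.output (fun j => x (some j)) (x none)) i (β N)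
            (β N i) k) l
      (𝓝 (momentPairing R (some i) none
          (filterKernel S.h (S.κ i) (gradientNum (θbar i) r) (den (θbar i) ^ 2)) convUnit +
        ∑ j, (momentPairing R (some i) (some j)
            (filterKernel S.h (S.κ i) (gradientNum (θbar i) r) (den (θbar i) ^ 2))
            (filterKernel S.h (S.κ j) (num (S.θstar j)) (den (S.θstar j))) -
          momentPairing R (some i) (some j)
            (filterKernel S.h (S.κ i) (gradientNum (θbar i) r) (den (θbar i) ^ 2))
            (filterKernel S.h (S.κ j) (num (θbar j)) (den (θbar j)))))) := by
  have hu : ∀ j, Subexponential (x (some j)) := fun j => ht.subexponential (some j)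
  have hβj : ∀ j, Tendsto (fun N => β N j) l (𝓝 (θbar j)) := tendsto_pi_nhds.1 hβ
  obtain ⟨hg1, hg2⟩ := (hst i).tendsto_filterKernel_sq S.h_pos (S.intersample i)
    (continuous_coeff_gradientNum r) (fun θ => natDegree_gradientNum_le (S.m_le_n i) θ r)
  have hg := hg2.comp (hβj i)
  have hm : ∀ j, GeomTendsto
      (fun N => filterKernel S.h (S.κ j) (num (β N j)) (den (β N j))) l
      (filterKernel S.h (S.κ j) (num (θbar j)) (den (θbar j))) := fun j =>
    ((hst j).tendsto_filterKernel S.h_pos (S.intersample j) continuous_coeff_num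
      fun θ => (natDegree_num_le θ).trans (S.m_le_n j)).2.comp (hβj j)
  have hstar : ∀ j, IsStableRational (num (S.θstar j)) (den (S.θstar j)) := fun j =>
    S.isStableRational_model (S.stable j)
  have hlim := (ht.tendsto_average_conv hl hg (geomBounded_convUnit.geomTendsto l) (some i)
    none).add (tendsto_finsetSum Finset.univ fun j _ =>
      (ht.tendsto_average_conv hl hg (((hstar j).geomBounded S.h_pos
        (S.intersample j)).geomTendsto l) (some i) (some j)).sub
      (ht.tendsto_average_conv hl hg (hm j) (some i) (some j)))
  refine hlim.congr' ?_
  have hstβ : ∀ᶠ N in l, ∀ j, IsStableModel (β N j) :=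
    eventually_all.2 fun j => (hβj j).eventually (hst j).eventually
  filter_upwards [hstβ, (hβj i).eventually hg1] with N hN hN1
  simp_rw [← mul_sub, ← Finset.sum_sub_distrib, ← mul_sub]
  rw [← Finset.mul_sum, ← mul_add, Finset.sum_comm, ← Finset.sum_add_distrib]
  congr 1
  refine Finset.sum_congr rfl fun k _ => ?_
  rw [← Finset.mul_sum, ← mul_add, S.residual_output_eq, S.gradient_eq _ _ _ _ (hN i),
    conv_convUnit, System.filterInput, hN1.filterSample_eq_conv S.h_pos (S.intersample i) (hu i)]
  congr 2
  refine Finset.sum_congr rfl fun j _ => ?_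
  rw [System.filterInput, System.filterInput,
    (hstar j).filterSample_eq_conv S.h_pos (S.intersample j) (hu j),
    (S.isStableRational_model (hN j)).filterSample_eq_conv S.h_pos (S.intersample j) (hu j)]

theorem System.natDegree_bias_le (j : Fin K) (θ : Param (S.n j) (S.m j)) :
    (den (S.θstar j) * num θ - den θ * num (S.θstar j)).natDegree ≤ S.n j + S.m j :=
  (natDegree_sub_le _ _).trans (max_le
    (natDegree_mul_le.trans (add_le_add (natDegree_den_le _) (natDegree_num_le _)))
    (natDegree_mul_le.trans (add_le_add (natDegree_den_le _) (natDegree_num_le _))))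

theorem System.isStableRational_stack (j : Fin K) {θ θ' : Param (S.n j) (S.m j)}
    (hst : IsStableModel θ) (hst' : IsStableModel θ') (c : ℕ) :
    IsStableRational (X ^ (S.n j + S.m j - c)) (den θ * den θ') := by
  refine hst.isStableRational_mul hst' ?_
  rw [natDegree_X_pow]
  have := S.m_le_n j
  omega

/-- The stack contracted with `η_j` is the filter `(A* B - A B*) / (A* A)`, that is `B / A - B* /
A*` after cancellation. -/
theorem System.sum_filteredStack_mul_biasVector {u : Fin K → ℤ → ℝ}
    (hu : ∀ j, Subexponential (u j)) (j : Fin K) {θ : Param (S.n j) (S.m j)}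
    (hst : IsStableModel θ) (k : ℤ) :
    ∑ c, S.filteredStack u j (den (S.θstar j) * den θ) k c * S.biasVector j θ c
      = S.filterInput u j (num θ) (den θ) k
        - S.filterInput u j (num (S.θstar j)) (den (S.θstar j)) k := by
  have hh := S.h_pos
  have hκ := S.intersample j
  have hmn := S.m_le_n j
  have hs : ∀ N : ℝ[X], N.natDegree ≤ S.n j + S.n j →
      IsStableRational N (den (S.θstar j) * den θ) := fun N hN =>
    (S.stable j).isStableRational_mul hst hN
  have hd1 : (den (S.θstar j) * num θ).natDegree ≤ S.n j + S.n j :=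
    natDegree_mul_le.trans (add_le_add (natDegree_den_le _) ((natDegree_num_le _).trans hmn))
  have hd2 : (den θ * num (S.θstar j)).natDegree ≤ S.n j + S.n j :=
    natDegree_mul_le.trans (add_le_add (natDegree_den_le _) ((natDegree_num_le _).trans hmn))
  simp only [System.filteredStack, System.biasVector, System.filterInput, mul_comm _ (coeff _ _)]
  rw [← filterSample_sum Finset.univ
    (N := fun c : Fin (S.n j + S.m j + 1) => X ^ (S.n j + S.m j - (c : ℕ)))
    (fun c => (den (S.θstar j) * num θ - den θ * num (S.θstar j)).coeff (S.n j + S.m j - (c : ℕ)))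
    (hs 0 (by simp)) (fun c _ => S.isStableRational_stack j (S.stable j) hst c) hh hκ (hu j),
    sum_C_coeff_mul_X_pow_rev (S.natDegree_bias_le j θ)]
  have hneg : den (S.θstar j) * num θ - den θ * num (S.θstar j)
      = den (S.θstar j) * num θ + C (-1) * (den θ * num (S.θstar j)) := by
    rw [C_neg, C_1]; ring
  rw [hneg, filterSample_add (hs _ hd1) (hs _ ((natDegree_C_mul_le _ _).trans hd2)) hh hκ (hu j),
    filterSample_C_mul (hs _ hd2) _ hh hκ (hu j)]
  have e1 : filterSample S.h (S.κ j) (den (S.θstar j) * num θ) (den (S.θstar j) * den θ) (u j) k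
      = filterSample S.h (S.κ j) (num θ) (den θ) (u j) k := by
    rw [mul_comm _ (num θ), mul_comm _ (den θ), filterSample_mul_right (den_ne_zero _)
      (den_ne_zero _) (S.isStableRational_model hst).proper]
  have e2 : filterSample S.h (S.κ j) (den θ * num (S.θstar j)) (den (S.θstar j) * den θ) (u j) k
      = filterSample S.h (S.κ j) (num (S.θstar j)) (den (S.θstar j)) (u j) k := by
    rw [mul_comm _ (num (S.θstar j)), filterSample_mul_right (den_ne_zero _)
      (den_ne_zero _) (S.isStableRational_model (S.stable j)).proper]
  rw [e1, e2]
  ring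

/-- For a typical realization, the limits of the time averages satisfy the limit equation. -/
theorem System.sum_momentPairing_mul_biasVector_eq_zero (ht : IsTypical x R)
    (hR : ∀ j m m', R (some j) none m m' = 0) {mth : Method} {l : Filter ℕ} [l.NeBot]
    (hl : l ≤ atTop) {β : ℕ → ∀ j, Param (S.n j) (S.m j)} {θs : ℕ → ℕ → Param (S.n i) (S.m i)}
    (hit : ∀ᶠ N in l, S.IsIteration (fun j => x (some j))
      (S.output (fun j => x (some j)) (x none)) mth i (β N) N (θs N) ∧
        Tendsto (θs N) atTop (𝓝 (β N i)))
    (hβ : Tendsto β l (𝓝 θbar)) (hst : ∀ j, IsStableModel (θbar j))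
    (hco : IsCoprimeModel (θbar i)) (r : Fin (S.n i + S.m i + 1)) :
    ∑ j, ∑ c : Fin (S.n j + S.m j + 1), momentPairing R (some i) (some j)
      (filterKernel S.h (S.κ i) (X ^ (S.n i + S.m i - (r : ℕ))) (den (θbar i) ^ 2))
      (filterKernel S.h (S.κ j) (X ^ (S.n j + S.m j - (c : ℕ)))
        (den (S.θstar j) * den (θbar j))) * S.biasVector j (θbar j) c = 0 := by
  set u : Fin K → ℤ → ℝ := fun j => x (some j) with hudef
  have hh := S.h_pos
  have hu : ∀ j, Subexponential (u j) := fun j => ht.subexponential (some j)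
  have hy : Subexponential (S.output u (x none)) :=
    S.subexponential_output hu (ht.subexponential none)
  have hstβ : ∀ᶠ N in l, ∀ j, IsStableModel (β N j) :=
    eventually_all.2 fun j => (tendsto_pi_nhds.1 hβ j).eventually (hst j).eventually
  -- The averages at `β N` are eventually zero and have the same limit as those at `θbar`.
  have hzero : ∀ s, Tendsto (fun N : ℕ => (1 / (N : ℝ)) * ∑ k ∈ Finset.Icc 1 N,
      S.gradient u i (θbar i) k s * S.residual u (S.output u (x none)) i θbar (θbar i) k) l
      (𝓝 0) := fun s => by
    have h1 := S.tendsto_average_gradient_mul_residual ht hl hβ hst s (i := i)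
    have h2 := S.tendsto_average_gradient_mul_residual ht hl
      (tendsto_const_nhds (x := θbar) (f := l)) hst s (i := i)
    have h3 : ∀ᶠ N : ℕ in l, 0 = (1 / (N : ℝ)) * ∑ k ∈ Finset.Icc 1 N,
        S.gradient u i (β N i) k s *
          S.residual u (S.output u (x none)) i (β N) (β N i) k := by
      filter_upwards [hit, hstβ] with N h4 h5
      exact (h4.1.sum_gradient_mul_residual S hu hy h5 (h5 i) h4.2 s).symm
    rw [tendsto_nhds_unique (tendsto_const_nhds.congr' h3) h1]
    exact h2
  have hX : (X ^ (S.n i + S.m i - (r : ℕ)) : ℝ[X]).natDegree ≤ S.n i + S.m i := by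
    rw [natDegree_X_pow]; omega
  -- Coprimeness enters here: the signal `ψ = (X ^ e / A²) u_i` is a fixed combination of the
  -- gradient entries, so it too is asymptotically orthogonal to the residual.
  obtain ⟨a, ha⟩ := exists_sum_C_mul_gradientNum_eq (hst i) hco hX
  have hsq : ∀ N : ℝ[X], N.natDegree ≤ S.n i + S.n i → IsStableRational N (den (θbar i) ^ 2) :=
    fun N hN => by rw [sq]; exact (hst i).isStableRational_mul (hst i) hN
  have hψs := hsq _ (hX.trans (Nat.add_le_add_left (S.m_le_n i) _))
  set ψ : ℤ → ℝ := S.filterInput u i (X ^ (S.n i + S.m i - (r : ℕ))) (den (θbar i) ^ 2) with hψ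
  have hψconv : ∀ k, ψ k = conv (filterKernel S.h (S.κ i) (X ^ (S.n i + S.m i - (r : ℕ)))
      (den (θbar i) ^ 2)) (x (some i)) k := fun k =>
    hψs.filterSample_eq_conv hh (S.intersample i) (hu i) k
  have hψg := (hψs.geomBounded hh (S.intersample i)).geomTendsto l
  have hψsum : ∀ k, ψ k = ∑ s, a s * S.gradient u i (θbar i) k s := fun k => by
    simp_rw [S.gradient_eq u i (θbar i) k (hst i), hψ, System.filterInput]
    rw [← filterSample_sum Finset.univ a (hsq 0 (by simp))
      (fun s _ => hsq _ (natDegree_gradientNum_le (S.m_le_n i) _ s)) hh (S.intersample i) (hu i),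
      ha]
  have hψe : Tendsto (fun N : ℕ => (1 / (N : ℝ)) * ∑ k ∈ Finset.Icc 1 N,
      ψ k * S.residual u (S.output u (x none)) i θbar (θbar i) k) l (𝓝 0) := by
    have h1 := tendsto_finsetSum Finset.univ fun s _ => (hzero s).const_mul (a s)
    simp only [mul_zero, Finset.sum_const_zero] at h1
    refine h1.congr fun N => ?_
    simp_rw [hψsum, Finset.mul_sum, Finset.sum_mul, Finset.mul_sum]
    rw [Finset.sum_comm]
    exact Finset.sum_congr rfl fun k _ => Finset.sum_congr rfl fun s _ => by ring
  have hψv : Tendsto (fun N : ℕ => (1 / (N : ℝ)) * ∑ k ∈ Finset.Icc 1 N, ψ k * x none k) l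
      (𝓝 0) := by
    have h1 := ht.tendsto_average_conv hl hψg (geomBounded_convUnit.geomTendsto l) (some i) none
    simp only [hR, mul_zero, tsum_zero, conv_convUnit, ← hψconv] at h1
    exact h1
  have hstack : ∀ j (c : Fin (S.n j + S.m j + 1)),
      IsStableRational (X ^ (S.n j + S.m j - (c : ℕ))) (den (S.θstar j) * den (θbar j)) :=
    fun j c => S.isStableRational_stack j (S.stable j) (hst j) c
  have hlim := tendsto_finsetSum Finset.univ fun (j : Fin K) _ =>
    tendsto_finsetSum Finset.univ fun (c : Fin (S.n j + S.m j + 1)) _ =>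
      (ht.tendsto_average_conv hl hψg (((hstack j c).geomBounded hh
        (S.intersample j)).geomTendsto l) (some i) (some j)).mul_const (S.biasVector j (θbar j) c)
  refine tendsto_nhds_unique hlim ?_
  -- Disturbance minus residual is the sum of model outputs minus true outputs, which is the sum of
  -- the stacks contracted with the `η_j`.
  have hdiff := hψv.sub hψe
  rw [sub_zero] at hdiff
  refine hdiff.congr fun N => ?_
  have hkey : ∀ k : ℤ, ψ k * x none k
        - ψ k * S.residual u (S.output u (x none)) i θbar (θbar i) k
      = ∑ j, ∑ c : Fin (S.n j + S.m j + 1), ψ k * conv (filterKernel S.h (S.κ j)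
        (X ^ (S.n j + S.m j - (c : ℕ))) (den (S.θstar j) * den (θbar j))) (x (some j)) k
          * S.biasVector j (θbar j) c := fun k => by
    have h1 : ∀ j, ∑ c : Fin (S.n j + S.m j + 1), ψ k * conv (filterKernel S.h (S.κ j)
        (X ^ (S.n j + S.m j - (c : ℕ))) (den (S.θstar j) * den (θbar j))) (x (some j)) k
          * S.biasVector j (θbar j) c
        = ψ k * (S.filterInput u j (num (θbar j)) (den (θbar j)) k
          - S.filterInput u j (num (S.θstar j)) (den (S.θstar j)) k) := fun j => by
      rw [← S.sum_filteredStack_mul_biasVector hu j (hst j), Finset.mul_sum]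
      refine Finset.sum_congr rfl fun c _ => ?_
      rw [System.filteredStack, System.filterInput,
        (hstack j c).filterSample_eq_conv hh (S.intersample j) (hu j), mul_assoc]
    simp_rw [h1]
    rw [S.residual_output_eq, ← Finset.mul_sum, ← mul_sub, sub_add_cancel_left,
      ← Finset.sum_neg_distrib]
    simp only [neg_sub]
  rw [← mul_sub, ← Finset.sum_sub_distrib]
  simp_rw [hkey, ← hψconv, Finset.mul_sum, Finset.sum_mul]
  rw [Finset.sum_comm]
  refine Finset.sum_congr rfl fun j _ => ?_
  rw [Finset.sum_comm]
  exact Finset.sum_congr rfl fun c _ => Finset.sum_congr rfl fun k _ => by ring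

variable {Ω : Type*} [MeasurableSpace Ω] {P : Measure Ω} [IsProbabilityMeasure P]
  {u : Fin K → ℤ → Ω → ℝ} {v : ℤ → Ω → ℝ}

/-- The entries of the matrices of the limit equation. -/
theorem System.integrable_momentEntry (hdata : IsStationaryData P u v)
    (hst : ∀ j, IsStableModel (θbar j)) (k : ℤ) (j : Fin K) (r : Fin (S.n i + S.m i + 1))
    (c : Fin (S.n j + S.m j + 1)) :
    Integrable (S.momentEntry u i j θbar k r c) P ∧
      S.momentMatrix P u i j θbar k r c = momentPairing
        (fun a b m m' => ∫ ω, jointSignal u v a (-m) ω * jointSignal u v b (-m') ω ∂P)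
        (some i) (some j)
        (filterKernel S.h (S.κ i) (X ^ (S.n i + S.m i - (r : ℕ))) (den (θbar i) ^ 2))
        (filterKernel S.h (S.κ j) (X ^ (S.n j + S.m j - (c : ℕ)))
          (den (S.θstar j) * den (θbar j))) := by
  have h1 : IsStableRational (X ^ (S.n i + S.m i - (r : ℕ))) (den (θbar i) ^ 2) := by
    rw [sq]; exact S.isStableRational_stack i (hst i) (hst i) r
  have h2 := S.isStableRational_stack j (S.stable j) (hst j) c
  have hsub : ∀ a, ∀ᵐ ω ∂P, Subexponential fun k => jointSignal u v a k ω := fun a =>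
    hdata.ae_isTypical.mono fun ω hω => hω.subexponential a
  have hmom := integral_conv_mul_conv (hdata.measurable_jointSignal (some i))
    (hdata.measurable_jointSignal (some j)) (hdata.memLp_jointSignal (some i))
    (hdata.memLp_jointSignal (some j)) (hdata.integral_norm_mul_jointSignal_le (some i) (some j))
    (hsub (some i)) (hsub (some j)) (h1.geomBounded S.h_pos (S.intersample i))
    (h2.geomBounded S.h_pos (S.intersample j)) k
  simp only [hdata.integral_mul_jointSignal_sub] at hmom
  have hae : S.momentEntry u i j θbar k r c =ᵐ[P] fun ω =>
      conv (filterKernel S.h (S.κ i) (X ^ (S.n i + S.m i - (r : ℕ))) (den (θbar i) ^ 2))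
        (fun k => jointSignal u v (some i) k ω) k *
      conv (filterKernel S.h (S.κ j) (X ^ (S.n j + S.m j - (c : ℕ)))
        (den (S.θstar j) * den (θbar j))) (fun k => jointSignal u v (some j) k ω) k := by
    filter_upwards [hsub (some i), hsub (some j)] with ω hi hj
    rw [← h1.filterSample_eq_conv S.h_pos (S.intersample i) hi,
      ← h2.filterSample_eq_conv S.h_pos (S.intersample j) hj]
    rfl
  refine ⟨hmom.1.congr hae.symm, ?_⟩
  rw [System.momentMatrix, Matrix.of_apply, integral_congr_ae hae, hmom.2]
  rfl

end LimitEquation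

end SysId

/-! ### The theorem -/

open SysId
theorem theorem2 {Ω : Type*} [MeasurableSpace Ω] (P : Measure Ω) [IsProbabilityMeasure P]
    {K : ℕ} (S : System K) (u : Fin K → ℤ → Ω → ℝ) (v : ℤ → Ω → ℝ)
    (hdata : IsStationaryData P u v)
    (hpe : ∀ j, IsPersistentlyExciting P (u j) (2 * S.n j))
    (mth : Method) (l : ℕ) (i : Fin K) :
    -- for almost every realization of the data,
    ∀ᵐ ω ∂P,
      -- whatever the outer iterates `θ N l j` and the inner iterates `θs N s` for sample size `N`,
      ∀ (θ : ℕ → ℕ → ∀ j, Param (S.n j) (S.m j)) (θs : ℕ → ℕ → Param (S.n i) (S.m i)),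
      -- if for all large `N` the iterations for the `i`th submodel are run on the first `N`
      -- samples, with stable and coprime estimates, and converge to `θ_i^{l+1}`,
      (∀ᶠ N in atTop,
        S.IsIteration (fun j k => u j k ω)
          (S.output (fun j k => u j k ω) (fun k => v k ω)) mth i (S.blocks (θ N) l i) N (θs N) ∧
        (∀ s, IsStableModel (θs N s) ∧ IsCoprimeModel (θs N s)) ∧
        Tendsto (θs N) atTop (𝓝 (θ N (l + 1) i))) →
      -- then every limit point as `N → ∞` which is stable, with a coprime `i`th submodel,
      ∀ θbar : ∀ j, Param (S.n j) (S.m j),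
        MapClusterPt θbar atTop (fun N => S.blocks (θ N) l i) →
        (∀ j, IsStableModel (θbar j)) → IsCoprimeModel (θbar i) →
        -- satisfies the limit equation, in which all the expectations exist.
        ∀ k : ℤ,
          (∀ j r c, Integrable (S.momentEntry u i j θbar k r c) P) ∧
          ∑ j, (S.momentMatrix P u i j θbar k).mulVec (S.biasVector j (θbar j)) = 0 := by
  filter_upwards [hdata.ae_isTypical] with ω hω θ θs hit θbar hcl hst hco k
  refine ⟨fun j r c => (S.integrable_momentEntry hdata hst k j r c).1, ?_⟩
  -- An ultrafilter finer than `atTop` plays the role of a convergent subsequence.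
  obtain ⟨U, hU, hUlim⟩ := mapClusterPt_iff_ultrafilter.1 hcl
  have hblock : ∀ N, S.blocks (θ N) l i i = θ N (l + 1) i := fun N => if_pos le_rfl
  have hit' : ∀ᶠ N in (U : Filter ℕ), S.IsIteration
      (fun j k => jointSignal u v (some j) k ω)
      (S.output (fun j k => jointSignal u v (some j) k ω) (fun k => jointSignal u v none k ω)) mth i
        (S.blocks (θ N) l i) N (θs N) ∧
      Tendsto (θs N) atTop (𝓝 (S.blocks (θ N) l i i)) := by
    filter_upwards [hU hit] with N hN
    rw [hblock]
    exact ⟨hN.1, hN.2.2⟩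
  have hzero := S.sum_momentPairing_mul_biasVector_eq_zero hω
    (fun j m m' => hdata.integral_input_mul_disturbance j (-m) (-m')) hU hit' hUlim hst hco
  funext r
  rw [Finset.sum_apply, Pi.zero_apply, ← hzero r]
  refine Finset.sum_congr rfl fun j _ => ?_
  rw [Matrix.mulVec, dotProduct]
  refine Finset.sum_congr rfl fun c _ => ?_
  rw [(S.integrable_momentEntry hdata hst k j r c).2]
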